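/- Let $d\ge 2$, $T>0$, $r\in\,]0,1[$, $q\in[d,\infty[$ and $p\in[\frac{4}{1+r},\infty]$. Let $u_0\in L^q(\mathbb R^d)$ be a vector field, and let $u_1,u_2$ be two mild solutions on $]0,T[$ of the Navier–Stokes equations $$\partial_t u-\Delta u+\nabla(u\otimes u)+\nabla \pi=0,\qquad \nabla\cdot u=0,\qquad u(0)=u_0$$ on $\mathbb R^d$ (where $\pi$ is the pressure), with the same initial data $u_0$, such that $$u_1,u_2\in L^{\frac{2}{1-r}}\big([0,T],B_\infty^{-r,\infty}(\mathbb R^d)\big)\cap L^p\big([0,T],L^q(\mathbb R^d)\big).$$ Then there exists $\delta\in\,]0,T[$ such that $u_1(t)=u_2(t)$ for every $t\in[0,\delta]$. Here the following definitions are used. * $\mathbf E_2$ is the space of functions $f\in L^2_{loc}(\mathbb R^d)$ with $\sup_{x_0}\|1_{B(x_0,1)}f\|_{2}<\infty$ and $\|1_{B(x_0,1)}f\|_{2}\to0$ as $|x_0|\to\infty$. * A mild solution on $]0,T[$ with initial data $u_0$ is a function $u\in L^2_{loc}([0,T[,\mathbf E_2)$ which satisfies, for every $t\in[0,T[$ and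 in the sense of tempered distributions, $$u(t)=e^{t\Delta}u_0-\int_0^t e^{(t-s)\Delta}\,\mathbb P\,\nabla(u\otimes u)(s)\,ds .$$ In this formula $\nabla(u\otimes u)$ is the vector field with components $\sum_k\partial_k(u_ju_k)$, and $\mathbb P$ is the Leray projector, with symbol $\delta_{ij}-\xi_i\xi_j/|\xi|^2$; no divergence condition on $u_0$ or $u$ is used. * $B_\infty^{-r,\infty}(\mathbb R^d)$ is the space of tempered distributions $f$ with $\|f\|_{B_\infty^{-r,\infty}}=\sup_{j\ge-1}2^{-rj}\|\Delta_jf\|_{L^\infty}<\infty$, where, for a function $\varphi\in C_c^\infty(\mathbb R^d)$ equal to $1$ near the origin and $\psi(\xi)=\varphi(\xi/2)-\varphi(\xi)$, the operator $\Delta_j$ is the Fourier multiplier with symbol $\psi(2^{-j}\xi)$ if $j\ge0$, and $\Delta_{-1}$ is the Fourier multiplier with symbol $\varphi(\xi)$. -/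

import Mathlib

open MeasureTheory Set Filter Topology
open scoped ENNReal SchwartzMap FourierTransform

noncomputable section

namespace NavierStokes

/-- The space `ℝ^d` with its Euclidean norm. -/
abbrev Space (d : ℕ) := EuclideanSpace ℝ (Fin d)

/-- The values of vector fields on `ℝ^d`. Complex components are allowed; real vector fields are the
special case in which all components are real. -/
abbrev Vec (d : ℕ) := EuclideanSpace ℂ (Fin d)

variable {d : ℕ}

/-! ### Lebesgue and uniformly local Lebesgue spaces -/

/-- The tempered distribution `f` is the (locally integrable) function `g`. -/
def Represents (f : 𝓢'(Space d, Vec d)) (g : Space d → Vec d) : Prop :=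
  ∀ φ : 𝓢(Space d, ℂ), Integrable (fun x => φ x • g x) ∧ f φ = ∫ x, φ x • g x

/-- The `L^q` norm of a tempered distribution; it is `∞` when the distribution is not a function in
`L^q`. -/
def lqNorm (q : ℝ≥0∞) (f : 𝓢'(Space d, Vec d)) : ℝ≥0∞ :=
  ⨅ (g : Space d → Vec d) (_ : MemLp g q ∧ Represents f g), eLpNorm g q

/-- The uniformly local norm `sup_{x₀} ‖1_{B(x₀,1)} f‖_p`. -/
def ulocNorm (p : ℝ≥0∞) (f : Space d → Vec d) : ℝ≥0∞ :=
  ⨆ x₀ : Space d, eLpNorm f p (volume.restrict (Metric.ball x₀ 1))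

/-- The space `𝐄_p` of functions with finite uniformly local `L^p` norm for which
`‖1_{B(x₀,1)} f‖_p → 0` as `‖x₀‖ → ∞`. -/
structure MemE (p : ℝ≥0∞) (f : Space d → Vec d) : Prop where
  aestronglyMeasurable : AEStronglyMeasurable f
  ulocNorm_lt_top : ulocNorm p f < ∞
  tendsto_zero : Tendsto (fun x₀ => eLpNorm f p (volume.restrict (Metric.ball x₀ 1)))
    (cocompact (Space d)) (𝓝 0)

/-- The space `L²_loc([0,T[, 𝐄_2)`, for functions of time and space. -/
structure MemL2locE2 (T : ℝ) (U : ℝ → Space d → Vec d) : Prop where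
  aestronglyMeasurable :
    AEStronglyMeasurable (Function.uncurry U) ((volume.restrict (Ico 0 T)).prod volume)
  memE : ∀ᵐ t ∂volume.restrict (Ico 0 T), MemE 2 (U t)
  memLp : ∀ T' ∈ Ioo 0 T, MemLp (fun t => ulocNorm 2 (U t)) 2 (volume.restrict (Icc 0 T'))

/-! ### Besov spaces -/

/-- The functions `χ` which define a Littlewood-Paley decomposition: smooth, with compact support,
and equal to `1` on a neighbourhood of the origin. -/
structure IsCutoff (χ : Space d → ℝ) : Prop where
  contDiff : ContDiff ℝ (⊤ : ℕ∞) χ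
  hasCompactSupport : HasCompactSupport χ
  eventually_eq_one : ∀ᶠ ξ in 𝓝 0, χ ξ = 1

/-- The operator `S_j`, the Fourier multiplier with symbol `χ(ξ / 2^j)`. -/
def lowFreq (χ : Space d → ℝ) (j : ℕ) (f : 𝓢'(Space d, Vec d)) : 𝓢'(Space d, Vec d) :=
  TemperedDistribution.fourierMultiplierCLM (Vec d)
    (fun ξ => (χ (((2 : ℝ) ^ j)⁻¹ • ξ) : ℂ)) f

/-- The function `ψ(ξ) = χ(ξ / 2) - χ(ξ)`. -/
def annulusCutoff (χ : Space d → ℝ) (ξ : Space d) : ℝ :=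
  χ ((2 : ℝ)⁻¹ • ξ) - χ ξ

/-- The operator `Δ_j`, `j ≥ 0`, the Fourier multiplier with symbol `ψ(ξ / 2^j)`. -/
def dyadicBlock (χ : Space d → ℝ) (j : ℕ) (f : 𝓢'(Space d, Vec d)) : 𝓢'(Space d, Vec d) :=
  TemperedDistribution.fourierMultiplierCLM (Vec d)
    (fun ξ => (annulusCutoff χ (((2 : ℝ) ^ j)⁻¹ • ξ) : ℂ)) f

/-- The norm `sup_{j ≥ -1} 2^{sj} ‖Δ_j f‖_q` of the Besov space `B_q^{s,∞}`, where `Δ_{-1} = S_0`;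
it is finite exactly on this space. -/
def besovNorm (χ : Space d → ℝ) (s : ℝ) (q : ℝ≥0∞) (f : 𝓢'(Space d, Vec d)) : ℝ≥0∞ :=
  max ((2 : ℝ≥0∞) ^ (-s) * lqNorm q (lowFreq χ 0 f))
    (⨆ j : ℕ, (2 : ℝ≥0∞) ^ (s * j) * lqNorm q (dyadicBlock χ j f))

/-- The space `L_T^p X = L^p([0,T], X)`, where `N` is the extended norm which defines `X`. -/
def MemLpTime (T : ℝ) (p : ℝ≥0∞) (N : 𝓢'(Space d, Vec d) → ℝ≥0∞)
    (u : ℝ → 𝓢'(Space d, Vec d)) : Prop :=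
  MemLp (fun t => N (u t)) p (volume.restrict (Icc 0 T))

/-! ### Mild solutions of the Navier-Stokes equations -/

/-- The symbol of `e^{tΔ}`, for the Fourier transform with kernel `exp(-2πi⟨x,ξ⟩)`. -/
def heatSymbol (t : ℝ) (ξ : Space d) : ℂ :=
  (Real.exp (-(4 * Real.pi ^ 2 * t * ‖ξ‖ ^ 2)) : ℂ)

/-- The heat semi-group `e^{tΔ}`, `t ≥ 0`, on tempered distributions. -/
def heat (t : ℝ) (f : 𝓢'(Space d, Vec d)) : 𝓢'(Space d, Vec d) :=
  TemperedDistribution.fourierMultiplierCLM (Vec d) (heatSymbol t) f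

/-- The symbol `δ_{ij} - ξ_i ξ_j / |ξ|²` of the entry `ℙ_{ij}` of the Leray projector. -/
def leraySymbol (i j : Fin d) (ξ : Space d) : ℝ :=
  (if i = j then 1 else 0) - ξ i * ξ j / ‖ξ‖ ^ 2

/-- The symbol `2πi ξ_k` of `∂/∂x_k`. -/
def derivSymbol (k : Fin d) (ξ : Space d) : ℂ :=
  2 * Real.pi * Complex.I * (ξ k : ℂ)

/-- The convolution kernel of the operator `e^{τΔ} ℙ_{ij} ∂_k`, for `τ > 0`. -/
def oseenKernel (i j k : Fin d) (τ : ℝ) : Space d → ℂ :=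
  𝓕⁻ (fun ξ : Space d => heatSymbol τ ξ * (leraySymbol i j ξ : ℂ) * derivSymbol k ξ)

/-- The vector field `e^{τΔ} ℙ ∇F`, `τ > 0`, for a matrix field `F`, where `∇F` is the vector field
with components `∑_k ∂_k F_{jk}`. -/
def heatLerayDiv (τ : ℝ) (F : Space d → Fin d → Fin d → ℂ) (x : Space d) : Vec d :=
  WithLp.toLp 2 fun i => ∑ j, ∑ k, ∫ y, oseenKernel i j k τ (x - y) * F y j k

/-- The value at time `t` of the Oseen integral operator,
`-∫_0^t e^{(t-s)Δ} ℙ ∇F(s) ds`, paired with the test function `φ`: the integral in time is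
understood in the sense of tempered distributions. -/
def oseenIntegral (F : ℝ → Space d → Fin d → Fin d → ℂ) (t : ℝ) (φ : 𝓢(Space d, ℂ)) : Vec d :=
  -∫ s in (0 : ℝ)..t, ∫ x, φ x • heatLerayDiv (t - s) (F s) x

/-- The matrix field `u ⊗ v`, as a function of time and space. -/
def tensor (U V : ℝ → Space d → Vec d) : ℝ → Space d → Fin d → Fin d → ℂ :=
  fun s y j k => U s y j * V s y k

/-- `u` is a mild solution on `]0,T[` of the Navier-Stokes equations with initial data `u₀`:
it belongs to `L²_loc([0,T[, 𝐄_2)`, and for every `t ∈ [0,T[` the identity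
`u(t) = e^{tΔ} u₀ - ∫_0^t e^{(t-s)Δ} ℙ ∇(u ⊗ u)(s) ds` holds between tempered distributions. -/
def IsMildSolution (T : ℝ) (u₀ : 𝓢'(Space d, Vec d)) (u : ℝ → 𝓢'(Space d, Vec d)) : Prop :=
  ∃ U : ℝ → Space d → Vec d, MemL2locE2 T U ∧
    (∀ᵐ t ∂volume.restrict (Ico 0 T), Represents (u t) (U t)) ∧
    ∀ t ∈ Ico 0 T, ∀ φ : 𝓢(Space d, ℂ),
      u t φ = heat t u₀ φ + oseenIntegral (tensor U U) t φ

end NavierStokes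

end

open NavierStokes

open scoped NNReal

namespace NavierStokes

section

/-! ### Integral inequalities -/

/-! The two solutions are not compared with each other: on a short interval each is shown to agree
with a third, better solution `v`. Since `q ≥ d`, Kato's fixed point argument produces from `u₀` a
solution `v` bounded in `L^q` with `‖v(t)‖_∞ ≤ b t^{-1/2}`, where `b` is as small as desired once
the interval is short (`exists_katoSolution`). The smallness comes from the density of bounded
functions in `L^q`, so the critical case `q = d` is included.

Let `U` be one of the given solutions and `w = U - v`. Then `w` is minus the Duhamel integral of `U
⊗ U - v ⊗ v = w ⊗ w + v ⊗ w + w ⊗ v`. It is measured in `L^{q/2}` by a function `N(t)` that bounds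
both `t^{-σ/2} ‖w(t)‖` and the Hölder increments of `w(t)` of some order `σ` in `]r, 1[`. The
product estimate `GoodKernel.exists_heatLerayDiv_tens_le` shows that `e^{τΔ} ℙ ∇(w ⊗ w)` has
increments of size `τ^{-(1+r)/2} M N`, where `M` bounds `w` in the Besov space of regularity `-r`:
because `σ > r`, the dyadic telescoping of `w ⊗ w` converges, and it is cut at the heat scale `√τ`.
The mixed terms only use the sup bound of `v`.

Hence every majorant `N` of `w` yields a new one, `majorantStep`: a fractional integral of `m N`,
with `m` in `L^{2/(1-r)}` in time, plus small multiples of integrals with kernels homogeneous of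
degree `-1`. On `L^a`, with `1/a = (r+σ)/2`, the Hardy-Littlewood-Sobolev inequality controls the
former and Hardy's inequality the latter (`exists_lintegral_majorantStep_le`). The resulting factor
is at most `1/2` when `b` and the interval are small.

The exponent `4/(1+r)` puts `U ⊗ U` in `L^{2/(1+r)}` in time with values in `L^{q/2}`, which is what
a first majorant in `L^a` requires (`exists_isMajorant`). Iterating forces `w = 0` almost everywhere
(`ae_eq_zero_of_isMajorant`). Equality at every time follows, because the integral equation at time
`t` only sees the solution almost everywhere on `]0, t[`. -/

theorem rpow_one_sub_le_of_le_mul_rpow {A R : ℝ≥0∞} {θ : ℝ} (hA : A ≠ ∞) (hθ1 : θ < 1)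
    (h : A ≤ R * A ^ θ) : A ^ (1 - θ) ≤ R := by
  rcases eq_or_ne A 0 with h0 | h0
  · rw [h0, ENNReal.zero_rpow_of_pos (by linarith)]; exact zero_le
  · rw [ENNReal.rpow_sub _ _ h0 hA, ENNReal.rpow_one]
    exact ENNReal.div_le_of_le_mul h

/-- Truncations `min G n` on sets of finite measure exhaust the integral of `G ^ p`. -/
theorem lintegral_rpow_le_of_truncation {β : Type*} [MeasurableSpace β] {ν : Measure β}
    [SigmaFinite ν] {G : β → ℝ≥0∞} (hG : Measurable G) {p : ℝ} (hp : 0 < p) {B : ℝ≥0∞}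
    (h : ∀ g : β → ℝ≥0∞, Measurable g → g ≤ G → ∫⁻ y, g y ^ p ∂ν ≠ ∞ →
      ∫⁻ y, g y ^ p ∂ν ≤ B) : ∫⁻ y, G y ^ p ∂ν ≤ B := by
  let g : ℕ → β → ℝ≥0∞ := fun n => (spanningSets ν n).indicator (fun y => min (G y) n)
  have hgm : ∀ n, Measurable (g n) := fun n =>
    (hG.min measurable_const).indicator (measurableSet_spanningSets ν n)
  have hgG : ∀ n, g n ≤ G := fun n y => by
    by_cases hy : y ∈ spanningSets ν n <;> simp [g, hy]
  have hmono : Monotone g := fun m n hmn y => by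
    by_cases hy : y ∈ spanningSets ν m
    · have hy' := monotone_spanningSets ν hmn hy
      simp only [g, indicator_of_mem hy, indicator_of_mem hy']
      exact min_le_min_left _ (by exact_mod_cast hmn)
    · simp [g, hy]
  have hlim : ∀ y, ⨆ n, g n y = G y := fun y => by
    apply le_antisymm (iSup_le fun n => hgG n y)
    refine le_of_forall_lt fun c hc => ?_
    obtain ⟨n, hn⟩ := ENNReal.exists_nat_gt (ne_top_of_lt hc)
    have hy : y ∈ ⋃ i, spanningSets ν i := by simp [iUnion_spanningSets]
    obtain ⟨m, hm⟩ := mem_iUnion.1 hy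
    refine lt_of_lt_of_le ?_ (le_iSup (fun n => g n y) (max m n))
    simp only [g, indicator_of_mem (monotone_spanningSets ν (le_max_left m n) hm)]
    refine lt_min hc (hn.trans_le ?_)
    exact_mod_cast le_max_right m n
  have hbound : ∀ n, ∫⁻ y, g n y ^ p ∂ν ≤ B := fun n => by
    refine h _ (hgm n) (hgG n) ?_
    have : ∫⁻ y, g n y ^ p ∂ν ≤ ∫⁻ y, (spanningSets ν n).indicator (fun _ => (n : ℝ≥0∞) ^ p) y ∂ν := by
      refine lintegral_mono fun y => ?_
      by_cases hy : y ∈ spanningSets ν n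
      · simp only [g, indicator_of_mem hy]
        exact ENNReal.rpow_le_rpow (min_le_right _ _) hp.le
      · simp [g, hy, hp]
    refine ne_top_of_le_ne_top ?_ this
    rw [lintegral_indicator_const (measurableSet_spanningSets ν n)]
    exact ENNReal.mul_ne_top (ENNReal.rpow_ne_top_of_nonneg hp.le (by simp))
      (measure_spanningSets_lt_top ν n).ne
  have hsup : ∀ y, G y ^ p = ⨆ n, g n y ^ p := fun y => by
    rw [← hlim y]
    exact (ENNReal.orderIsoRpow p hp).map_iSup _
  simp_rw [hsup]
  rw [lintegral_iSup (fun n => (hgm n).pow_const p)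
    (fun m n hmn y => ENNReal.rpow_le_rpow (hmono hmn y) hp.le)]
  exact iSup_le hbound

/-- Minkowski's integral inequality. -/
theorem lintegral_rpow_lintegral_le {α β : Type*} [MeasurableSpace α] [MeasurableSpace β]
    {μ : Measure α} {ν : Measure β} [SFinite μ] [SigmaFinite ν] {F : α → β → ℝ≥0∞}
    (hF : Measurable (Function.uncurry F)) {p : ℝ} (hp : 1 ≤ p) :
    (∫⁻ y, (∫⁻ x, F x y ∂μ) ^ p ∂ν) ^ (1 / p) ≤ ∫⁻ x, (∫⁻ y, F x y ^ p ∂ν) ^ (1 / p) ∂μ := by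
  have hF' : Measurable (fun z : β × α => F z.2 z.1) := hF.comp measurable_swap
  rcases hp.eq_or_lt with rfl | hp1
  · simp only [ENNReal.rpow_one, div_one]
    rw [lintegral_lintegral_swap hF'.aemeasurable]
  have hp0 : 0 < p := by linarith
  set R := ∫⁻ x, (∫⁻ y, F x y ^ p ∂ν) ^ (1 / p) ∂μ
  suffices h : ∫⁻ y, (∫⁻ x, F x y ∂μ) ^ p ∂ν ≤ R ^ p by
    calc _ ≤ (R ^ p) ^ (1 / p) := ENNReal.rpow_le_rpow h (by positivity)
      _ = R := by rw [← ENNReal.rpow_mul, mul_one_div_cancel hp0.ne', ENNReal.rpow_one]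
  have hpq : p.HolderConjugate (p / (p - 1)) := Real.HolderConjugate.conjExponent hp1
  refine lintegral_rpow_le_of_truncation hF'.lintegral_prod_right' hp0 fun g hg hgG hfin => ?_
  -- Write `g ^ p = g * g ^ (p - 1)`, enlarge the first factor to the full integral and apply
  -- Hölder: the integral of `g ^ p` is at most `R` times a lower power of itself. That power can be
  -- divided out because the truncation has finite norm.
  have key : ∫⁻ y, g y ^ p ∂ν ≤ R * (∫⁻ y, g y ^ p ∂ν) ^ (1 - 1 / p) := by
    calc ∫⁻ y, g y ^ p ∂ν ≤ ∫⁻ y, (∫⁻ x, F x y ∂μ) * g y ^ (p - 1) ∂ν := by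
          refine lintegral_mono fun y => ?_
          calc g y ^ p = g y ^ (1 + (p - 1)) := by congr 1; ring
            _ = g y * g y ^ (p - 1) := by
              rw [ENNReal.rpow_add_of_nonneg _ _ zero_le_one (by linarith), ENNReal.rpow_one]
            _ ≤ _ := by gcongr; exact hgG y
      _ = ∫⁻ y, ∫⁻ x, F x y * g y ^ (p - 1) ∂μ ∂ν := by
          refine lintegral_congr fun y => ?_
          rw [lintegral_mul_const _ (hF.of_uncurry_right)]
      _ = ∫⁻ x, ∫⁻ y, F x y * g y ^ (p - 1) ∂ν ∂μ := by
          refine lintegral_lintegral_swap ?_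
          exact (hF'.mul ((hg.comp measurable_fst).pow_const _)).aemeasurable
      _ ≤ ∫⁻ x, (∫⁻ y, F x y ^ p ∂ν) ^ (1 / p) * (∫⁻ y, g y ^ p ∂ν) ^ (1 - 1 / p) ∂μ := by
          refine lintegral_mono fun x => ?_
          refine (ENNReal.lintegral_mul_le_Lp_mul_Lq ν hpq
            (hF.of_uncurry_left).aemeasurable (hg.pow_const _).aemeasurable).trans ?_
          have e1 : 1 / (p / (p - 1)) = 1 - 1 / p := by field_simp
          have e2 : (p - 1) * (p / (p - 1)) = p := by
            have : p - 1 ≠ 0 := by linarith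
            field_simp
          simp_rw [← ENNReal.rpow_mul, e1, e2]
          exact le_rfl
      _ = _ := by
          rw [lintegral_mul_const]
          exact (Measurable.lintegral_prod_right' (f := fun z : α × β => F z.1 z.2 ^ p)
            (hF.pow_const p)).pow_const _
  have h1 : (1 : ℝ) - 1 / p < 1 := by have := one_div_pos.2 hp0; linarith
  have := rpow_one_sub_le_of_le_mul_rpow hfin h1 key
  rw [sub_sub_cancel] at this
  calc _ = ((∫⁻ y, g y ^ p ∂ν) ^ (1 / p)) ^ p := by
        rw [← ENNReal.rpow_mul, one_div_mul_cancel hp0.ne', ENNReal.rpow_one]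
    _ ≤ R ^ p := ENNReal.rpow_le_rpow this hp0.le

end

section

/-! ### Fractional integration in time -/

theorem measurable_ofReal_rpow (β : ℝ) : Measurable fun x : ℝ => ENNReal.ofReal (x ^ β) :=
  (measurable_id.pow_const β).ennreal_ofReal

/-- The one-sided kernel `x ^ (-α)`, `x > 0`. -/
noncomputable def timeKernel (α x : ℝ) : ℝ≥0∞ := (Ioi 0).indicator (fun x => ENNReal.ofReal (x ^ (-α))) x

theorem measurable_timeKernel (α : ℝ) : Measurable (timeKernel α) :=
  (measurable_ofReal_rpow _).indicator measurableSet_Ioi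

theorem lintegral_Ioc_ofReal_rpow {β R : ℝ} (hβ : -1 < β) (hR : 0 ≤ R) :
    ∫⁻ x in Ioc 0 R, ENNReal.ofReal (x ^ β) = ENNReal.ofReal (R ^ (β + 1) / (β + 1)) := by
  rw [← ofReal_integral_eq_lintegral_ofReal]
  · rw [← intervalIntegral.integral_of_le hR, integral_rpow (Or.inl hβ),
      Real.zero_rpow (by linarith), sub_zero]
  · rw [← IntegrableOn, ← intervalIntegrable_iff_integrableOn_Ioc_of_le hR]
    exact intervalIntegral.intervalIntegrable_rpow' hβ
  · filter_upwards [ae_restrict_mem measurableSet_Ioc] with x hx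
    exact Real.rpow_nonneg hx.1.le _

/-- Among sets of measure `R`, the kernel has its largest integral on `(0, R]`. It is enough to
split there: below `R` the kernel is integrated exactly, beyond `R` it is at most `R ^ (-α)`, and
both pieces scale like `R ^ (1 - α)`. -/
theorem setLIntegral_timeKernel_le {α : ℝ} (hα0 : 0 < α) (hα1 : α < 1) (E : Set ℝ) :
    ∫⁻ x in E, timeKernel α x ≤
      ENNReal.ofReal (1 / (1 - α) + 1) * volume E ^ (1 - α) := by
  have hc : 0 < 1 / (1 - α) + 1 := by have : 0 < 1 - α := by linarith
                                      positivity
  rcases eq_or_ne (volume E) ∞ with hE | hE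
  · rw [hE, ENNReal.top_rpow_of_pos (by linarith), ENNReal.mul_top]
    · exact le_top
    · simpa using hc
  rcases eq_or_ne (volume E) 0 with h0 | h0
  · rw [Measure.restrict_eq_zero.2 h0]; simp
  set R := (volume E).toReal
  have hR : 0 < R := ENNReal.toReal_pos h0 hE
  have hER : volume E = ENNReal.ofReal R := (ENNReal.ofReal_toReal hE).symm
  calc ∫⁻ x in E, timeKernel α x
      ≤ ∫⁻ x in E, ((Ioc 0 R).indicator (fun x => ENNReal.ofReal (x ^ (-α))) x
          + ENNReal.ofReal (R ^ (-α))) := by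
        refine lintegral_mono fun x => ?_
        by_cases hx : 0 < x
        · by_cases hxR : x ≤ R
          · simp [timeKernel, hx, hxR]
          · simp only [timeKernel, mem_Ioi, hx, indicator_of_mem]
            refine le_add_left (ENNReal.ofReal_le_ofReal ?_)
            exact Real.rpow_le_rpow_of_nonpos hR (not_le.1 hxR).le (by linarith)
        · simp [timeKernel, hx]
    _ ≤ (∫⁻ x in Ioc 0 R, ENNReal.ofReal (x ^ (-α))) + ENNReal.ofReal (R ^ (-α)) * volume E := by
        rw [lintegral_add_right _ measurable_const, setLIntegral_const]
        refine add_le_add ?_ le_rfl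
        rw [← lintegral_indicator measurableSet_Ioc]
        exact setLIntegral_le_lintegral _ _
    _ = _ := by
        rw [lintegral_Ioc_ofReal_rpow (by linarith) hR.le, hER,
          ENNReal.ofReal_rpow_of_pos hR, ← ENNReal.ofReal_mul (by positivity),
          ← ENNReal.ofReal_mul hc.le, ← ENNReal.ofReal_add (by
            have : 0 < 1 - α := by linarith
            rw [show -α + 1 = 1 - α by ring]; positivity) (by positivity)]
        congr 1
        have : R ^ (-α) * R = R ^ (1 - α) := by
          rw [← Real.rpow_add_one hR.ne']; congr 1; ring
        rw [this, show -α + 1 = 1 - α by ring]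
        ring

theorem lintegral_level {p : ℝ} (hp : 0 < p) (x : ℝ≥0∞) :
    ∫⁻ a in Ioi (0 : ℝ), {a : ℝ | ENNReal.ofReal a < x}.indicator
      (fun a => ENNReal.ofReal (a ^ (p - 1))) a = ENNReal.ofReal (1 / p) * x ^ p := by
  have hfin : ∀ R : ℝ, 0 ≤ R → ∫⁻ a in Ioc (0 : ℝ) R, ENNReal.ofReal (a ^ (p - 1)) =
      ENNReal.ofReal (1 / p) * (ENNReal.ofReal R) ^ p := fun R hR => by
    rw [lintegral_Ioc_ofReal_rpow (by linarith) hR, ENNReal.ofReal_rpow_of_nonneg hR hp.le,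
      ← ENNReal.ofReal_mul (by positivity), sub_add_cancel]
    congr 1; ring
  have hms : MeasurableSet {a : ℝ | ENNReal.ofReal a < x} :=
    measurableSet_lt ENNReal.measurable_ofReal measurable_const
  rw [lintegral_indicator hms, Measure.restrict_restrict hms]
  rcases eq_or_ne x ∞ with rfl | hx
  · rw [ENNReal.top_rpow_of_pos hp, ENNReal.mul_top (by simpa using hp), eq_top_iff]
    refine ENNReal.le_of_forall_nnreal_lt fun c _ => ?_
    -- Chosen so that `R ^ p / p = c`: the integral up to `R` already reaches the arbitrary bound
    -- `c`.
    set R := (p * c) ^ (1 / p) with hR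
    have hR0 : 0 ≤ R := by positivity
    calc (c : ℝ≥0∞) = ENNReal.ofReal (1 / p) * (ENNReal.ofReal R) ^ p := by
          rw [ENNReal.ofReal_rpow_of_nonneg hR0 hp.le, ← ENNReal.ofReal_mul (by positivity), hR,
            ← Real.rpow_mul (by positivity), one_div_mul_cancel hp.ne', Real.rpow_one,
            ← mul_assoc, one_div_mul_cancel hp.ne', one_mul, ENNReal.ofReal_coe_nnreal]
      _ = _ := (hfin R hR0).symm
      _ ≤ _ := by
          refine lintegral_mono_set fun a ha => ?_
          simp [ha.1]
  · lift x to ℝ≥0 using hx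
    have : ({a : ℝ | ENNReal.ofReal a < x} ∩ Ioi 0) = Ioo 0 (x : ℝ) := by
      ext a
      simp only [mem_inter_iff, mem_ofPred_eq, mem_Ioi, mem_Ioo]
      constructor
      · rintro ⟨h1, h2⟩
        refine ⟨h2, ?_⟩
        rw [← ENNReal.ofReal_coe_nnreal] at h1
        exact (ENNReal.ofReal_lt_ofReal_iff_of_nonneg h2.le).1 h1
      · rintro ⟨h1, h2⟩
        refine ⟨?_, h1⟩
        rw [← ENNReal.ofReal_coe_nnreal]
        exact (ENNReal.ofReal_lt_ofReal_iff_of_nonneg h1.le).2 h2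
    rw [this, restrict_Ioo_eq_restrict_Ioc]
    exact (hfin _ x.coe_nonneg).trans (by rw [ENNReal.ofReal_coe_nnreal])

/-- The distribution function of `f`. -/
noncomputable def distrib (f : ℝ → ℝ≥0∞) (a : ℝ) : ℝ≥0∞ := volume {t | ENNReal.ofReal a < f t}

theorem measurable_level {f : ℝ → ℝ≥0∞} (hf : Measurable f) :
    MeasurableSet {z : ℝ × ℝ | ENNReal.ofReal z.1 < f z.2} :=
  measurableSet_lt (ENNReal.measurable_ofReal.comp measurable_fst) (hf.comp measurable_snd)

theorem measurable_distrib {f : ℝ → ℝ≥0∞} (hf : Measurable f) : Measurable (distrib f) :=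
  measurable_measure_prodMk_left (measurable_level hf)

/-- The layer-cake formula: Fubini on the region under the graph of `f`, with `lintegral_level`
evaluating the inner integral. -/
theorem lintegral_distrib_mul {f : ℝ → ℝ≥0∞} (hf : Measurable f) {p : ℝ} (hp : 0 < p) :
    ∫⁻ a in Ioi (0 : ℝ), distrib f a * ENNReal.ofReal (a ^ (p - 1)) =
      ENNReal.ofReal (1 / p) * ∫⁻ t, f t ^ p := by
  have hm : Measurable fun z : ℝ × ℝ => {z : ℝ × ℝ | ENNReal.ofReal z.1 < f z.2}.indicator
      (fun z => ENNReal.ofReal (z.1 ^ (p - 1))) z :=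
    ((measurable_fst.pow_const _).ennreal_ofReal).indicator (measurable_level hf)
  calc _ = ∫⁻ a in Ioi (0 : ℝ), ∫⁻ t, {z : ℝ × ℝ | ENNReal.ofReal z.1 < f z.2}.indicator
          (fun z => ENNReal.ofReal (z.1 ^ (p - 1))) (a, t) := by
        refine lintegral_congr fun a => ?_
        have : (fun t => {z : ℝ × ℝ | ENNReal.ofReal z.1 < f z.2}.indicator
          (fun z => ENNReal.ofReal (z.1 ^ (p - 1))) (a, t)) =
          {t | ENNReal.ofReal a < f t}.indicator (fun _ => ENNReal.ofReal (a ^ (p - 1))) := by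
          ext t; simp [indicator]
        rw [this, lintegral_indicator_const (measurableSet_lt measurable_const hf), mul_comm,
          distrib]
    _ = ∫⁻ t, ∫⁻ a in Ioi (0 : ℝ), {z : ℝ × ℝ | ENNReal.ofReal z.1 < f z.2}.indicator
          (fun z => ENNReal.ofReal (z.1 ^ (p - 1))) (a, t) :=
        lintegral_lintegral_swap hm.aemeasurable
    _ = ∫⁻ t, ENNReal.ofReal (1 / p) * f t ^ p := by
        refine lintegral_congr fun t => ?_
        rw [← lintegral_level hp]
        rfl
    _ = _ := lintegral_const_mul _ (hf.pow_const p)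

/-- One half of the Hardy-Littlewood-Sobolev bound, written for distribution functions. Hölder with
exponents `1 / (1 - α)` and `1 / α` trades `W ^ (1 - α)` for the normalized integral of `W`, and the
endpoint `x ^ (p / q)` is the one for which the remaining power of `x` is exactly `x ^ (p - 1)`, the
weight that normalizes `V`. -/
theorem lintegral_distrib_bilinear_le {α p q : ℝ} (hα0 : 0 < α) (hα1 : α < 1) (hp : 1 < p)
    (hq : 1 < q) (hpq : 1 / p + 1 / q = 2 - α) :
    ∃ c : ℝ≥0, ∀ V W : ℝ → ℝ≥0∞, Measurable V → Measurable W →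
      ∫⁻ x in Ioi (0 : ℝ), V x * ENNReal.ofReal (x ^ (p - 1)) ≤ 1 →
      ∫⁻ y in Ioi (0 : ℝ), W y * ENNReal.ofReal (y ^ (q - 1)) ≤ 1 →
      ∫⁻ x in Ioi (0 : ℝ), V x * ∫⁻ y in Ioc 0 (x ^ (p / q)), W y ^ (1 - α) ≤ c := by
  have hp0 : 0 < p := by linarith
  have hq0 : 0 < q := by linarith
  set m := (q - 1) * (1 - α) with hm
  -- This is `p > 1` in disguise; it makes `y ^ (-m / α)` integrable at the origin.
  have hmα : m < α := by
    have h1 : 1 / p < 1 := by rw [div_lt_one hp0]; exact hp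
    have h2 : 1 - α < 1 / q := by linarith
    rw [lt_div_iff₀ hq0] at h2
    nlinarith
  set e := 1 - m / α with he
  have he0 : 0 < e := by rw [he, sub_pos, div_lt_one hα0]; exact hmα
  refine ⟨Real.toNNReal ((1 / e) ^ α), fun V W hV hW hV1 hW1 => ?_⟩
  have hconj : (1 / (1 - α)).HolderConjugate (1 / α) := by
    rw [Real.holderConjugate_iff]
    refine ⟨by rw [lt_div_iff₀ (by linarith)]; linarith, by simp⟩
  have inner : ∀ x : ℝ, 0 < x → ∫⁻ y in Ioc 0 (x ^ (p / q)), W y ^ (1 - α) ≤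
      ENNReal.ofReal ((1 / e) ^ α) * ENNReal.ofReal (x ^ (p - 1)) := by
    intro x hx
    set Y := x ^ (p / q) with hY
    have hY0 : 0 < Y := by positivity
    calc ∫⁻ y in Ioc 0 Y, W y ^ (1 - α)
        = ∫⁻ y in Ioc 0 Y, (W y * ENNReal.ofReal (y ^ (q - 1))) ^ (1 - α)
            * ENNReal.ofReal (y ^ (-m)) := by
          refine setLIntegral_congr_fun measurableSet_Ioc fun y hy => ?_
          have hy0 : 0 < y := hy.1
          rw [ENNReal.mul_rpow_of_nonneg _ _ (by linarith), mul_assoc,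
            ENNReal.ofReal_rpow_of_pos (by positivity), ← ENNReal.ofReal_mul (by positivity),
            ← Real.rpow_mul hy0.le, ← Real.rpow_add hy0, ← hm]
          simp
      _ ≤ (∫⁻ y in Ioc 0 Y, W y * ENNReal.ofReal (y ^ (q - 1))) ^ (1 - α) *
          (∫⁻ y in Ioc 0 Y, ENNReal.ofReal (y ^ (-(m / α)))) ^ α := by
          refine (ENNReal.lintegral_mul_le_Lp_mul_Lq _ hconj ?_ ?_).trans (le_of_eq ?_)
          · exact ((hW.mul (measurable_ofReal_rpow _)).pow_const _).aemeasurable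
          · exact (measurable_ofReal_rpow _).aemeasurable
          · simp only [one_div_one_div]
            congr 2
            · refine lintegral_congr fun y => ?_
              rw [← ENNReal.rpow_mul, mul_one_div_cancel (by linarith), ENNReal.rpow_one]
            · refine setLIntegral_congr_fun measurableSet_Ioc fun y hy => ?_
              have hy0 : 0 < y := hy.1
              rw [ENNReal.ofReal_rpow_of_pos (by positivity), ← Real.rpow_mul hy0.le]
              congr 2; ring
      _ ≤ 1 * (ENNReal.ofReal (Y ^ e / e)) ^ α := by
          gcongr
          · refine ENNReal.rpow_le_one ((lintegral_mono_set ?_).trans hW1) (by linarith)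
            exact Ioc_subset_Ioi_self
          · rw [lintegral_Ioc_ofReal_rpow (by linarith) hY0.le, show -(m / α) + 1 = e by ring]
      _ = _ := by
          rw [one_mul, ENNReal.ofReal_rpow_of_pos (by positivity),
            ← ENNReal.ofReal_mul (by positivity)]
          congr 1
          rw [div_eq_mul_one_div, mul_comm, Real.mul_rpow (by positivity) (by positivity)]
          congr 1
          rw [hY, ← Real.rpow_mul hx.le, ← Real.rpow_mul hx.le]
          congr 1
          have : e * α = α - m := by rw [he]; field_simp
          rw [mul_assoc, this, hm]
          have h3 : q * p * (2 - α) = q + p := by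
            rw [← hpq]; field_simp
          field_simp
          linear_combination -h3
  calc _ ≤ ∫⁻ x in Ioi (0 : ℝ), ENNReal.ofReal ((1 / e) ^ α) * (V x * ENNReal.ofReal (x ^ (p - 1))) := by
        refine setLIntegral_mono' measurableSet_Ioi fun x hx => ?_
        rw [mul_left_comm]
        gcongr
        exact inner x hx
    _ ≤ ENNReal.ofReal ((1 / e) ^ α) * 1 := by
        rw [lintegral_const_mul' _ _ ENNReal.ofReal_ne_top]
        gcongr
    _ = _ := by rw [mul_one]; rfl

end

/-! ### The Hardy-Littlewood-Sobolev inequality -/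

section

theorem lintegral_indicator_level (x : ℝ≥0∞) :
    ∫⁻ a in Ioi (0 : ℝ), {a : ℝ | ENNReal.ofReal a < x}.indicator 1 a = x := by
  have := lintegral_level one_pos x
  simpa [Pi.one_def] using this

/-- The bound for one set is applied either in `s` for fixed `t` or in `t` for fixed `s`. Both
outcomes are kept: each is the useful one on its own part of the quadrant of levels. -/
theorem setLIntegral_setLIntegral_timeKernel_le {α : ℝ} (hα0 : 0 < α) (hα1 : α < 1)
    {E F : Set ℝ} :
    ∫⁻ t in E, ∫⁻ s in F, timeKernel α (t - s) ≤
      ENNReal.ofReal (1 / (1 - α) + 1) *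
        min (volume E * volume F ^ (1 - α)) (volume F * volume E ^ (1 - α)) := by
  have hk := measurable_timeKernel α
  have h1 : ∀ (G : Set ℝ) (t : ℝ), ∫⁻ s in G, timeKernel α (t - s) ≤
      ENNReal.ofReal (1 / (1 - α) + 1) * volume G ^ (1 - α) := fun G t => by
    have hmp := (Measure.measurePreserving_sub_left (volume : Measure ℝ) t)
    have : ∫⁻ s in G, timeKernel α (t - s) = ∫⁻ x in (fun x => t - x) ⁻¹' G, timeKernel α x := by
      rw [← hmp.setLIntegral_comp_preimage_emb (measurableEmbedding_subLeft t)]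
      congr 2
      ext x; simp
    rw [this]
    refine (setLIntegral_timeKernel_le hα0 hα1 _).trans ?_
    rw [hmp.measure_preimage_emb (measurableEmbedding_subLeft t)]
  have h2 : ∀ (G : Set ℝ) (s : ℝ), ∫⁻ t in G, timeKernel α (t - s) ≤
      ENNReal.ofReal (1 / (1 - α) + 1) * volume G ^ (1 - α) := fun G s => by
    have hmp := (measurePreserving_sub_right (volume : Measure ℝ) s)
    have : ∫⁻ t in G, timeKernel α (t - s) = ∫⁻ x in (fun x => x + s) ⁻¹' G, timeKernel α x := by
      rw [← hmp.setLIntegral_comp_preimage_emb (measurableEmbedding_subRight s) (timeKernel α)]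
      congr 2
      ext x; simp
    rw [this]
    refine (setLIntegral_timeKernel_le hα0 hα1 _).trans ?_
    rw [(measurePreserving_add_right (volume : Measure ℝ) s).measure_preimage_emb
      (measurableEmbedding_addRight s)]
  rw [mul_min]
  refine le_min ?_ ?_
  · calc _ ≤ ∫⁻ t in E, ENNReal.ofReal (1 / (1 - α) + 1) * volume F ^ (1 - α) :=
        lintegral_mono fun t => h1 F t
      _ = _ := by rw [setLIntegral_const]; ring
  · rw [lintegral_lintegral_swap (f := fun t s => timeKernel α (t - s))
      (hk.comp (measurable_fst.sub measurable_snd)).aemeasurable]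
    calc _ ≤ ∫⁻ t in F, ENNReal.ofReal (1 / (1 - α) + 1) * volume E ^ (1 - α) :=
        lintegral_mono fun t => h2 E t
      _ = _ := by rw [setLIntegral_const]; ring

/-- A layer-cake decomposition of both functions and Fubini reduce the bilinear form to pairs of
level sets. -/
theorem lintegral_lintegral_timeKernel_le {α : ℝ} (hα0 : 0 < α) (hα1 : α < 1)
    {f g : ℝ → ℝ≥0∞} (hf : Measurable f) (hg : Measurable g) :
    ∫⁻ t, ∫⁻ s, timeKernel α (t - s) * (f t * g s) ≤
      ∫⁻ x in Ioi (0 : ℝ), ∫⁻ y in Ioi (0 : ℝ), ENNReal.ofReal (1 / (1 - α) + 1) *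
        min (distrib f x * distrib g y ^ (1 - α)) (distrib g y * distrib f x ^ (1 - α)) := by
  have hk := measurable_timeKernel α
  let If : ℝ → ℝ → ℝ≥0∞ := fun a t => {a : ℝ | ENNReal.ofReal a < f t}.indicator 1 a
  let Ig : ℝ → ℝ → ℝ≥0∞ := fun a t => {a : ℝ | ENNReal.ofReal a < g t}.indicator 1 a
  have hI : ∀ {h : ℝ → ℝ≥0∞}, Measurable h → Measurable fun z : ℝ × ℝ =>
      {a : ℝ | ENNReal.ofReal a < h z.2}.indicator (1 : ℝ → ℝ≥0∞) z.1 := fun {h} hh => by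
    have : (fun z : ℝ × ℝ => {a : ℝ | ENNReal.ofReal a < h z.2}.indicator (1 : ℝ → ℝ≥0∞) z.1) =
        {z : ℝ × ℝ | ENNReal.ofReal z.1 < h z.2}.indicator 1 := by
      ext z; simp [indicator]
    rw [this]
    exact measurable_const.indicator (measurable_level hh)
  have hIf : Measurable fun z : ℝ × ℝ => If z.1 z.2 := hI hf
  have hIg : Measurable fun z : ℝ × ℝ => Ig z.1 z.2 := hI hg
  have step : ∀ t s, timeKernel α (t - s) * (f t * g s) =
      ∫⁻ x in Ioi (0 : ℝ), ∫⁻ y in Ioi (0 : ℝ), timeKernel α (t - s) * (If x t * Ig y s) := by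
    intro t s
    have hft : Measurable fun x => If x t := hIf.comp measurable_prodMk_right
    have hgs : Measurable fun x => Ig x s := hIg.comp measurable_prodMk_right
    simp_rw [← mul_assoc]
    simp_rw [lintegral_const_mul _ hgs]
    rw [lintegral_mul_const _ (hft.const_mul _), lintegral_const_mul _ hft]
    simp only [If, Ig, lintegral_indicator_level]
  have hm4 : Measurable fun z : (ℝ × ℝ) × (ℝ × ℝ) =>
      timeKernel α (z.1.1 - z.1.2) * (If z.2.1 z.1.1 * Ig z.2.2 z.1.2) := by
    have m1 : Measurable fun z : (ℝ × ℝ) × (ℝ × ℝ) => timeKernel α (z.1.1 - z.1.2) :=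
      hk.comp (by fun_prop)
    have m2 : Measurable fun z : (ℝ × ℝ) × (ℝ × ℝ) => If z.2.1 z.1.1 :=
      hIf.comp (f := fun z : (ℝ × ℝ) × (ℝ × ℝ) => (z.2.1, z.1.1)) (by fun_prop)
    have m3 : Measurable fun z : (ℝ × ℝ) × (ℝ × ℝ) => Ig z.2.2 z.1.2 :=
      hIg.comp (f := fun z : (ℝ × ℝ) × (ℝ × ℝ) => (z.2.2, z.1.2)) (by fun_prop)
    exact m1.mul (m2.mul m3)
  calc ∫⁻ t, ∫⁻ s, timeKernel α (t - s) * (f t * g s)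
      = ∫⁻ t, ∫⁻ s, ∫⁻ x in Ioi (0 : ℝ), ∫⁻ y in Ioi (0 : ℝ),
          timeKernel α (t - s) * (If x t * Ig y s) := by simp_rw [step]
    _ = ∫⁻ z : ℝ × ℝ, ∫⁻ w, timeKernel α (z.1 - z.2) * (If w.1 z.1 * Ig w.2 z.2)
          ∂((volume.restrict (Ioi (0 : ℝ))).prod (volume.restrict (Ioi (0 : ℝ)))) := by
        rw [Measure.volume_eq_prod, lintegral_prod _ hm4.lintegral_prod_right.aemeasurable]
        refine lintegral_congr fun t => lintegral_congr fun s => ?_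
        have m5 : Measurable fun w : ℝ × ℝ => timeKernel α (t - s) * (If w.1 t * Ig w.2 s) :=
          hm4.comp (measurable_prodMk_left (x := (t, s)))
        rw [lintegral_prod _ m5.aemeasurable]
    _ = ∫⁻ w : ℝ × ℝ, (∫⁻ z : ℝ × ℝ, timeKernel α (z.1 - z.2) * (If w.1 z.1 * Ig w.2 z.2))
          ∂((volume.restrict (Ioi (0 : ℝ))).prod (volume.restrict (Ioi (0 : ℝ)))) :=
        lintegral_lintegral_swap hm4.aemeasurable
    _ = ∫⁻ x in Ioi (0 : ℝ), ∫⁻ y in Ioi (0 : ℝ), ∫⁻ t, ∫⁻ s,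
          timeKernel α (t - s) * (If x t * Ig y s) := by
        rw [lintegral_prod _ hm4.lintegral_prod_left.aemeasurable]
        refine lintegral_congr fun x => lintegral_congr fun y => ?_
        have m5 : Measurable fun z : ℝ × ℝ => timeKernel α (z.1 - z.2) * (If x z.1 * Ig y z.2) :=
          hm4.comp (measurable_prodMk_right (y := (x, y)))
        rw [Measure.volume_eq_prod, lintegral_prod _ m5.aemeasurable]
    _ ≤ _ := by
        refine lintegral_mono fun x => lintegral_mono fun y => ?_
        have hF : MeasurableSet {t | ENNReal.ofReal x < f t} := measurableSet_lt measurable_const hf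
        have hG : MeasurableSet {t | ENNReal.ofReal y < g t} := measurableSet_lt measurable_const hg
        refine le_trans (le_of_eq ?_) (setLIntegral_setLIntegral_timeKernel_le hα0 hα1
          (E := {t | ENNReal.ofReal x < f t}) (F := {t | ENNReal.ofReal y < g t}))
        rw [← lintegral_indicator hF]
        refine lintegral_congr fun t => ?_
        by_cases ht : ENNReal.ofReal x < f t
        · rw [indicator_of_mem (by exact ht), ← lintegral_indicator hG]
          refine lintegral_congr fun s => ?_
          by_cases hs : ENNReal.ofReal y < g s <;> simp [If, Ig, ht, hs]
        · rw [indicator_of_notMem (by exact ht)]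
          simp [If, ht]

/-- The bilinear form of the Hardy-Littlewood-Sobolev inequality, for normalized functions. -/
theorem exists_lintegral_timeKernel_le {α p q : ℝ} (hα0 : 0 < α) (hα1 : α < 1) (hp : 1 < p)
    (hq : 1 < q) (hpq : 1 / p + 1 / q = 2 - α) :
    ∃ c : ℝ≥0, ∀ f g : ℝ → ℝ≥0∞, Measurable f → Measurable g →
      ∫⁻ t, f t ^ p ≤ 1 → ∫⁻ t, g t ^ q ≤ 1 →
      ∫⁻ t, ∫⁻ s, timeKernel α (t - s) * (f t * g s) ≤ c := by
  obtain ⟨c₁, hc₁⟩ := lintegral_distrib_bilinear_le hα0 hα1 hp hq hpq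
  obtain ⟨c₂, hc₂⟩ := lintegral_distrib_bilinear_le hα0 hα1 hq hp (by rw [add_comm]; exact hpq)
  have hp0 : 0 < p := by linarith
  have hq0 : 0 < q := by linarith
  refine ⟨Real.toNNReal (1 / (1 - α) + 1) * (c₁ + c₂), fun f g hf hg hf1 hg1 => ?_⟩
  have hV := measurable_distrib hf
  have hW := measurable_distrib hg
  have norm1 : ∀ {h : ℝ → ℝ≥0∞} {e : ℝ}, Measurable h → 1 < e → ∫⁻ t, h t ^ e ≤ 1 →
      ∫⁻ a in Ioi (0 : ℝ), distrib h a * ENNReal.ofReal (a ^ (e - 1)) ≤ 1 := by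
    intro h e hh he h1
    rw [lintegral_distrib_mul hh (by linarith)]
    refine mul_le_one' ?_ h1
    rw [ENNReal.ofReal_le_one, div_le_one (by linarith)]
    exact he.le
  have meas : ∀ {V W : ℝ → ℝ≥0∞} {e : ℝ}, Measurable V → Measurable W → Measurable fun z : ℝ × ℝ =>
      (Ioc 0 (z.1 ^ e)).indicator (fun y => V z.1 * W y ^ (1 - α)) z.2 := by
    intro V W e hV hW
    have : (fun z : ℝ × ℝ => (Ioc 0 (z.1 ^ e)).indicator (fun y => V z.1 * W y ^ (1 - α)) z.2) =
        {z : ℝ × ℝ | 0 < z.2 ∧ z.2 ≤ z.1 ^ e}.indicator (fun z => V z.1 * W z.2 ^ (1 - α)) := by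
      ext z; simp [indicator]
    rw [this]
    refine ((hV.comp measurable_fst).mul ((hW.comp measurable_snd).pow_const _)).indicator ?_
    exact (measurableSet_lt measurable_const measurable_snd).inter
      (measurableSet_le measurable_snd (measurable_fst.pow_const _))
  have half : ∀ {V W : ℝ → ℝ≥0∞} {e : ℝ}, Measurable W → ∀ x : ℝ,
      ∫⁻ y in Ioi (0 : ℝ), (Ioc 0 (x ^ e)).indicator (fun y => V x * W y ^ (1 - α)) y =
      V x * ∫⁻ y in Ioc 0 (x ^ e), W y ^ (1 - α) := by
    intro V W e hW x
    rw [lintegral_indicator measurableSet_Ioc, Measure.restrict_restrict measurableSet_Ioc,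
      inter_eq_self_of_subset_left Ioc_subset_Ioi_self, lintegral_const_mul _ (hW.pow_const _)]
  refine (lintegral_lintegral_timeKernel_le hα0 hα1 hf hg).trans ?_
  simp_rw [lintegral_const_mul' _ _ ENNReal.ofReal_ne_top]
  rw [ENNReal.coe_mul]
  refine mul_le_mul' le_rfl ?_
  calc _ ≤ ∫⁻ x in Ioi (0 : ℝ), ∫⁻ y in Ioi (0 : ℝ),
        ((Ioc 0 (x ^ (p / q))).indicator (fun y => distrib f x * distrib g y ^ (1 - α)) y +
        (Ioc 0 (y ^ (q / p))).indicator (fun x => distrib g y * distrib f x ^ (1 - α)) x) := by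
        refine setLIntegral_mono' measurableSet_Ioi fun x hx => ?_
        refine setLIntegral_mono' measurableSet_Ioi fun y hy => ?_
        have hx0 : 0 < x := hx
        have hy0 : 0 < y := hy
        -- The quadrant is cut along `y = x ^ (p / q)`; on each side the minimum is replaced by the
        -- argument that `lintegral_distrib_bilinear_le` can integrate there.
        by_cases hxy : y ≤ x ^ (p / q)
        · have hmem : y ∈ Ioc 0 (x ^ (p / q)) := ⟨hy0, hxy⟩
          rw [indicator_of_mem hmem]
          exact le_add_right (min_le_left _ _)
        · have : x ≤ y ^ (q / p) := by
            calc x = (x ^ (p / q)) ^ (q / p) := by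
                  rw [← Real.rpow_mul hx0.le]; field_simp; simp
              _ ≤ _ := Real.rpow_le_rpow (by positivity) (not_le.1 hxy).le (by positivity)
          have hmem : x ∈ Ioc 0 (y ^ (q / p)) := ⟨hx0, this⟩
          rw [indicator_of_mem hmem]
          exact le_add_left (min_le_right _ _)
    _ = (∫⁻ x in Ioi (0 : ℝ), ∫⁻ y in Ioi (0 : ℝ),
        (Ioc 0 (x ^ (p / q))).indicator (fun y => distrib f x * distrib g y ^ (1 - α)) y) +
        ∫⁻ x in Ioi (0 : ℝ), ∫⁻ y in Ioi (0 : ℝ),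
        (Ioc 0 (y ^ (q / p))).indicator (fun x => distrib g y * distrib f x ^ (1 - α)) x := by
        rw [← lintegral_add_left (Measurable.lintegral_prod_right' (meas hV hW))]
        refine lintegral_congr fun x => ?_
        have m5 : Measurable fun y => (Ioc 0 (x ^ (p / q))).indicator
            (fun y => distrib f x * distrib g y ^ (1 - α)) y :=
          (meas hV hW).comp (measurable_prodMk_left (x := x))
        rw [lintegral_add_left m5]
    _ ≤ c₁ + c₂ := by
        refine add_le_add ?_ ?_
        · simp_rw [half hW]
          exact hc₁ _ _ hV hW (norm1 hf hp hf1) (norm1 hg hq hg1)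
        · have m5 : Measurable fun z : ℝ × ℝ => (Ioc 0 (z.2 ^ (q / p))).indicator
              (fun x => distrib g z.2 * distrib f x ^ (1 - α)) z.1 :=
            (meas hW hV).comp measurable_swap
          rw [lintegral_lintegral_swap (f := fun x y => (Ioc 0 (y ^ (q / p))).indicator
              (fun x => distrib g y * distrib f x ^ (1 - α)) x) m5.aemeasurable]
          simp_rw [half hV]
          exact hc₂ _ _ hW hV (norm1 hg hq hg1) (norm1 hf hp hf1)
    _ = _ := by simp

/-- The Hardy-Littlewood-Sobolev inequality on the line. -/
theorem exists_hardyLittlewoodSobolev {α a b : ℝ} (hα0 : 0 < α) (hα1 : α < 1) (hb : 1 < b)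
    (ha : 0 < a) (hab : 1 / a = 1 / b + α - 1) :
    ∃ c : ℝ≥0, ∀ g : ℝ → ℝ≥0∞, Measurable g →
      (∫⁻ t, (∫⁻ s, timeKernel α (t - s) * g s) ^ a) ^ (1 / a) ≤
        c * (∫⁻ s, g s ^ b) ^ (1 / b) := by
  have hb0 : 0 < b := by linarith
  have ha1 : 1 < a := by
    have : 1 / b < 1 := by rw [div_lt_one hb0]; exact hb
    have h1 : 1 / a < 1 := by linarith
    rwa [div_lt_one ha] at h1
  set p := a / (a - 1) with hp
  have hpa : a.HolderConjugate p := Real.HolderConjugate.conjExponent ha1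
  have hp1 : 1 < p := hpa.symm.lt
  have hp0 : 0 < p := by linarith
  have hpi : 1 / p = 1 - 1 / a := by rw [hp]; field_simp
  obtain ⟨c, hc⟩ := exists_lintegral_timeKernel_le hα0 hα1 hp1 hb (by rw [hpi, hab]; ring)
  -- The added `1` keeps the constant nonzero, so that the right side is infinite whenever the norm
  -- of `g` is.
  refine ⟨c + 1, fun g hg => ?_⟩
  have hk : Measurable fun z : ℝ × ℝ => timeKernel α (z.1 - z.2) :=
    (measurable_timeKernel α).comp (measurable_fst.sub measurable_snd)
  set B := (∫⁻ s, g s ^ b) ^ (1 / b) with hB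
  rcases eq_or_ne B ∞ with hBt | hBt
  · rw [hBt, ENNReal.mul_top (by simp)]; exact le_top
  rcases eq_or_ne B 0 with hB0 | hB0
  · have h0 : ∫⁻ s, g s ^ b = 0 := by
      rw [hB, ENNReal.rpow_eq_zero_iff] at hB0
      rcases hB0 with h | h
      · exact h.1
      · exact absurd h.2 (not_lt.2 (by positivity))
    rw [lintegral_eq_zero_iff (hg.pow_const b)] at h0
    have : ∀ t, ∫⁻ s, timeKernel α (t - s) * g s = 0 := fun t => by
      rw [← lintegral_zero (μ := (volume : Measure ℝ))]
      refine lintegral_congr_ae ?_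
      filter_upwards [h0] with s hs
      have : g s = 0 := by
        simpa [ENNReal.rpow_eq_zero_iff, hb0, not_lt.2 hb0.le] using hs
      simp [this]
    simp [this, ha, ENNReal.zero_rpow_of_pos (show 0 < a⁻¹ by positivity)]
  have hgB : ∫⁻ s, (g s / B) ^ b ≤ 1 := by
    simp_rw [div_eq_mul_inv, ENNReal.mul_rpow_of_nonneg _ _ hb0.le]
    rw [lintegral_mul_const _ (hg.pow_const b)]
    have : ∫⁻ s, g s ^ b = B ^ b := by
      rw [hB, ← ENNReal.rpow_mul, one_div_mul_cancel hb0.ne', ENNReal.rpow_one]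
    rw [this, ← ENNReal.mul_rpow_of_nonneg _ _ hb0.le, ENNReal.mul_inv_cancel hB0 hBt,
      ENNReal.one_rpow]
  have hGm : Measurable fun t => ∫⁻ s, timeKernel α (t - s) * g s :=
    Measurable.lintegral_prod_right' (f := fun z : ℝ × ℝ => timeKernel α (z.1 - z.2) * g z.2)
      (hk.mul (hg.comp measurable_snd))
  suffices h : ∫⁻ t, (∫⁻ s, timeKernel α (t - s) * g s) ^ a ≤ (c * B) ^ a by
    calc _ ≤ ((c * B) ^ a) ^ (1 / a) := ENNReal.rpow_le_rpow h (by positivity)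
      _ = c * B := by rw [← ENNReal.rpow_mul, mul_one_div_cancel ha.ne', ENNReal.rpow_one]
      _ ≤ _ := by gcongr; simp
  refine lintegral_rpow_le_of_truncation hGm ha fun h hh hhG hfin => ?_
  set A := ∫⁻ t, h t ^ a with hA
  rcases eq_or_ne A 0 with hA0 | hA0
  · rw [hA0]; exact zero_le
  have hAp0 : A ^ (1 / p) ≠ 0 := by
    simp [ENNReal.rpow_eq_zero_iff, hA0, hfin]
  have hApt : A ^ (1 / p) ≠ ∞ := ENNReal.rpow_ne_top_of_nonneg (by positivity) hfin
  -- The normalized dual function of the truncation `h`: its `L^p` norm is one because `(a - 1) p =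
  -- a`. Testing the bilinear inequality against it gives the norm bound by duality.
  have hfm : Measurable fun t => h t ^ (a - 1) / A ^ (1 / p) := (hh.pow_const _).div_const _
  have hf1 : ∫⁻ t, (h t ^ (a - 1) / A ^ (1 / p)) ^ p ≤ 1 := by
    simp_rw [div_eq_mul_inv, ENNReal.mul_rpow_of_nonneg _ _ hp0.le]
    rw [lintegral_mul_const _ ((hh.pow_const _).pow_const _)]
    have e1 : (a - 1) * p = a := by
      rw [hp]
      have : a - 1 ≠ 0 := by linarith
      field_simp
    simp_rw [← ENNReal.rpow_mul, e1]
    rw [← hA, ENNReal.inv_rpow, ← ENNReal.rpow_mul, mul_assoc, inv_mul_cancel₀ hp0.ne', mul_one,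
      ENNReal.rpow_one, ENNReal.mul_inv_cancel hA0 hfin]
  have key : A ≤ (c * B) * A ^ (1 / p) := by
    calc A ≤ ∫⁻ t, (∫⁻ s, timeKernel α (t - s) * g s) * h t ^ (a - 1) := by
          refine lintegral_mono fun t => ?_
          calc h t ^ a = h t ^ (1 + (a - 1)) := by congr 1; ring
            _ = h t * h t ^ (a - 1) := by
              rw [ENNReal.rpow_add_of_nonneg _ _ zero_le_one (by linarith), ENNReal.rpow_one]
            _ ≤ _ := by gcongr; exact hhG t
      _ = ∫⁻ t, B * A ^ (1 / p) * ∫⁻ s, timeKernel α (t - s) *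
            (h t ^ (a - 1) / A ^ (1 / p) * (g s / B)) := by
          refine lintegral_congr fun t => ?_
          have m5 : Measurable fun s => timeKernel α (t - s) * g s :=
            (hk.comp (measurable_prodMk_left (x := t))).mul hg
          rw [← lintegral_mul_const _ m5,
            ← lintegral_const_mul' _ _ (ENNReal.mul_ne_top hBt hApt)]
          refine lintegral_congr fun s => ?_
          calc _ = timeKernel α (t - s) * (h t ^ (a - 1) * (A ^ (1 / p) * (A ^ (1 / p))⁻¹) *
                (g s * (B * B⁻¹))) := by
                rw [ENNReal.mul_inv_cancel hB0 hBt, ENNReal.mul_inv_cancel hAp0 hApt]; ring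
            _ = _ := by simp only [div_eq_mul_inv]; ring
      _ ≤ B * A ^ (1 / p) * c := by
          rw [lintegral_const_mul' _ _ (ENNReal.mul_ne_top hBt hApt)]
          gcongr
          exact hc _ _ hfm (hg.div_const _) hf1 hgB
      _ = _ := by ring
  have h1 : 1 / p < 1 := by rw [div_lt_one hp0]; exact hp1
  have := rpow_one_sub_le_of_le_mul_rpow hfin h1 key
  rw [hpi, sub_sub_cancel] at this
  calc A = (A ^ (1 / a)) ^ a := by
        rw [← ENNReal.rpow_mul, one_div_mul_cancel ha.ne', ENNReal.rpow_one]
    _ ≤ (c * B) ^ a := ENNReal.rpow_le_rpow this ha.le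

end

/-! ### The Hardy inequality -/

section

theorem lintegral_comp_mul_left' {c : ℝ} (hc : 0 < c) {f : ℝ → ℝ≥0∞} (hf : Measurable f) :
    ∫⁻ x, f (c * x) = ENNReal.ofReal c⁻¹ * ∫⁻ x, f x := by
  rw [← lintegral_map hf (measurable_const_mul c), Real.map_volume_mul_left hc.ne',
    lintegral_smul_measure, abs_of_pos (inv_pos.2 hc), smul_eq_mul]

theorem lintegral_comp_mul_right' {c : ℝ} (hc : 0 < c) {f : ℝ → ℝ≥0∞} (hf : Measurable f) :
    ∫⁻ x, f (x * c) = ENNReal.ofReal c⁻¹ * ∫⁻ x, f x := by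
  simp_rw [mul_comm _ c]; exact lintegral_comp_mul_left' hc hf

theorem timeKernel_of_pos {α x : ℝ} (hx : 0 < x) : timeKernel α x = ENNReal.ofReal (x ^ (-α)) := by
  simp [timeKernel, hx]

theorem timeKernel_of_nonpos {α x : ℝ} (hx : x ≤ 0) : timeKernel α x = 0 := by
  simp [timeKernel, not_lt.2 hx]

theorem timeKernel_mul {α x y : ℝ} (hx : 0 < x) :
    timeKernel α (x * y) = ENNReal.ofReal (x ^ (-α)) * timeKernel α y := by
  rcases le_or_gt y 0 with hy | hy
  · rw [timeKernel_of_nonpos hy, timeKernel_of_nonpos (mul_nonpos_of_nonneg_of_nonpos hx.le hy),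
      mul_zero]
  · rw [timeKernel_of_pos hy, timeKernel_of_pos (mul_pos hx hy),
      Real.mul_rpow hx.le hy.le, ENNReal.ofReal_mul (by positivity)]

theorem timeKernel_add {α γ x : ℝ} :
    timeKernel α x * timeKernel γ x = timeKernel (α + γ) x := by
  rcases le_or_gt x 0 with hx | hx
  · simp [timeKernel_of_nonpos hx]
  · rw [timeKernel_of_pos hx, timeKernel_of_pos hx, timeKernel_of_pos hx,
      ← ENNReal.ofReal_mul (by positivity), ← Real.rpow_add hx]
    congr 2; ring

theorem timeKernel_ne_top (α x : ℝ) : timeKernel α x ≠ ∞ := by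
  rcases le_or_gt x 0 with hx | hx
  · simp [timeKernel_of_nonpos hx]
  · simp [timeKernel_of_pos hx]

/-- Bound for the Beta integral. -/
theorem exists_lintegral_timeKernel_mul_le {α γ : ℝ} (hα0 : 0 ≤ α) (hα1 : α < 1) (hγ0 : 0 ≤ γ)
    (hγ1 : γ < 1) : ∃ c : ℝ≥0, ∀ t : ℝ, 0 < t →
      ∫⁻ s, timeKernel α (t - s) * timeKernel γ s ≤ c * ENNReal.ofReal (t ^ (1 - α - γ)) := by
  have h1α : 0 < 1 - α := by linarith
  have h1γ : 0 < 1 - γ := by linarith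
  refine ⟨Real.toNNReal (2 ^ α * (1 / (1 - γ)) + 2 ^ γ * (1 / (1 - α))), fun t ht => ?_⟩
  have htt : Measurable fun s : ℝ => t - s := by fun_prop
  have e1 : ∀ β : ℝ, β < 1 → ∫⁻ s, (Ioc 0 t).indicator (fun s => ENNReal.ofReal (s ^ (-β))) s =
      ENNReal.ofReal (t ^ (1 - β) / (1 - β)) := fun β hβ => by
    rw [lintegral_indicator measurableSet_Ioc, lintegral_Ioc_ofReal_rpow (by linarith) ht.le,
      show -β + 1 = 1 - β by ring]
  have e2 : ∫⁻ s, (Ioc 0 t).indicator (fun s => ENNReal.ofReal (s ^ (-α))) (t - s) =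
      ENNReal.ofReal (t ^ (1 - α) / (1 - α)) := by
    rw [← e1 α hα1]
    exact lintegral_sub_left_eq_self _ t
  have m1 : ∀ β : ℝ, Measurable ((Ioc 0 t).indicator (fun s : ℝ => ENNReal.ofReal (s ^ (-β)))) :=
    fun β => (measurable_ofReal_rpow _).indicator measurableSet_Ioc
  calc ∫⁻ s, timeKernel α (t - s) * timeKernel γ s
      ≤ ∫⁻ s, (ENNReal.ofReal ((t / 2) ^ (-α)) *
            (Ioc 0 t).indicator (fun s => ENNReal.ofReal (s ^ (-γ))) s +
          ENNReal.ofReal ((t / 2) ^ (-γ)) *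
            (Ioc 0 t).indicator (fun s => ENNReal.ofReal (s ^ (-α))) (t - s)) := by
        refine lintegral_mono fun s => ?_
        rcases le_or_gt s 0 with hs | hs
        · simp [timeKernel_of_nonpos hs]
        rcases le_or_gt t s with hst | hst
        · simp [timeKernel_of_nonpos (sub_nonpos.2 hst)]
        have hts : 0 < t - s := sub_pos.2 hst
        have i1 : s ∈ Ioc 0 t := ⟨hs, hst.le⟩
        have i2 : t - s ∈ Ioc 0 t := ⟨hts, by linarith⟩
        rw [timeKernel_of_pos hs, timeKernel_of_pos hts, indicator_of_mem i1, indicator_of_mem i2]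
        -- One of `s` and `t - s` is at least `t / 2`, so the corresponding factor is at most a
        -- power of `t / 2` and the other one is integrated.
        rcases le_or_gt s (t / 2) with h | h
        · refine le_add_right ?_
          gcongr ?_ * _
          refine ENNReal.ofReal_le_ofReal ?_
          exact Real.rpow_le_rpow_of_nonpos (by positivity) (by linarith) (by linarith)
        · refine le_add_left ?_
          rw [mul_comm]
          gcongr ?_ * _
          refine ENNReal.ofReal_le_ofReal ?_
          exact Real.rpow_le_rpow_of_nonpos (by positivity) (by linarith) (by linarith)
    _ = ENNReal.ofReal ((t / 2) ^ (-α)) * ENNReal.ofReal (t ^ (1 - γ) / (1 - γ)) +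
        ENNReal.ofReal ((t / 2) ^ (-γ)) * ENNReal.ofReal (t ^ (1 - α) / (1 - α)) := by
        rw [lintegral_add_left ((m1 γ).const_mul _), lintegral_const_mul _ (m1 γ),
          lintegral_const_mul' _ _ ENNReal.ofReal_ne_top, e1 γ hγ1, e2]
    _ ≤ _ := by
        refine le_of_eq ?_
        rw [← ENNReal.ofReal_mul (by positivity), ← ENNReal.ofReal_mul (by positivity),
          ← ENNReal.ofReal_add (by positivity) (by positivity)]
        change _ = ENNReal.ofReal _ * _
        rw [← ENNReal.ofReal_mul (by positivity)]
        congr 1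
        have f1 : ∀ x : ℝ, (t / 2) ^ (-x) = 2 ^ x * t ^ (-x) := fun x => by
          rw [Real.div_rpow ht.le zero_le_two, Real.rpow_neg zero_le_two, div_inv_eq_mul, mul_comm]
        have f2 : t ^ (-α) * t ^ (1 - γ) = t ^ (1 - α - γ) := by
          rw [← Real.rpow_add ht]; congr 1; ring
        have f3 : t ^ (-γ) * t ^ (1 - α) = t ^ (1 - α - γ) := by
          rw [← Real.rpow_add ht]; congr 1; ring
        rw [f1, f1]
        calc _ = 2 ^ α * (1 / (1 - γ)) * (t ^ (-α) * t ^ (1 - γ)) +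
              2 ^ γ * (1 / (1 - α)) * (t ^ (-γ) * t ^ (1 - α)) := by ring
          _ = _ := by rw [f2, f3]; ring

/-- Hardy's inequality for a kernel which is homogeneous of degree `-1`. -/
theorem exists_hardy {α a : ℝ} (hα1 : α < 1) (ha : 1 ≤ a) (haα : 1 / a < α) :
    ∃ c : ℝ≥0, ∀ g : ℝ → ℝ≥0∞, Measurable g →
      (∫⁻ t, (∫⁻ s, timeKernel α (t - s) * timeKernel (1 - α) s * g s) ^ a) ^ (1 / a) ≤
        c * (∫⁻ s, g s ^ a) ^ (1 / a) := by
  have ha0 : 0 < a := by linarith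
  have ha' : 0 < 1 / a := by positivity
  -- Dilating `g` by `θ` costs `θ ^ (-1/a)` in `L^a`, which adds `1/a` to the exponent at the
  -- origin; `1 / a < α` keeps it below one.
  obtain ⟨c, hc⟩ := exists_lintegral_timeKernel_mul_le (α := α) (γ := 1 - α + 1 / a)
    (by linarith) hα1 (by linarith) (by linarith)
  refine ⟨c, fun g hg => ?_⟩
  have hk := measurable_timeKernel
  have hW : Measurable fun θ => timeKernel α (1 - θ) * timeKernel (1 - α) θ :=
    ((hk α).comp (by fun_prop)).mul (hk _)
  -- Substitute `s = t θ`. The kernel has degree `-1`, so it absorbs the Jacobian and `t` survives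
  -- only inside `g`; Minkowski's inequality in `θ` then applies.
  have step : ∀ t : ℝ, ∫⁻ s, timeKernel α (t - s) * timeKernel (1 - α) s * g s ≤
      ∫⁻ θ, timeKernel α (1 - θ) * timeKernel (1 - α) θ * g (t * θ) := by
    intro t
    rcases le_or_gt t 0 with ht | ht
    · refine le_trans (le_of_eq ?_) zero_le
      rw [← lintegral_zero (μ := (volume : Measure ℝ))]
      refine lintegral_congr fun s => ?_
      rcases le_or_gt s 0 with hs | hs
      · simp [timeKernel_of_nonpos hs]
      · simp [timeKernel_of_nonpos (show t - s ≤ 0 by linarith)]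
    · have hm : Measurable fun s => timeKernel α (t - s) * timeKernel (1 - α) s * g s :=
        (((hk α).comp (by fun_prop)).mul (hk _)).mul hg
      have := lintegral_comp_mul_left' ht hm
      refine le_of_eq ?_
      calc _ = ENNReal.ofReal t * (ENNReal.ofReal t⁻¹ *
            ∫⁻ s, timeKernel α (t - s) * timeKernel (1 - α) s * g s) := by
            rw [← mul_assoc, ← ENNReal.ofReal_mul ht.le, mul_inv_cancel₀ ht.ne',
              ENNReal.ofReal_one, one_mul]
        _ = _ := by
            rw [← this, ← lintegral_const_mul' _ _ ENNReal.ofReal_ne_top]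
            refine lintegral_congr fun θ => ?_
            rw [show t - t * θ = t * (1 - θ) by ring, timeKernel_mul ht, timeKernel_mul ht]
            calc _ = (ENNReal.ofReal t * ENNReal.ofReal (t ^ (-α)) *
                  ENNReal.ofReal (t ^ (-(1 - α)))) *
                  (timeKernel α (1 - θ) * timeKernel (1 - α) θ * g (t * θ)) := by ring
              _ = _ := by
                rw [← ENNReal.ofReal_mul ht.le, ← ENNReal.ofReal_mul (by positivity)]
                have : t * t ^ (-α) * t ^ (-(1 - α)) = 1 := by
                  rw [mul_assoc, ← Real.rpow_add ht]
                  rw [show -α + -(1 - α) = -1 by ring, Real.rpow_neg_one, mul_inv_cancel₀ ht.ne']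
                rw [this, ENNReal.ofReal_one, one_mul]
  calc _ ≤ (∫⁻ t, (∫⁻ θ, timeKernel α (1 - θ) * timeKernel (1 - α) θ * g (t * θ)) ^ a) ^ (1 / a) := by
        exact ENNReal.rpow_le_rpow (lintegral_mono fun t =>
          ENNReal.rpow_le_rpow (step t) ha0.le) ha'.le
    _ ≤ ∫⁻ θ, (∫⁻ t, (timeKernel α (1 - θ) * timeKernel (1 - α) θ * g (t * θ)) ^ a) ^ (1 / a) := by
        refine lintegral_rpow_lintegral_le (F := fun θ t =>
          timeKernel α (1 - θ) * timeKernel (1 - α) θ * g (t * θ)) ?_ ha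
        exact (hW.comp measurable_fst).mul (hg.comp (measurable_snd.mul measurable_fst))
    _ = ∫⁻ θ, timeKernel α (1 - θ) * timeKernel (1 - α + 1 / a) θ * (∫⁻ s, g s ^ a) ^ (1 / a) := by
        refine lintegral_congr fun θ => ?_
        rcases le_or_gt θ 0 with hθ | hθ
        · simp [timeKernel_of_nonpos hθ, ha0]
        · simp_rw [ENNReal.mul_rpow_of_nonneg _ _ ha0.le]
          rw [lintegral_const_mul' _ _ (by
            refine ENNReal.mul_ne_top ?_ ?_ <;>
            exact ENNReal.rpow_ne_top_of_nonneg ha0.le (timeKernel_ne_top _ _)),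
            lintegral_comp_mul_right' hθ (hg.pow_const a),
            ENNReal.mul_rpow_of_nonneg _ _ ha'.le, ENNReal.mul_rpow_of_nonneg _ _ ha'.le,
            ENNReal.mul_rpow_of_nonneg _ _ ha'.le, ← ENNReal.rpow_mul, ← ENNReal.rpow_mul,
            mul_one_div_cancel ha0.ne', ENNReal.rpow_one, ENNReal.rpow_one,
            ← timeKernel_add, timeKernel_of_pos (α := 1 / a) hθ,
            ENNReal.ofReal_rpow_of_pos (by positivity), Real.inv_rpow hθ.le, ← Real.rpow_neg hθ.le]
          ring
    _ = (∫⁻ θ, timeKernel α (1 - θ) * timeKernel (1 - α + 1 / a) θ) *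
          (∫⁻ s, g s ^ a) ^ (1 / a) :=
        lintegral_mul_const _ (((hk α).comp (by fun_prop)).mul (hk _))
    _ ≤ _ := by
        gcongr
        refine (hc 1 one_pos).trans (le_of_eq ?_)
        simp

end

section

variable {d : ℕ} {W : Type*} [NormedAddCommGroup W] [NormedSpace ℝ W]

/-! ### Convolution kernels and their dilations -/

/-- Bounded continuous integrable functions which are Lipschitz with respect to translations in
`L¹`. -/
structure GoodKernel (ψ : Space d → W) : Prop where
  continuous : Continuous ψ
  integrable : Integrable ψ
  bounded : ∃ c : ℝ≥0, ∀ x, ‖ψ x‖ₑ ≤ c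
  shift : ∃ c : ℝ≥0, ∀ h, ∫⁻ x, ‖ψ (x + h) - ψ x‖ₑ ≤ c * ‖h‖ₑ

/-- The dilated kernel `l ^ (-(d + n)) ψ (x / l)`. -/
noncomputable def dil (n : ℕ) (l : ℝ) (ψ : Space d → W) (x : Space d) : W :=
  (l ^ (d + n))⁻¹ • ψ (l⁻¹ • x)

theorem lintegral_comp_inv_smul {l : ℝ} (hl : 0 < l) {f : Space d → ℝ≥0∞} (hf : Measurable f) :
    ∫⁻ x, f (l⁻¹ • x) = ENNReal.ofReal (l ^ d) * ∫⁻ x, f x := by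
  rw [← lintegral_map hf (measurable_const_smul _),
    Measure.map_addHaar_smul _ (inv_ne_zero hl.ne'), lintegral_smul_measure, smul_eq_mul]
  congr 2
  rw [finrank_euclideanSpace_fin, inv_pow, inv_inv, abs_of_pos (by positivity)]

theorem enorm_dil {n : ℕ} {l : ℝ} (hl : 0 < l) (ψ : Space d → W) (x : Space d) :
    ‖dil n l ψ x‖ₑ = ENNReal.ofReal (l ^ (d + n))⁻¹ * ‖ψ (l⁻¹ • x)‖ₑ := by
  rw [dil, enorm_smul, Real.enorm_of_nonneg (by positivity)]

theorem lintegral_enorm_dil {n : ℕ} {l : ℝ} (hl : 0 < l) {ψ : Space d → W}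
    (hψ : Continuous ψ) :
    ∫⁻ x, ‖dil n l ψ x‖ₑ = ENNReal.ofReal (l ^ n)⁻¹ * ∫⁻ x, ‖ψ x‖ₑ := by
  simp_rw [enorm_dil hl]
  rw [lintegral_const_mul' _ _ ENNReal.ofReal_ne_top,
    lintegral_comp_inv_smul hl (f := fun x => ‖ψ x‖ₑ) hψ.enorm.measurable, ← mul_assoc,
    ← ENNReal.ofReal_mul (by positivity)]
  congr 2
  rw [pow_add]; field_simp

theorem lintegral_enorm_dil_shift {n : ℕ} {l : ℝ} (hl : 0 < l) {ψ : Space d → W}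
    (hψ : Continuous ψ) (h : Space d) :
    ∫⁻ x, ‖dil n l ψ (x + h) - dil n l ψ x‖ₑ =
      ENNReal.ofReal (l ^ n)⁻¹ * ∫⁻ x, ‖ψ (x + l⁻¹ • h) - ψ x‖ₑ := by
  have : ∀ x, ‖dil n l ψ (x + h) - dil n l ψ x‖ₑ =
      ‖dil n l (fun y => ψ (y + l⁻¹ • h) - ψ y) x‖ₑ := fun x => by
    simp only [dil, smul_add, smul_sub]
  simp_rw [this]
  exact lintegral_enorm_dil hl (by fun_prop)

theorem lintegral_enorm_shift_le_two {W : Type*} [NormedAddCommGroup W] (ψ : Space d → W) (hψ : Continuous ψ) (h : Space d) :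
    ∫⁻ x, ‖ψ (x + h) - ψ x‖ₑ ≤ 2 * ∫⁻ x, ‖ψ x‖ₑ := by
  calc _ ≤ ∫⁻ x, (‖ψ (x + h)‖ₑ + ‖ψ x‖ₑ) := lintegral_mono fun x => enorm_sub_le
    _ = _ := by
      rw [lintegral_add_right _ hψ.enorm.measurable,
        lintegral_add_right_eq_self (fun x => ‖ψ x‖ₑ) h, two_mul]

/-- Interpolation between the trivial bound and the Lipschitz bound for translations. -/
theorem GoodKernel.exists_shift_le {ψ : Space d → W} (hψ : GoodKernel ψ) {σ : ℝ} (hσ0 : 0 ≤ σ)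
    (hσ1 : σ ≤ 1) : ∃ c : ℝ≥0, ∀ (n : ℕ) (l : ℝ) (_ : 0 < l) (h : Space d),
      ∫⁻ x, ‖dil n l ψ (x + h) - dil n l ψ x‖ₑ ≤
        c * ENNReal.ofReal (l ^ (-((n : ℝ) + σ))) * ‖h‖ₑ ^ σ := by
  obtain ⟨c₁, hc₁⟩ := hψ.shift
  have hfin : 2 * ∫⁻ x, ‖ψ x‖ₑ ≠ ∞ := ENNReal.mul_ne_top (by simp) hψ.integrable.2.ne
  set c₀ := (2 * ∫⁻ x, ‖ψ x‖ₑ).toNNReal with hc₀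
  have hb : ∀ h, ∫⁻ x, ‖ψ (x + h) - ψ x‖ₑ ≤ c₀ := fun h => by
    rw [hc₀, ENNReal.coe_toNNReal hfin]
    exact lintegral_enorm_shift_le_two ψ hψ.continuous h
  refine ⟨c₀ ^ (1 - σ) * c₁ ^ σ, fun n l hl h => ?_⟩
  rw [lintegral_enorm_dil_shift hl hψ.continuous]
  set I := ∫⁻ x, ‖ψ (x + l⁻¹ • h) - ψ x‖ₑ
  have hI : I = I ^ (1 - σ) * I ^ σ := by
    rw [← ENNReal.rpow_add_of_nonneg _ _ (by linarith) hσ0]; simp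
  calc ENNReal.ofReal (l ^ n)⁻¹ * I ≤ ENNReal.ofReal (l ^ n)⁻¹ *
      ((c₀ : ℝ≥0∞) ^ (1 - σ) * (c₁ * ‖l⁻¹ • h‖ₑ) ^ σ) := by
        conv_lhs => rw [hI]
        exact mul_le_mul' le_rfl (mul_le_mul' (ENNReal.rpow_le_rpow (hb _) (by linarith))
          (ENNReal.rpow_le_rpow (hc₁ _) hσ0))
    _ = _ := by
        rw [ENNReal.mul_rpow_of_nonneg _ _ hσ0, enorm_smul,
          ENNReal.mul_rpow_of_nonneg _ _ hσ0, Real.enorm_of_nonneg (by positivity),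
          ENNReal.ofReal_rpow_of_pos (by positivity), ENNReal.coe_mul,
          ENNReal.coe_rpow_of_nonneg _ (by linarith), ENNReal.coe_rpow_of_nonneg _ hσ0,
          neg_add, Real.rpow_add hl, ENNReal.ofReal_mul (by positivity), Real.inv_rpow hl.le,
          Real.rpow_neg hl.le, Real.rpow_neg hl.le, Real.rpow_natCast]
        ring

/-- For the translation bound, an increment is the integral of the derivative along a segment;
Fubini and translation invariance give the `L¹` norm of the derivative as the Lipschitz constant. -/
theorem goodKernel_of_schwartz (f : 𝓢(Space d, ℂ)) : GoodKernel (f : Space d → ℂ) := by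
  have hD := (SchwartzMap.fderivCLM ℝ (Space d) ℂ f).integrable (μ := volume)
  have hDc : Continuous (fderiv ℝ (f : Space d → ℂ)) := (SchwartzMap.fderivCLM ℝ (Space d) ℂ f).continuous
  refine ⟨f.continuous, f.integrable, ⟨⟨SchwartzMap.seminorm ℝ 0 0 f, apply_nonneg _ _⟩, fun x => ?_⟩,
    ⟨(∫⁻ x, ‖fderiv ℝ f x‖ₑ).toNNReal, fun h => ?_⟩⟩
  · rw [← ofReal_norm]
    refine (ENNReal.ofReal_le_ofReal (SchwartzMap.norm_le_seminorm ℝ f x)).trans (le_of_eq ?_)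
    rw [ENNReal.ofReal, Real.toNNReal_of_nonneg (apply_nonneg _ _)]
    rfl
  · have hfin : ∫⁻ x, ‖fderiv ℝ f x‖ₑ ≠ ∞ := hD.2.ne
    rw [ENNReal.coe_toNNReal hfin]
    have key : ∀ x, ‖f (x + h) - f x‖ₑ ≤ ∫⁻ θ in Ioc (0 : ℝ) 1, ‖fderiv ℝ f (x + θ • h)‖ₑ * ‖h‖ₑ := by
      intro x
      have : f (x + h) - f x = ∫ θ in (0 : ℝ)..1, fderiv ℝ f (x + θ • h) h := by
        have h1 : ∀ θ ∈ uIcc (0 : ℝ) 1, HasDerivAt (fun θ : ℝ => f (x + θ • h))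
            (fderiv ℝ f (x + θ • h) h) θ := fun θ _ => by
          have hg : HasDerivAt (fun θ : ℝ => x + θ • h) h θ := by
            simpa using ((hasDerivAt_id θ).smul_const h).const_add x
          exact (f.differentiableAt.hasFDerivAt).comp_hasDerivAt θ hg
        rw [intervalIntegral.integral_eq_sub_of_hasDerivAt h1]
        · simp
        · refine Continuous.intervalIntegrable ?_ _ _
          exact (hDc.comp (by fun_prop)).clm_apply continuous_const
      rw [this, intervalIntegral.integral_of_le zero_le_one]
      refine (enorm_integral_le_lintegral_enorm _).trans (lintegral_mono fun θ => ?_)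
      exact ContinuousLinearMap.le_opENorm _ _
    calc _ ≤ ∫⁻ x, ∫⁻ θ in Ioc (0 : ℝ) 1, ‖fderiv ℝ f (x + θ • h)‖ₑ * ‖h‖ₑ := lintegral_mono key
      _ = ∫⁻ θ in Ioc (0 : ℝ) 1, ∫⁻ x, ‖fderiv ℝ f (x + θ • h)‖ₑ * ‖h‖ₑ := by
          refine lintegral_lintegral_swap (Continuous.measurable ?_).aemeasurable
          have : Continuous fun z : Space d × ℝ => fderiv ℝ f (z.1 + z.2 • h) :=
            hDc.comp (by fun_prop)
          exact ENNReal.continuous_mul_const (by simp) |>.comp this.enorm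
      _ = ∫⁻ θ in Ioc (0 : ℝ) 1, (∫⁻ x, ‖fderiv ℝ f x‖ₑ) * ‖h‖ₑ := by
          refine lintegral_congr fun θ => ?_
          rw [lintegral_mul_const' _ _ (by simp),
            lintegral_add_right_eq_self (fun x => ‖fderiv ℝ f x‖ₑ) (θ • h)]
      _ = _ := by simp

end

section

variable {d : ℕ}

/-! ### The heat kernel and the Oseen kernel -/

/-- The power is dominated by `m! exp (1 + y)`, and completing the square absorbs the linear
exponent into the Gaussian. -/
theorem one_add_pow_mul_exp_le {c : ℝ} (hc : 0 < c) (m : ℕ) {y : ℝ} (hy : 0 ≤ y) :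
    (1 + y) ^ m * Real.exp (-(c * y ^ 2)) ≤ m.factorial * Real.exp (1 + 1 / (4 * c)) := by
  have h1 : (1 + y) ^ m ≤ m.factorial * Real.exp (1 + y) := by
    have := Real.pow_div_factorial_le_exp (1 + y) (by linarith) m
    rw [div_le_iff₀ (by positivity)] at this
    linarith
  calc _ ≤ m.factorial * Real.exp (1 + y) * Real.exp (-(c * y ^ 2)) := by gcongr
    _ = m.factorial * Real.exp (1 + y + -(c * y ^ 2)) := by rw [mul_assoc, ← Real.exp_add]
    _ ≤ _ := by
      refine mul_le_mul_of_nonneg_left (Real.exp_le_exp.2 ?_) (by positivity)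
      have : y - c * y ^ 2 ≤ 1 / (4 * c) := by
        rw [le_div_iff₀ (by positivity)]
        nlinarith [sq_nonneg (2 * c * y - 1)]
      linarith

/-- The Gaussian `exp (-c |x|²)`. -/
noncomputable def gaussian {c : ℝ} (hc : 0 < c) : 𝓢(Space d, ℝ) where
  toFun x := Real.exp (-(c * ‖x‖ ^ 2))
  smooth' := Real.contDiff_exp.comp ((contDiff_const.mul (contDiff_norm_sq ℝ)).neg)
  decay' k n := by
    have hg : Function.HasTemperateGrowth fun x : Space d => -(c * ‖x‖ ^ 2) := by
      have := (Function.HasTemperateGrowth.const c).mul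
        (Function.hasTemperateGrowth_norm_sq (H := Space d))
      exact this.neg
    obtain ⟨m, C, hC0, hC⟩ := hg.norm_iteratedFDeriv_le_uniform n
    refine ⟨n.factorial * (C + 1) ^ n *
      ((k + m * n).factorial * Real.exp (1 + 1 / (4 * c))), fun x => ?_⟩
    -- Faà di Bruno bound: every derivative of `exp` at the inner value equals the Gaussian itself,
    -- while the derivatives of the exponent grow polynomially. Using `C + 1` in place of `C` makes
    -- the base at least one, hence dominated by its own `i`-th power.
    have hb := norm_iteratedFDeriv_comp_le (n := n) (N := (⊤ : ℕ∞)) (g := Real.exp)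
      (f := fun x : Space d => -(c * ‖x‖ ^ 2))
      Real.contDiff_exp hg.1 (by exact_mod_cast le_top) x
      (C := Real.exp (-(c * ‖x‖ ^ 2))) (D := (C + 1) * (1 + ‖x‖) ^ m)
      (fun i _ => by
        rw [norm_iteratedFDeriv_eq_norm_iteratedDeriv, iteratedDeriv_eq_iterate, Real.iter_deriv_exp,
          Real.norm_of_nonneg (Real.exp_pos _).le])
      (fun i hi1 hin => by
        refine (hC i hin x).trans ?_
        have h1 : (1 : ℝ) ≤ (C + 1) * (1 + ‖x‖) ^ m := by
          have : (1 : ℝ) ≤ (1 + ‖x‖) ^ m := one_le_pow₀ (by linarith [norm_nonneg x])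
          nlinarith
        calc C * (1 + ‖x‖) ^ m ≤ (C + 1) * (1 + ‖x‖) ^ m := by gcongr; linarith
          _ ≤ _ := le_self_pow₀ h1 (by omega))
    calc ‖x‖ ^ k * ‖iteratedFDeriv ℝ n (fun x : Space d => Real.exp (-(c * ‖x‖ ^ 2))) x‖
        ≤ (1 + ‖x‖) ^ k * (n.factorial * Real.exp (-(c * ‖x‖ ^ 2)) *
            ((C + 1) * (1 + ‖x‖) ^ m) ^ n) := by
          gcongr
          · linarith [norm_nonneg x]
          · exact hb
      _ = n.factorial * (C + 1) ^ n * ((1 + ‖x‖) ^ (k + m * n) * Real.exp (-(c * ‖x‖ ^ 2))) := by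
          rw [mul_pow, pow_add, pow_mul]; ring
      _ ≤ _ := by
          exact mul_le_mul_of_nonneg_left (one_add_pow_mul_exp_le hc _ (norm_nonneg x))
            (by positivity)

/-- The symbol of the heat semi-group at time `1`, as a Schwartz function. -/
noncomputable def heatSchwartz : 𝓢(Space d, ℂ) :=
  (gaussian (d := d) (c := 4 * Real.pi ^ 2) (by positivity)).postcompCLM Complex.ofRealCLM

theorem heatSchwartz_apply (ξ : Space d) : heatSchwartz ξ = heatSymbol 1 ξ := by
  rw [heatSchwartz, SchwartzMap.postcompCLM_apply, heatSymbol, mul_one]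
  rfl

theorem heatSymbol_smul {l : ℝ} (t : ℝ) (ξ : Space d) :
    heatSymbol t (l • ξ) = heatSymbol (l ^ 2 * t) ξ := by
  unfold heatSymbol
  rw [norm_smul, mul_pow, Real.norm_eq_abs, sq_abs]
  congr 3; ring

theorem derivSymbol_smul (k : Fin d) (l : ℝ) (ξ : Space d) :
    derivSymbol k (l • ξ) = l * derivSymbol k ξ := by
  simp [derivSymbol]; ring

theorem leraySymbol_smul {l : ℝ} (hl : l ≠ 0) (i j : Fin d) (ξ : Space d) :
    leraySymbol i j (l • ξ) = leraySymbol i j ξ := by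
  unfold leraySymbol
  rw [norm_smul, mul_pow, Real.norm_eq_abs, sq_abs]
  simp only [PiLp.smul_apply, smul_eq_mul]
  congr 1
  rw [show l * ξ i * (l * ξ j) = l ^ 2 * (ξ i * ξ j) by ring,
    mul_div_mul_left _ _ (pow_ne_zero 2 hl)]

theorem hasTemperateGrowth_derivSymbol (k : Fin d) :
    Function.HasTemperateGrowth (derivSymbol k) := by
  unfold derivSymbol
  have h : Function.HasTemperateGrowth fun ξ : Space d => ((EuclideanSpace.proj k : Space d →L[ℝ] ℝ) ξ) :=
    ContinuousLinearMap.hasTemperateGrowth _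
  have h2 := Function.HasTemperateGrowth.comp Function.Complex.hasTemperateGrowth_ofReal h
  exact (Function.HasTemperateGrowth.const (2 * Real.pi * Complex.I : ℂ)).mul h2

/-- Scaling of the inverse Fourier transform. -/
theorem fourierInv_comp_smul {W : Type*} [NormedAddCommGroup W] [NormedSpace ℂ W] {l : ℝ}
    (hl : 0 < l) (m : Space d → W) :
    𝓕⁻ (fun ξ => m (l • ξ)) = dil 0 l (𝓕⁻ m) := by
  ext x
  rw [dil, Real.fourierInv_eq', Real.fourierInv_eq']
  have := Measure.integral_comp_smul_of_nonneg (volume : Measure (Space d)) (fun ξ : Space d =>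
    Complex.exp (↑(2 * Real.pi * inner ℝ ξ (l⁻¹ • x)) * Complex.I) • m ξ) l (hR := hl.le)
  rw [finrank_euclideanSpace_fin] at this
  rw [add_zero, ← this]
  refine integral_congr_ae (Eventually.of_forall fun ξ => ?_)
  simp only [inner_smul_left, inner_smul_right]
  congr 5
  simp only [RCLike.conj_to_real]
  field_simp

theorem dil_smul_eq {W : Type*} [NormedAddCommGroup W] [NormedSpace ℝ W] (l : ℝ)
    (n m : ℕ) (ψ : Space d → W) : (l ^ n)⁻¹ • dil m l ψ = dil (m + n) l ψ := by
  ext x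
  simp only [Pi.smul_apply, dil, smul_smul]
  congr 1
  rw [← mul_inv, ← pow_add]; congr 2; ring

theorem fourierInv_const_smul {W : Type*} [NormedAddCommGroup W] [NormedSpace ℂ W] (c : ℝ)
    (m : Space d → W) : 𝓕⁻ (fun ξ => c • m ξ) = c • 𝓕⁻ m := by
  ext x
  rw [Pi.smul_apply, Real.fourierInv_eq', Real.fourierInv_eq', ← integral_smul]
  simp_rw [smul_comm _ c]

/-- The heat symbol depends on `√τ ξ` only and the Leray symbol has degree zero; the derivative
produces one extra factor `1 / √τ`, which is the index `1` of `dil`. -/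
theorem oseenKernel_eq_dil (i j k : Fin d) {τ : ℝ} (hτ : 0 < τ) :
    oseenKernel i j k τ = dil 1 (√τ) (oseenKernel i j k 1) := by
  have hl : 0 < √τ := Real.sqrt_pos.2 hτ
  rw [← zero_add 1, ← dil_smul_eq (√τ) 1 0]
  simp only [oseenKernel]
  rw [← fourierInv_comp_smul hl, ← fourierInv_const_smul]
  congr 1
  ext ξ
  rw [heatSymbol_smul, Real.sq_sqrt hτ.le, mul_one, derivSymbol_smul, leraySymbol_smul hl.ne']
  rw [pow_one, Complex.real_smul, Complex.ofReal_inv]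
  have : ((√τ : ℝ) : ℂ) ≠ 0 := by exact_mod_cast hl.ne'
  field_simp

theorem fourierInv_heatSymbol {τ : ℝ} (hτ : 0 < τ) :
    𝓕⁻ (heatSymbol (d := d) τ) = dil 0 (√τ) (𝓕⁻ (heatSymbol 1)) := by
  have hl : 0 < √τ := Real.sqrt_pos.2 hτ
  rw [← fourierInv_comp_smul hl]
  congr 1
  ext ξ
  rw [heatSymbol_smul, Real.sq_sqrt hτ.le, mul_one]

/-- The Schwartz function `∂_k` applied to the heat symbol. -/
noncomputable def derivHeat (k : Fin d) : 𝓢(Space d, ℂ) :=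
  SchwartzMap.smulLeftCLM ℂ (derivSymbol k) heatSchwartz

theorem derivHeat_apply (k : Fin d) (ξ : Space d) :
    derivHeat k ξ = heatSymbol 1 ξ * derivSymbol k ξ := by
  rw [derivHeat, SchwartzMap.smulLeftCLM_apply_apply (hasTemperateGrowth_derivSymbol k),
    heatSchwartz_apply, smul_eq_mul, mul_comm]

/-- The Schwartz function `∂_i ∂_j ∂_k` applied to the heat symbol. -/
noncomputable def derivHeat₃ (i j k : Fin d) : 𝓢(Space d, ℂ) :=
  SchwartzMap.smulLeftCLM ℂ (derivSymbol i) (SchwartzMap.smulLeftCLM ℂ (derivSymbol j) (derivHeat k))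

theorem derivHeat₃_apply (i j k : Fin d) (ξ : Space d) :
    derivHeat₃ i j k ξ =
      heatSymbol 1 ξ * derivSymbol i ξ * derivSymbol j ξ * derivSymbol k ξ := by
  rw [derivHeat₃, SchwartzMap.smulLeftCLM_apply_apply (hasTemperateGrowth_derivSymbol i),
    SchwartzMap.smulLeftCLM_apply_apply (hasTemperateGrowth_derivSymbol j), derivHeat_apply]
  simp only [smul_eq_mul]; ring

theorem derivHeat₃_smul (i j k : Fin d) {s : ℝ} (hs : 0 < s) (ξ : Space d) :
    ((√s ^ 3)⁻¹ : ℝ) • derivHeat₃ i j k (√s • ξ) =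
      heatSymbol s ξ * derivSymbol i ξ * derivSymbol j ξ * derivSymbol k ξ := by
  have hl : 0 < √s := Real.sqrt_pos.2 hs
  rw [derivHeat₃_apply, heatSymbol_smul, Real.sq_sqrt hs.le, mul_one, derivSymbol_smul,
    derivSymbol_smul, derivSymbol_smul, Complex.real_smul]
  push_cast
  have : ((√s : ℝ) : ℂ) ≠ 0 := by exact_mod_cast hl.ne'
  field_simp

/-- Supplies the factor `|ξ|⁻²` of the Leray symbol as a superposition of heat symbols, thereby
removing the singularity at the origin. -/
theorem integral_heatSymbol_Ioi {ξ : Space d} (hξ : ξ ≠ 0) :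
    ∫ s in Ioi (1 : ℝ), heatSymbol s ξ = heatSymbol 1 ξ / (4 * Real.pi ^ 2 * ‖ξ‖ ^ 2) := by
  have hn : 0 < ‖ξ‖ := norm_pos_iff.2 hξ
  set a : ℝ := 4 * Real.pi ^ 2 * ‖ξ‖ ^ 2 with ha
  have ha0 : 0 < a := by positivity
  have h := integral_exp_mul_Ioi (a := -a) (by linarith) 1
  unfold heatSymbol
  rw [integral_complex_ofReal]
  have : ∀ s : ℝ, -(4 * Real.pi ^ 2 * s * ‖ξ‖ ^ 2) = -a * s := fun s => by rw [ha]; ring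
  simp_rw [this]
  rw [h]
  push_cast
  rw [ha]; push_cast
  rw [neg_div_neg_eq]

/-- The nonsmooth quotient `ξ_i ξ_j / |ξ|²` becomes an integral over heat times `s > 1` of rescaled
copies of a single Schwartz function. The signs match because `(2πi)² = -4π²`; at `ξ = 0` the
derivative symbol kills every term. -/
theorem heatSymbol_mul_leraySymbol (i j k : Fin d) (ξ : Space d) :
    heatSymbol 1 ξ * (leraySymbol i j ξ : ℂ) * derivSymbol k ξ =
      (if i = j then 1 else 0) * derivHeat k ξ +
      ∫ s in Ioi (1 : ℝ), ((√s ^ 3)⁻¹ : ℝ) • derivHeat₃ i j k (√s • ξ) := by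
  have h1 : ∫ s in Ioi (1 : ℝ), ((√s ^ 3)⁻¹ : ℝ) • derivHeat₃ i j k (√s • ξ) =
      ∫ s in Ioi (1 : ℝ), heatSymbol s ξ * (derivSymbol i ξ * derivSymbol j ξ * derivSymbol k ξ) := by
    refine setIntegral_congr_fun measurableSet_Ioi fun s hs => ?_
    have hs' : (1 : ℝ) < s := hs
    rw [derivHeat₃_smul i j k (by linarith)]; ring
  rw [h1, derivHeat_apply, integral_mul_const]
  rcases eq_or_ne ξ 0 with rfl | hξ
  · simp [derivSymbol]
  · rw [integral_heatSymbol_Ioi hξ]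
    have hn : ((‖ξ‖ : ℝ) : ℂ) ≠ 0 := by exact_mod_cast norm_ne_zero_iff.2 hξ
    have hp : ((Real.pi : ℝ) : ℂ) ≠ 0 := by exact_mod_cast Real.pi_ne_zero
    unfold leraySymbol derivSymbol
    have hI : Complex.I ^ 2 = -1 := Complex.I_sq
    push_cast
    split_ifs with hij
    all_goals
      simp only [Complex.ofReal_one, Complex.ofReal_zero]
      field_simp
      ring_nf
      rw [hI]
      ring

end

/-! ### The Oseen kernel is a good kernel -/

section

variable {d : ℕ}

/-- Three derivatives on the heat kernel give a decay of `s^{-3/2}`, and this is what makes the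
superposition over large heat times converge. -/
theorem lintegral_Ioi_sqrt_pow_inv_le {n : ℕ} (hn : 3 ≤ n) :
    ∫⁻ s in Ioi (1 : ℝ), ENNReal.ofReal (√s ^ n)⁻¹ ≤ 2 := by
  have h : ∀ s ∈ Ioi (1 : ℝ), (√s ^ n)⁻¹ ≤ s ^ (-(3 / 2) : ℝ) := fun s hs => by
    have hs1 : (1 : ℝ) < s := hs
    have hs0 : 0 < s := by linarith
    rw [Real.rpow_neg hs0.le]
    refine inv_anti₀ (by positivity) ?_
    rw [Real.sqrt_eq_rpow, ← Real.rpow_natCast, ← Real.rpow_mul hs0.le]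
    refine Real.rpow_le_rpow_of_exponent_le hs1.le ?_
    have : (3 : ℝ) ≤ n := by exact_mod_cast hn
    linarith
  calc _ ≤ ∫⁻ s in Ioi (1 : ℝ), ENNReal.ofReal (s ^ (-(3 / 2) : ℝ)) :=
        setLIntegral_mono' measurableSet_Ioi fun s hs => ENNReal.ofReal_le_ofReal (h s hs)
    _ = ENNReal.ofReal (∫ s in Ioi (1 : ℝ), s ^ (-(3 / 2) : ℝ)) := by
        rw [ofReal_integral_eq_lintegral_ofReal]
        · exact integrableOn_Ioi_rpow_of_lt (by norm_num) one_pos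
        · filter_upwards [ae_restrict_mem measurableSet_Ioi] with s hs
          have hs1 : (1 : ℝ) < s := hs
          positivity
    _ = 2 := by
        rw [integral_Ioi_rpow_of_lt (by norm_num) one_pos]
        norm_num

/-- The absolute convergence that permits exchanging the integral in `s` with the Fourier integral.
On the frequency side, dilating by `√s ≥ 1` can only decrease the integral in `ξ`. -/
theorem integrable_derivHeat₃_prod (i j k : Fin d) :
    Integrable (fun z : ℝ × Space d => ((√z.1 ^ 3)⁻¹ : ℝ) • derivHeat₃ i j k (√z.1 • z.2))
      ((volume.restrict (Ioi (1 : ℝ))).prod volume) := by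
  have hm : Measurable fun z : ℝ × Space d => ((√z.1 ^ 3)⁻¹ : ℝ) • derivHeat₃ i j k (√z.1 • z.2) := by
    have h1 : Measurable fun z : ℝ × Space d => (√z.1 ^ 3)⁻¹ := by fun_prop
    have h2 : Continuous fun z : ℝ × Space d => derivHeat₃ i j k (√z.1 • z.2) :=
      (derivHeat₃ i j k).continuous.comp (by fun_prop)
    exact h1.smul h2.measurable
  refine ⟨hm.aestronglyMeasurable, ?_⟩
  rw [hasFiniteIntegral_iff_enorm, lintegral_prod _ hm.enorm.aemeasurable]
  have step : ∀ s ∈ Ioi (1 : ℝ), ∫⁻ ξ : Space d, ‖((√s ^ 3)⁻¹ : ℝ) • derivHeat₃ i j k (√s • ξ)‖ₑ ≤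
      ENNReal.ofReal (√s ^ 3)⁻¹ * ∫⁻ ξ, ‖derivHeat₃ i j k ξ‖ₑ := fun s hs => by
    have hs1 : (1 : ℝ) < s := hs
    have hl : 1 < √s := by rw [Real.lt_sqrt (by norm_num)]; simpa using hs1
    simp_rw [enorm_smul]
    rw [lintegral_const_mul' _ _ (by simp), Real.enorm_of_nonneg (by positivity)]
    refine mul_le_mul' le_rfl ?_
    have := lintegral_comp_inv_smul (d := d) (l := (√s)⁻¹) (by positivity)
      (f := fun ξ => ‖derivHeat₃ i j k ξ‖ₑ) (derivHeat₃ i j k).continuous.enorm.measurable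
    rw [inv_inv] at this
    rw [this]
    refine mul_le_of_le_one_left zero_le ?_
    rw [ENNReal.ofReal_le_one]
    exact pow_le_one₀ (by positivity) (inv_le_one_of_one_le₀ hl.le)
  refine (setLIntegral_mono' measurableSet_Ioi step).trans_lt ?_
  rw [lintegral_mul_const']
  · exact ENNReal.mul_lt_top ((lintegral_Ioi_sqrt_pow_inv_le le_rfl).trans_lt (by simp))
      (derivHeat₃ i j k).integrable.2
  · exact (derivHeat₃ i j k).integrable.2.ne

theorem integrable_oseenSymbol (i j k : Fin d) :
    Integrable fun ξ : Space d => heatSymbol 1 ξ * (leraySymbol i j ξ : ℂ) * derivSymbol k ξ := by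
  simp_rw [heatSymbol_mul_leraySymbol]
  refine ((derivHeat k).integrable.const_mul _).add ?_
  exact (integrable_derivHeat₃_prod i j k).integral_prod_right

/-- Under inverse Fourier transformation, the frequency dilation by `√s` and the factor `s^{-3/2}`
combine into `dil 3`. -/
theorem oseenKernel_one_eq (i j k : Fin d) (x : Space d) :
    oseenKernel i j k 1 x = (if i = j then 1 else 0) * 𝓕⁻ (derivHeat k) x +
      ∫ s in Ioi (1 : ℝ), dil 3 (√s) (𝓕⁻ (derivHeat₃ i j k) : 𝓢(Space d, ℂ)) x := by
  obtain ⟨e, he⟩ : ∃ e : Space d → ℂ,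
      ∀ ξ, e ξ = Complex.exp (↑(2 * Real.pi * inner ℝ ξ x) * Complex.I) := ⟨_, fun ξ => rfl⟩
  have hec : Continuous e := by
    rw [funext he]; fun_prop
  have hen : ∀ ξ, ‖e ξ‖ = 1 := fun ξ => by rw [he]; exact Complex.norm_exp_ofReal_mul_I _
  have hF : ∀ f : Space d → ℂ, 𝓕⁻ f x = ∫ ξ, e ξ • f ξ := fun f => by
    rw [Real.fourierInv_eq']; simp_rw [he]
  obtain ⟨G, hG⟩ : ∃ G : ℝ → Space d → ℂ,
      ∀ s ξ, G s ξ = ((√s ^ 3)⁻¹ : ℝ) • derivHeat₃ i j k (√s • ξ) := ⟨_, fun s ξ => rfl⟩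
  have hGi : Integrable (fun z : ℝ × Space d => G z.1 z.2)
      ((volume.restrict (Ioi (1 : ℝ))).prod volume) := by
    simp_rw [hG]; exact integrable_derivHeat₃_prod i j k
  have i1 : Integrable fun ξ : Space d => e ξ • ((if i = j then (1 : ℂ) else 0) * derivHeat k ξ) :=
    ((derivHeat k).integrable.const_mul _).bdd_mul (c := 1) hec.aestronglyMeasurable
      (Eventually.of_forall fun ξ => (hen ξ).le)
  have i2 : Integrable fun ξ : Space d => e ξ • ∫ s in Ioi (1 : ℝ), G s ξ :=
    hGi.integral_prod_right.bdd_mul (c := 1) hec.aestronglyMeasurable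
      (Eventually.of_forall fun ξ => (hen ξ).le)
  have i3 : Integrable (Function.uncurry fun (s : ℝ) (ξ : Space d) => e ξ • G s ξ)
      ((volume.restrict (Ioi (1 : ℝ))).prod volume) := by
    have : Integrable (fun z : ℝ × Space d => e z.2 * G z.1 z.2)
        ((volume.restrict (Ioi (1 : ℝ))).prod volume) :=
      hGi.bdd_mul (c := 1) (hec.comp continuous_snd).aestronglyMeasurable
        (Eventually.of_forall fun z => (hen z.2).le)
    exact this
  have hdil : ∀ s ∈ Ioi (1 : ℝ), ∫ ξ, e ξ • G s ξ =
      dil 3 (√s) (𝓕⁻ (derivHeat₃ i j k) : 𝓢(Space d, ℂ)) x := fun s hs => by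
    have hs1 : (1 : ℝ) < s := hs
    have hl : 0 < √s := Real.sqrt_pos.2 (by linarith)
    have h1 := congrFun (fourierInv_const_smul (√s ^ 3)⁻¹
      (fun ξ : Space d => derivHeat₃ i j k (√s • ξ))) x
    rw [fourierInv_comp_smul hl, dil_smul_eq (√s), hF] at h1
    rw [SchwartzMap.fourierInv_coe, ← h1]
    simp_rw [hG]
  calc oseenKernel i j k 1 x
      = ∫ ξ, e ξ • (heatSymbol 1 ξ * (leraySymbol i j ξ : ℂ) * derivSymbol k ξ) := by
        rw [oseenKernel, hF]
    _ = ∫ ξ, (e ξ • ((if i = j then (1 : ℂ) else 0) * derivHeat k ξ) +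
          e ξ • ∫ s in Ioi (1 : ℝ), G s ξ) := by
        refine integral_congr_ae (Eventually.of_forall fun ξ => ?_)
        simp only [heatSymbol_mul_leraySymbol, smul_add, hG]
    _ = (∫ ξ, e ξ • ((if i = j then (1 : ℂ) else 0) * derivHeat k ξ)) +
          ∫ ξ, e ξ • ∫ s in Ioi (1 : ℝ), G s ξ := integral_add i1 i2
    _ = _ := by
        congr 1
        · rw [SchwartzMap.fourierInv_coe, hF, ← integral_const_mul]
          refine integral_congr_ae (Eventually.of_forall fun ξ => ?_)
          simp only [smul_eq_mul]; ring
        · simp_rw [← integral_smul]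
          rw [← integral_integral_swap i3]
          exact setIntegral_congr_fun measurableSet_Ioi hdil

theorem measurable_dil_sqrt (n : ℕ) (h : Space d) {B : Space d → ℂ} (hB : Continuous B) :
    Measurable fun z : Space d × ℝ => dil n (√z.2) B (z.1 + h) := by
  unfold dil
  have h1 : Measurable fun z : Space d × ℝ => B ((√z.2)⁻¹ • (z.1 + h)) :=
    hB.measurable.comp (by fun_prop)
  have h2 : Measurable fun z : Space d × ℝ => (√z.2 ^ (d + n))⁻¹ := by fun_prop
  exact h2.smul h1

/-- In `L¹` the copy at heat time `s` contributes `s^{-3/2}`, and its increments `s^{-2}`; both are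
integrable over `s > 1`, so no pointwise decay in `x` is needed. Boundedness and continuity follow
from the integrability of the symbol. -/
theorem goodKernel_oseenKernel (i j k : Fin d) : GoodKernel (oseenKernel i j k 1) := by
  have hint := integrable_oseenSymbol i j k
  obtain ⟨A, hA'⟩ : ∃ A : 𝓢(Space d, ℂ), A = 𝓕⁻ (derivHeat k) := ⟨_, rfl⟩
  obtain ⟨B, hB'⟩ : ∃ B : 𝓢(Space d, ℂ), B = 𝓕⁻ (derivHeat₃ i j k) := ⟨_, rfl⟩
  have hA := goodKernel_of_schwartz A
  have hB := goodKernel_of_schwartz B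
  have hcont : Continuous (oseenKernel i j k 1) := by
    rw [oseenKernel, Real.fourierInv_eq_fourier_comp_neg]
    exact VectorFourier.fourierIntegral_continuous Real.continuous_fourierChar
      (by exact continuous_inner) hint.comp_neg
  obtain ⟨a, ha⟩ := hA.shift
  obtain ⟨b, hb⟩ := hB.shift
  have hmB : Measurable fun z : Space d × ℝ => dil 3 (√z.2) B z.1 := by
    simpa only [add_zero] using measurable_dil_sqrt 3 (0 : Space d) B.continuous
  have bound : ∀ {n : ℕ}, 3 ≤ n → ∀ (F : Space d → ℝ → ℂ), Measurable (Function.uncurry F) →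
      ∀ c : ℝ≥0∞, c ≠ ∞ →
      (∀ s, 1 < s → ∫⁻ x, ‖F x s‖ₑ ≤ ENNReal.ofReal (√s ^ n)⁻¹ * c) →
      ∫⁻ x, ‖∫ s in Ioi (1 : ℝ), F x s‖ₑ ≤ 2 * c := by
    intro n hn F hF c hc hs
    calc _ ≤ ∫⁻ x, ∫⁻ s in Ioi (1 : ℝ), ‖F x s‖ₑ :=
          lintegral_mono fun x => enorm_integral_le_lintegral_enorm _
      _ = ∫⁻ s in Ioi (1 : ℝ), ∫⁻ x, ‖F x s‖ₑ := lintegral_lintegral_swap hF.enorm.aemeasurable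
      _ ≤ ∫⁻ s in Ioi (1 : ℝ), ENNReal.ofReal (√s ^ n)⁻¹ * c :=
          setLIntegral_mono' measurableSet_Ioi hs
      _ ≤ _ := by
          rw [lintegral_mul_const' _ _ hc]
          exact mul_le_mul' (lintegral_Ioi_sqrt_pow_inv_le hn) le_rfl
  have hBn : ∫⁻ x, ‖∫ s in Ioi (1 : ℝ), dil 3 (√s) B x‖ₑ ≤ 2 * ∫⁻ x, ‖B x‖ₑ := by
    refine bound le_rfl (fun x s => dil 3 (√s) B x) hmB _ B.integrable.2.ne fun s hs => ?_
    rw [lintegral_enorm_dil (Real.sqrt_pos.2 (by linarith)) B.continuous]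
  have hsI : ∀ x, Integrable (fun s => dil 3 (√s) B x) (volume.restrict (Ioi (1 : ℝ))) := fun x => by
    obtain ⟨c, hc⟩ := hB.bounded
    refine ⟨(hmB.comp measurable_prodMk_left).aestronglyMeasurable, ?_⟩
    rw [hasFiniteIntegral_iff_enorm]
    calc _ ≤ ∫⁻ s in Ioi (1 : ℝ), ENNReal.ofReal (√s ^ (d + 3))⁻¹ * c := by
          refine setLIntegral_mono' measurableSet_Ioi fun s hs => ?_
          have hs1 : (1 : ℝ) < s := hs
          rw [enorm_dil (Real.sqrt_pos.2 (by linarith))]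
          exact mul_le_mul' le_rfl (hc _)
      _ ≤ 2 * c := by
          rw [lintegral_mul_const' _ _ (by simp)]
          exact mul_le_mul' (lintegral_Ioi_sqrt_pow_inv_le (by omega)) le_rfl
      _ < ∞ := ENNReal.mul_lt_top (by simp) (by simp)
  obtain ⟨δ, hδ⟩ : ∃ δ : ℂ, δ = if i = j then 1 else 0 := ⟨_, rfl⟩
  have hδ1 : ‖δ‖ₑ ≤ 1 := by rw [hδ]; split_ifs <;> simp
  have hO : ∀ x, oseenKernel i j k 1 x = δ * A x + ∫ s in Ioi (1 : ℝ), dil 3 (√s) B x := by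
    rw [hA', hB', hδ]
    exact oseenKernel_one_eq i j k
  refine ⟨hcont, ⟨hcont.aestronglyMeasurable, ?_⟩, ⟨(∫⁻ ξ, ‖heatSymbol 1 ξ *
    (leraySymbol i j ξ : ℂ) * derivSymbol k ξ‖ₑ).toNNReal, fun x => ?_⟩, ⟨a + 2 * b, fun h => ?_⟩⟩
  · rw [hasFiniteIntegral_iff_enorm]
    calc _ ≤ ∫⁻ x, (‖A x‖ₑ + ‖∫ s in Ioi (1 : ℝ), dil 3 (√s) B x‖ₑ) := by
          refine lintegral_mono fun x => ?_
          rw [hO]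
          refine (enorm_add_le _ _).trans (add_le_add ?_ le_rfl)
          rw [enorm_mul]
          exact mul_le_of_le_one_left zero_le hδ1
      _ ≤ (∫⁻ x, ‖A x‖ₑ) + 2 * ∫⁻ x, ‖B x‖ₑ := by
          rw [lintegral_add_left A.continuous.enorm.measurable]
          exact add_le_add le_rfl hBn
      _ < ∞ := ENNReal.add_lt_top.2 ⟨A.integrable.2, ENNReal.mul_lt_top (by simp) B.integrable.2⟩
  · rw [ENNReal.coe_toNNReal hint.2.ne, oseenKernel, Real.fourierInv_eq']
    refine (enorm_integral_le_lintegral_enorm _).trans (lintegral_mono fun ξ => ?_)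
    rw [enorm_smul]
    refine mul_le_of_le_one_left zero_le ?_
    rw [← ofReal_norm, Complex.norm_exp_ofReal_mul_I, ENNReal.ofReal_one]
  · calc _ ≤ ∫⁻ x, (‖A (x + h) - A x‖ₑ +
            ‖∫ s in Ioi (1 : ℝ), (dil 3 (√s) B (x + h) - dil 3 (√s) B x)‖ₑ) := by
          refine lintegral_mono fun x => ?_
          rw [hO, hO, integral_sub (hsI _) (hsI _), add_sub_add_comm, ← mul_sub]
          refine (enorm_add_le _ _).trans (add_le_add ?_ le_rfl)
          rw [enorm_mul]
          exact mul_le_of_le_one_left zero_le hδ1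
      _ ≤ a * ‖h‖ₑ + 2 * (b * ‖h‖ₑ) := by
          have hm : Measurable fun x => ‖A (x + h) - A x‖ₑ :=
            ((A.continuous.comp (continuous_add_const h)).sub A.continuous).enorm.measurable
          rw [lintegral_add_left hm]
          refine add_le_add (ha h) ?_
          have hm1 : Measurable fun z : Space d × ℝ => dil 3 (√z.2) B (z.1 + h) :=
            measurable_dil_sqrt 3 h B.continuous
          refine bound (n := 4) (by norm_num) (fun x s => dil 3 (√s) B (x + h) - dil 3 (√s) B x)
            (hm1.sub hmB) _ (ENNReal.mul_ne_top (by simp) (by simp)) fun s hs => ?_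
          have hl : 0 < √s := Real.sqrt_pos.2 (by linarith)
          rw [lintegral_enorm_dil_shift hl B.continuous]
          refine (mul_le_mul' le_rfl (hb _)).trans (le_of_eq ?_)
          rw [enorm_smul, Real.enorm_of_nonneg (by positivity)]
          have : ENNReal.ofReal (√s ^ 4)⁻¹ = ENNReal.ofReal (√s ^ 3)⁻¹ * ENNReal.ofReal (√s)⁻¹ := by
            rw [← ENNReal.ofReal_mul (by positivity), ← mul_inv, ← pow_succ]
          rw [this]; ring
      _ = _ := by push_cast; ring

end

/-! ### Norm bounds for convolutions and the Oseen operator -/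

section

variable {d : ℕ}

theorem eLpNorm_ofReal {α ε : Type*} [MeasurableSpace α] {μ : Measure α} [TopologicalSpace ε]
    [ContinuousENorm ε] {p : ℝ} (hp : 0 < p) (f : α → ε) :
    eLpNorm f (ENNReal.ofReal p) μ = (∫⁻ x, ‖f x‖ₑ ^ p ∂μ) ^ (1 / p) := by
  rw [eLpNorm_eq_lintegral_rpow_enorm_toReal (by simpa using hp) ENNReal.ofReal_ne_top,
    ENNReal.toReal_ofReal hp.le]

theorem eLpNorm_lintegral_le {α β : Type*} [MeasurableSpace α] [MeasurableSpace β]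
    {μ : Measure α} {ν : Measure β} [SFinite μ] [SigmaFinite ν] {F : α → β → ℝ≥0∞}
    (hF : Measurable (Function.uncurry F)) {p : ℝ} (hp : 1 ≤ p) :
    eLpNorm (fun y => ∫⁻ x, F x y ∂μ) (ENNReal.ofReal p) ν ≤
      ∫⁻ x, eLpNorm (F x) (ENNReal.ofReal p) ν ∂μ := by
  have hp0 : 0 < p := by linarith
  simp_rw [eLpNorm_ofReal hp0, enorm_eq_self]
  exact lintegral_rpow_lintegral_le hF hp

theorem eLpNorm_const_mul_ennreal {α : Type*} [MeasurableSpace α] {μ : Measure α} {p : ℝ}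
    (hp : 0 < p) (c : ℝ≥0∞) {f : α → ℝ≥0∞} (hf : Measurable f) :
    eLpNorm (fun x => c * f x) (ENNReal.ofReal p) μ = c * eLpNorm f (ENNReal.ofReal p) μ := by
  simp_rw [eLpNorm_ofReal hp, enorm_eq_self, ENNReal.mul_rpow_of_nonneg _ _ hp.le]
  rw [lintegral_const_mul _ (hf.pow_const _), ENNReal.mul_rpow_of_nonneg _ _ (by positivity),
    ← ENNReal.rpow_mul, mul_one_div_cancel hp.ne', ENNReal.rpow_one]

theorem eLpNorm_comp_sub_right {ε : Type*} [TopologicalSpace ε] [ContinuousENorm ε]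
    [MeasurableSpace ε] [OpensMeasurableSpace ε] {p : ℝ} (hp : 0 < p) (f : Space d → ε)
    (y : Space d) :
    eLpNorm (fun x => f (x - y)) (ENNReal.ofReal p) = eLpNorm f (ENNReal.ofReal p) := by
  simp_rw [eLpNorm_ofReal hp]
  rw [lintegral_sub_right_eq_self (fun x => ‖f x‖ₑ ^ p)]

/-- Young's inequality. -/
theorem eLpNorm_lintegral_conv_le {p : ℝ} (hp : 1 ≤ p) {K g : Space d → ℝ≥0∞}
    (hK : Measurable K) (hg : Measurable g) :
    eLpNorm (fun x => ∫⁻ y, K (x - y) * g y) (ENNReal.ofReal p) ≤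
      (∫⁻ x, K x) * eLpNorm g (ENNReal.ofReal p) := by
  have hp0 : 0 < p := by linarith
  have h1 : ∀ x, ∫⁻ y, K (x - y) * g y = ∫⁻ y, K y * g (x - y) := fun x => by
    rw [← lintegral_sub_left_eq_self _ x]; simp only [sub_sub_cancel]
  simp_rw [h1]
  refine (eLpNorm_lintegral_le (F := fun y x => K y * g (x - y)) (by fun_prop) hp).trans
    (le_of_eq ?_)
  rw [← lintegral_mul_const _ hK]
  refine lintegral_congr fun y => ?_
  have hg' : Measurable fun x => g (x - y) := hg.comp (measurable_sub_const y)
  rw [eLpNorm_const_mul_ennreal hp0 _ hg', eLpNorm_comp_sub_right hp0]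

/-- Hölder's inequality for the measure `K(y) dy`; its total mass appears because it need not be
one. -/
theorem lintegral_mul_rpow_le {K f : Space d → ℝ≥0∞} (hK : Measurable K) (hf : Measurable f)
    {r q : ℝ} (hr : 0 < r) (hrq : r ≤ q) :
    ∫⁻ y, K y * f y ^ r ≤ (∫⁻ y, K y * f y ^ q) ^ (r / q) * (∫⁻ y, K y) ^ (1 - r / q) := by
  have hq : 0 < q := hr.trans_le hrq
  have h1 : r / q ≤ 1 := (div_le_one hq).2 hrq
  have h0 : 0 < r / q := by positivity
  refine le_trans (le_of_eq ?_) (ENNReal.lintegral_mul_norm_pow_le (hK.mul (hf.pow_const q)).aemeasurable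
    hK.aemeasurable (p := r / q) (q := 1 - r / q) h0.le (by linarith) (by ring))
  refine lintegral_congr fun y => ?_
  rw [Pi.mul_apply, ENNReal.mul_rpow_of_nonneg _ _ h0.le, ← ENNReal.rpow_mul, mul_div_cancel₀ _ hq.ne',
    mul_right_comm, ← ENNReal.rpow_add_of_nonneg _ _ h0.le (by linarith), add_sub_cancel,
    ENNReal.rpow_one]

/-- Hölder's inequality for the convolution of a bounded integrable kernel and a function that is
bounded and in `L^q`. -/
theorem lintegral_conv_rpow_le {K f : Space d → ℝ≥0∞} (hK : Measurable K) (hf : Measurable f)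
    {r q : ℝ} (hr : 0 < r) (hrq : r ≤ q) {c : ℝ≥0∞} (hc : ∀ x, K x ≤ c) (x : Space d) :
    ∫⁻ y, K (x - y) * f y ^ r ≤
      c ^ (r / q) * (∫⁻ y, K y) ^ (1 - r / q) * eLpNorm f (ENNReal.ofReal q) ^ r := by
  have hq : 0 < q := hr.trans_le hrq
  have h0 : 0 < r / q := by positivity
  have hK' : Measurable fun y => K (x - y) := hK.comp (measurable_const_sub x)
  refine (lintegral_mul_rpow_le hK' hf hr hrq).trans ?_
  rw [lintegral_sub_left_eq_self K x, eLpNorm_ofReal hq, ← ENNReal.rpow_mul, mul_right_comm,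
    one_div_mul_eq_div, ← ENNReal.mul_rpow_of_nonneg _ _ h0.le]
  refine mul_le_mul' (ENNReal.rpow_le_rpow ?_ h0.le) le_rfl
  simp_rw [enorm_eq_self]
  rw [← lintegral_const_mul _ (hf.pow_const q)]
  exact lintegral_mono fun y => mul_le_mul' (hc _) le_rfl

/-! ### Scalar majorants of the Oseen operator. -/

theorem enorm_vec_le (v : Vec d) : ‖v‖ₑ ≤ ∑ i, ‖v i‖ₑ := by
  have h : v = ∑ i, EuclideanSpace.single i (v i) := by
    ext j
    simp [Pi.single_apply]
  calc ‖v‖ₑ = ‖∑ i, EuclideanSpace.single i (v i)‖ₑ := by rw [← h]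
    _ ≤ ∑ i, ‖EuclideanSpace.single i (v i)‖ₑ := enorm_sum_le _ _
    _ = _ := by
      refine Finset.sum_congr rfl fun i _ => ?_
      rw [← ofReal_norm, ← ofReal_norm, PiLp.norm_single]

theorem stronglyMeasurable_oseenKernel (i j k : Fin d) :
    StronglyMeasurable fun z : ℝ × Space d => oseenKernel i j k z.1 z.2 := by
  simp only [oseenKernel, Real.fourierInv_eq']
  have h : Measurable fun w : (ℝ × Space d) × Space d =>
      Complex.exp (↑(2 * Real.pi * inner ℝ w.2 w.1.2) * Complex.I) •
        (heatSymbol w.1.1 w.2 * (leraySymbol i j w.2 : ℂ) * derivSymbol k w.2) := by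
    unfold heatSymbol leraySymbol derivSymbol
    fun_prop
  exact h.stronglyMeasurable.integral_prod_right

/-- A scalar kernel which dominates `e^{τΔ} ℙ ∇`. -/
noncomputable def oseenAbs (τ : ℝ) (x : Space d) : ℝ≥0∞ :=
  ∑ i : Fin d, ∑ j : Fin d, ∑ k : Fin d, ‖oseenKernel i j k τ x‖ₑ

/-- A scalar kernel which dominates the increments of `e^{τΔ} ℙ ∇`. -/
noncomputable def oseenDiff (h : Space d) (τ : ℝ) (x : Space d) : ℝ≥0∞ :=
  ∑ i : Fin d, ∑ j : Fin d, ∑ k : Fin d, ‖oseenKernel i j k τ (x + h) - oseenKernel i j k τ x‖ₑ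

theorem measurable_oseenAbs : Measurable fun z : ℝ × Space d => oseenAbs z.1 z.2 := by
  unfold oseenAbs
  refine Finset.measurable_fun_sum _ fun i _ => Finset.measurable_fun_sum _ fun j _ =>
    Finset.measurable_fun_sum _ fun k _ => ?_
  exact (stronglyMeasurable_oseenKernel i j k).measurable.enorm

theorem measurable_oseenKernel_apply (i j k : Fin d) (τ : ℝ) : Measurable (oseenKernel i j k τ) :=
  (stronglyMeasurable_oseenKernel i j k).measurable.of_uncurry_left

theorem measurable_oseenDiff (h : Space d) (τ : ℝ) : Measurable (oseenDiff h τ) := by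
  unfold oseenDiff
  refine Finset.measurable_fun_sum _ fun i _ => Finset.measurable_fun_sum _ fun j _ =>
    Finset.measurable_fun_sum _ fun k _ => ?_
  have := measurable_oseenKernel_apply i j k τ
  exact ((this.comp (measurable_add_const h)).sub this).enorm

theorem ofReal_sqrt_rpow_neg {τ : ℝ} (hτ : 0 < τ) (β : ℝ) :
    ENNReal.ofReal (√τ ^ (-β)) = timeKernel (β / 2) τ := by
  rw [timeKernel_of_pos hτ, Real.sqrt_eq_rpow, ← Real.rpow_mul hτ.le]
  congr 2; ring

theorem ofReal_sqrt_pow_inv {τ : ℝ} (hτ : 0 < τ) (n : ℕ) :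
    ENNReal.ofReal (√τ ^ n)⁻¹ = timeKernel (n / 2) τ := by
  rw [← ofReal_sqrt_rpow_neg hτ, Real.rpow_neg (Real.sqrt_nonneg _), Real.rpow_natCast]

theorem lintegral_sum₃ {α ι : Type*} [MeasurableSpace α] {μ : Measure α} [Fintype ι]
    {f : ι → ι → ι → α → ℝ≥0∞} (hf : ∀ i j k, Measurable (f i j k)) :
    ∫⁻ x, ∑ i, ∑ j, ∑ k, f i j k x ∂μ = ∑ i, ∑ j, ∑ k, ∫⁻ x, f i j k x ∂μ := by
  rw [lintegral_finsetSum _ fun i _ => by fun_prop]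
  refine Finset.sum_congr rfl fun i _ => ?_
  rw [lintegral_finsetSum _ fun j _ => by fun_prop]
  refine Finset.sum_congr rfl fun j _ => ?_
  rw [lintegral_finsetSum _ fun k _ => by fun_prop]

/-- The heat time acts only by dilation, so everything follows from time one: `τ^{-1/2}` in `L¹`
here, and below `τ^{-(d+1)/2}` in sup norm and `τ^{-(1+σ)/2}` for increments of order `σ`. -/
theorem exists_lintegral_oseenAbs_le (d : ℕ) :
    ∃ c : ℝ≥0, ∀ τ > 0, ∫⁻ x : Space d, oseenAbs τ x ≤ c * timeKernel (1 / 2) τ := by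
  refine ⟨∑ i : Fin d, ∑ j : Fin d, ∑ k : Fin d, (∫⁻ x, ‖oseenKernel i j k 1 x‖ₑ).toNNReal,
    fun τ hτ => ?_⟩
  have hm := fun i j k => (measurable_oseenKernel_apply (d := d) i j k τ).enorm
  push_cast
  simp_rw [Finset.sum_mul]
  unfold oseenAbs
  rw [lintegral_sum₃ hm]
  refine Finset.sum_le_sum fun i _ => Finset.sum_le_sum fun j _ => Finset.sum_le_sum fun k _ => ?_
  have hg := goodKernel_oseenKernel i j k
  rw [oseenKernel_eq_dil i j k hτ, lintegral_enorm_dil (Real.sqrt_pos.2 hτ) hg.continuous,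
    ENNReal.coe_toNNReal hg.integrable.2.ne, ofReal_sqrt_pow_inv hτ, mul_comm, Nat.cast_one]

theorem exists_oseenAbs_le (d : ℕ) :
    ∃ c : ℝ≥0, ∀ τ > 0, ∀ x : Space d, oseenAbs τ x ≤ c * timeKernel ((d + 1) / 2) τ := by
  choose c hc using fun i j k => (goodKernel_oseenKernel (d := d) i j k).bounded
  refine ⟨∑ i : Fin d, ∑ j : Fin d, ∑ k : Fin d, c i j k, fun τ hτ x => ?_⟩
  push_cast
  simp_rw [Finset.sum_mul]
  refine Finset.sum_le_sum fun i _ => Finset.sum_le_sum fun j _ => Finset.sum_le_sum fun k _ => ?_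
  rw [oseenKernel_eq_dil i j k hτ, enorm_dil (Real.sqrt_pos.2 hτ), ofReal_sqrt_pow_inv hτ, mul_comm]
  push_cast
  exact mul_le_mul' (hc _ _ _ _) le_rfl

theorem exists_lintegral_oseenDiff_le (d : ℕ) {σ : ℝ} (hσ0 : 0 ≤ σ) (hσ1 : σ ≤ 1) :
    ∃ c : ℝ≥0, ∀ τ > 0, ∀ h : Space d,
      ∫⁻ x, oseenDiff h τ x ≤ c * timeKernel ((1 + σ) / 2) τ * ‖h‖ₑ ^ σ := by
  choose c hc using fun i j k => (goodKernel_oseenKernel (d := d) i j k).exists_shift_le hσ0 hσ1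
  refine ⟨∑ i : Fin d, ∑ j : Fin d, ∑ k : Fin d, c i j k, fun τ hτ h => ?_⟩
  have hm : ∀ i j k, Measurable fun x => ‖oseenKernel i j k τ (x + h) - oseenKernel i j k τ x‖ₑ :=
    fun i j k => by
      have := measurable_oseenKernel_apply i j k τ
      exact ((this.comp (measurable_add_const h)).sub this).enorm
  push_cast
  simp_rw [Finset.sum_mul]
  unfold oseenDiff
  rw [lintegral_sum₃ hm]
  refine Finset.sum_le_sum fun i _ => Finset.sum_le_sum fun j _ => Finset.sum_le_sum fun k _ => ?_
  have := hc i j k 1 (√τ) (Real.sqrt_pos.2 hτ) h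
  rw [ofReal_sqrt_rpow_neg hτ, Nat.cast_one] at this
  rwa [oseenKernel_eq_dil i j k hτ]

theorem enorm_oseenKernel_le (i j k : Fin d) (τ : ℝ) (x : Space d) :
    ‖oseenKernel i j k τ x‖ₑ ≤ oseenAbs τ x := by
  unfold oseenAbs
  refine (Finset.single_le_sum (f := fun k => ‖oseenKernel i j k τ x‖ₑ) (fun _ _ => zero_le)
    (Finset.mem_univ k)).trans ?_
  refine (Finset.single_le_sum (f := fun j => ∑ k, ‖oseenKernel i j k τ x‖ₑ) (fun _ _ => zero_le)
    (Finset.mem_univ j)).trans ?_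
  exact Finset.single_le_sum (f := fun i => ∑ j, ∑ k, ‖oseenKernel i j k τ x‖ₑ)
    (fun _ _ => zero_le) (Finset.mem_univ i)

theorem enorm_apply_apply_le (A : Fin d → Fin d → ℂ) (j k : Fin d) : ‖A j k‖ₑ ≤ ‖A‖ₑ := by
  rw [← ofReal_norm, ← ofReal_norm]
  exact ENNReal.ofReal_le_ofReal ((norm_le_pi_norm (A j) k).trans (norm_le_pi_norm A j))

theorem enorm_sum_integral_le (K : Fin d → Fin d → Fin d → Space d → ℂ)
    (hK : ∀ i j k, Measurable (K i j k)) {F : Space d → Fin d → Fin d → ℂ} (hF : Measurable F)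
    (v : Vec d) (hv : ∀ i, v i = ∑ j, ∑ k, ∫ y, K i j k y * F y j k) :
    ‖v‖ₑ ≤ ∫⁻ y, (∑ i, ∑ j, ∑ k, ‖K i j k y‖ₑ) * ‖F y‖ₑ := by
  have hm : ∀ i j k, Measurable fun y => ‖K i j k y‖ₑ * ‖F y‖ₑ := fun i j k =>
    (hK i j k).enorm.mul hF.enorm
  refine (enorm_vec_le v).trans ?_
  simp_rw [Finset.sum_mul]
  rw [lintegral_sum₃ hm]
  refine Finset.sum_le_sum fun i _ => ?_
  rw [hv]
  refine (enorm_sum_le _ _).trans (Finset.sum_le_sum fun j _ => ?_)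
  refine (enorm_sum_le _ _).trans (Finset.sum_le_sum fun k _ => ?_)
  refine (enorm_integral_le_lintegral_enorm _).trans (lintegral_mono fun y => ?_)
  rw [enorm_mul]
  exact mul_le_mul' le_rfl (enorm_apply_apply_le _ _ _)

theorem enorm_heatLerayDiv_le (τ : ℝ) {F : Space d → Fin d → Fin d → ℂ} (hF : Measurable F)
    (x : Space d) : ‖heatLerayDiv τ F x‖ₑ ≤ ∫⁻ y, oseenAbs τ (x - y) * ‖F y‖ₑ :=
  enorm_sum_integral_le (fun i j k y => oseenKernel i j k τ (x - y))
    (fun i j k => (measurable_oseenKernel_apply i j k τ).comp (measurable_const_sub x)) hF _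
    fun _ => rfl

theorem integrable_oseenKernel_mul {τ : ℝ} {F : Space d → Fin d → Fin d → ℂ} (hF : Measurable F)
    {x : Space d} (h : ∫⁻ y, oseenAbs τ (x - y) * ‖F y‖ₑ ≠ ∞) (i j k : Fin d) :
    Integrable fun y => oseenKernel i j k τ (x - y) * F y j k := by
  have hm : Measurable fun y => oseenKernel i j k τ (x - y) * F y j k :=
    ((measurable_oseenKernel_apply i j k τ).comp (measurable_const_sub x)).mul (by fun_prop)
  refine ⟨hm.aestronglyMeasurable, ?_⟩
  rw [hasFiniteIntegral_iff_enorm]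
  refine lt_of_le_of_lt (lintegral_mono fun y => ?_) h.lt_top
  rw [enorm_mul]
  exact mul_le_mul' (enorm_oseenKernel_le _ _ _ _ _) (enorm_apply_apply_le _ _ _)

theorem heatLerayDiv_sub {τ : ℝ} {F G : Space d → Fin d → Fin d → ℂ} (hF : Measurable F)
    (hG : Measurable G) {x : Space d} (hFx : ∫⁻ y, oseenAbs τ (x - y) * ‖F y‖ₑ ≠ ∞)
    (hGx : ∫⁻ y, oseenAbs τ (x - y) * ‖G y‖ₑ ≠ ∞) :
    heatLerayDiv τ (fun y => F y - G y) x = heatLerayDiv τ F x - heatLerayDiv τ G x := by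
  ext i
  simp only [heatLerayDiv, PiLp.sub_apply, ← Finset.sum_sub_distrib]
  refine Finset.sum_congr rfl fun j _ => Finset.sum_congr rfl fun k _ => ?_
  rw [← integral_sub (integrable_oseenKernel_mul hF hFx i j k)
    (integrable_oseenKernel_mul hG hGx i j k)]
  simp only [Pi.sub_apply, mul_sub]

theorem heatLerayDiv_add_const (τ : ℝ) (F : Space d → Fin d → Fin d → ℂ) (x h : Space d) :
    heatLerayDiv τ F (x + h) = heatLerayDiv τ (fun y => F (y + h)) x := by
  ext i
  simp only [heatLerayDiv]
  refine Finset.sum_congr rfl fun j _ => Finset.sum_congr rfl fun k _ => ?_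
  rw [← integral_add_right_eq_self _ h]
  simp only [add_sub_add_right_eq_sub]

theorem enorm_heatLerayDiv_sub_le {τ : ℝ} {F : Space d → Fin d → Fin d → ℂ} (hF : Measurable F)
    {x h : Space d} (hx : ∫⁻ y, oseenAbs τ (x - y) * ‖F y‖ₑ ≠ ∞)
    (hxh : ∫⁻ y, oseenAbs τ (x + h - y) * ‖F y‖ₑ ≠ ∞) :
    ‖heatLerayDiv τ F (x + h) - heatLerayDiv τ F x‖ₑ ≤
      ∫⁻ y, oseenDiff h τ (x - y) * ‖F y‖ₑ := by
  refine (enorm_sum_integral_le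
    (fun i j k y => oseenKernel i j k τ (x + h - y) - oseenKernel i j k τ (x - y))
    (fun i j k => ((measurable_oseenKernel_apply i j k τ).comp (measurable_const_sub (x + h))).sub
      ((measurable_oseenKernel_apply i j k τ).comp (measurable_const_sub x))) hF _
      fun i => ?_).trans (le_of_eq ?_)
  · simp only [heatLerayDiv, PiLp.sub_apply, ← Finset.sum_sub_distrib]
    refine Finset.sum_congr rfl fun j _ => Finset.sum_congr rfl fun k _ => ?_
    rw [← integral_sub (integrable_oseenKernel_mul hF hxh i j k)
      (integrable_oseenKernel_mul hF hx i j k)]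
    simp only [sub_mul]
  · simp only [oseenDiff, sub_add_eq_add_sub]

theorem heatLerayDiv_congr {τ : ℝ} {F G : Space d → Fin d → Fin d → ℂ} (h : F =ᵐ[volume] G) :
    heatLerayDiv τ F = heatLerayDiv τ G := by
  ext x i
  simp only [heatLerayDiv]
  refine Finset.sum_congr rfl fun j _ => Finset.sum_congr rfl fun k _ => integral_congr_ae ?_
  filter_upwards [h] with y hy
  rw [hy]

/-- The kernel is in `L¹` and in `L^∞`, hence in the dual of `L^p`, so the convolution converges at
every point. Thus linearity of `heatLerayDiv` holds everywhere and not only almost everywhere. -/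
theorem lintegral_oseenAbs_mul_ne_top {τ : ℝ} (hτ : 0 < τ) {p : ℝ} (hp : 1 ≤ p)
    {g : Space d → ℝ≥0∞} (hg : Measurable g) (hgp : eLpNorm g (ENNReal.ofReal p) ≠ ∞)
    (x : Space d) : ∫⁻ y, oseenAbs τ (x - y) * g y ≠ ∞ := by
  obtain ⟨a, ha⟩ := exists_oseenAbs_le d
  obtain ⟨b, hb⟩ := exists_lintegral_oseenAbs_le d
  have h := lintegral_conv_rpow_le (K := oseenAbs τ) measurable_oseenAbs.of_uncurry_left hg
    one_pos hp (ha τ hτ) x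
  simp only [ENNReal.rpow_one] at h
  refine (h.trans_lt ?_).ne
  have hp0 : 0 < p := by linarith
  have h1 : 1 / p ≤ 1 := (div_le_one hp0).2 hp
  refine ENNReal.mul_lt_top (ENNReal.mul_lt_top ?_ ?_) hgp.lt_top
  · exact ENNReal.rpow_lt_top_of_nonneg (by positivity)
      (ENNReal.mul_ne_top (by simp) (timeKernel_ne_top _ _))
  · exact ENNReal.rpow_lt_top_of_nonneg (by linarith)
      (ne_top_of_le_ne_top (ENNReal.mul_ne_top (by simp) (timeKernel_ne_top _ _)) (hb τ hτ))

end

/-! ### Mollification and Hölder seminorms -/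

section

variable {d : ℕ}

theorem GoodKernel.dil {ψ : Space d → ℂ} (hψ : GoodKernel ψ) (n : ℕ) {l : ℝ} (hl : 0 < l) :
    GoodKernel (dil n l ψ) := by
  obtain ⟨b, hb⟩ := hψ.bounded
  obtain ⟨c, hc⟩ := hψ.shift
  have hcont : Continuous (NavierStokes.dil n l ψ) :=
    (hψ.continuous.comp (continuous_const_smul l⁻¹)).const_smul _
  refine ⟨hcont, ⟨hcont.aestronglyMeasurable, ?_⟩, ⟨Real.toNNReal (l ^ (d + n))⁻¹ * b, fun x => ?_⟩,
    ⟨Real.toNNReal (l ^ n)⁻¹ * (c * Real.toNNReal l⁻¹), fun h => ?_⟩⟩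
  · rw [hasFiniteIntegral_iff_enorm, lintegral_enorm_dil hl hψ.continuous]
    exact ENNReal.mul_lt_top (by simp) hψ.integrable.2
  · rw [enorm_dil hl]
    exact mul_le_mul' le_rfl (hb _)
  · rw [lintegral_enorm_dil_shift hl hψ.continuous]
    push_cast
    rw [mul_assoc]
    refine mul_le_mul' le_rfl ((hc _).trans (le_of_eq ?_))
    rw [enorm_smul, Real.enorm_of_nonneg (by positivity), mul_assoc]
    rfl

/-- The convolution of a scalar kernel and a vector field. -/
noncomputable def conv (ψ : Space d → ℂ) (f : Space d → Vec d) (x : Space d) : Vec d :=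
  ∫ y, ψ (x - y) • f y

theorem enorm_conv_le (ψ : Space d → ℂ) (f : Space d → Vec d) (x : Space d) :
    ‖conv ψ f x‖ₑ ≤ ∫⁻ y, ‖ψ (x - y)‖ₑ * ‖f y‖ₑ := by
  refine (enorm_integral_le_lintegral_enorm _).trans (le_of_eq ?_)
  simp_rw [enorm_smul]

theorem measurable_conv {ψ : Space d → ℂ} {f : Space d → Vec d} (hψ : Measurable ψ)
    (hf : Measurable f) : Measurable (conv ψ f) := by
  have h : Measurable fun z : Space d × Space d => ψ (z.1 - z.2) • f z.2 := by fun_prop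
  exact h.stronglyMeasurable.integral_prod_right.measurable

theorem eLpNorm_conv_le {p : ℝ} (hp : 1 ≤ p) {ψ : Space d → ℂ} {f : Space d → Vec d}
    (hψ : Measurable ψ) (hf : Measurable f) :
    eLpNorm (conv ψ f) (ENNReal.ofReal p) ≤ (∫⁻ x, ‖ψ x‖ₑ) * eLpNorm f (ENNReal.ofReal p) := by
  have := eLpNorm_lintegral_conv_le hp hψ.enorm hf.enorm
  rw [eLpNorm_enorm] at this
  refine (eLpNorm_mono_enorm fun x => ?_).trans this
  rw [enorm_eq_self]
  exact enorm_conv_le ψ f x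

theorem GoodKernel.lintegral_mul_lt_top {ψ : Space d → ℂ} (hψ : GoodKernel ψ) {p : ℝ} (hp : 1 ≤ p)
    {g : Space d → ℝ≥0∞} (hg : Measurable g) (hgp : eLpNorm g (ENNReal.ofReal p) ≠ ∞)
    (x : Space d) : ∫⁻ y, ‖ψ (x - y)‖ₑ * g y < ∞ := by
  obtain ⟨a, ha⟩ := hψ.bounded
  have h := lintegral_conv_rpow_le (K := fun y => ‖ψ y‖ₑ) hψ.continuous.measurable.enorm hg
    one_pos hp ha x
  simp only [ENNReal.rpow_one] at h
  refine h.trans_lt ?_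
  have hp0 : 0 < p := by linarith
  have h1 : 1 / p ≤ 1 := (div_le_one hp0).2 hp
  refine ENNReal.mul_lt_top (ENNReal.mul_lt_top ?_ ?_) hgp.lt_top
  · exact ENNReal.rpow_lt_top_of_nonneg (by positivity) (by simp)
  · exact ENNReal.rpow_lt_top_of_nonneg (by linarith) hψ.integrable.2.ne

theorem GoodKernel.integrable_smul {ψ : Space d → ℂ} (hψ : GoodKernel ψ) {p : ℝ} (hp : 1 ≤ p)
    {f : Space d → Vec d} (hf : Measurable f) (hfp : eLpNorm f (ENNReal.ofReal p) ≠ ∞)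
    (x : Space d) : Integrable fun y => ψ (x - y) • f y := by
  have hm : Measurable ψ := hψ.continuous.measurable
  refine ⟨(by fun_prop : Measurable fun y => ψ (x - y) • f y).aestronglyMeasurable, ?_⟩
  rw [hasFiniteIntegral_iff_enorm]
  simp_rw [enorm_smul]
  exact hψ.lintegral_mul_lt_top hp hf.enorm (by rwa [eLpNorm_enorm]) x

theorem conv_add_const (ψ : Space d → ℂ) (f : Space d → Vec d) (x h : Space d) :
    conv ψ f (x + h) = conv ψ (fun y => f (y + h)) x := by
  rw [conv, conv, ← integral_add_right_eq_self _ h]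
  simp only [add_sub_add_right_eq_sub]

theorem eLpNorm_comp_add_right {ε : Type*} [TopologicalSpace ε] [ContinuousENorm ε]
    [MeasurableSpace ε] [OpensMeasurableSpace ε] {p : ℝ} (hp : 0 < p) (f : Space d → ε)
    (y : Space d) :
    eLpNorm (fun x => f (x + y)) (ENNReal.ofReal p) = eLpNorm f (ENNReal.ofReal p) := by
  simp_rw [eLpNorm_ofReal hp]
  rw [lintegral_add_right_eq_self (fun x => ‖f x‖ₑ ^ p)]

theorem GoodKernel.conv_shift_sub {ψ : Space d → ℂ} (hψ : GoodKernel ψ) {p : ℝ} (hp : 1 ≤ p)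
    {f : Space d → Vec d} (hf : Measurable f) (hfp : eLpNorm f (ENNReal.ofReal p) ≠ ∞)
    (x h : Space d) :
    conv ψ f (x + h) - conv ψ f x = conv ψ (fun y => f (y + h) - f y) x := by
  have hfh : Measurable fun y => f (y + h) := by fun_prop
  rw [conv_add_const, conv, conv, conv, ← integral_sub (hψ.integrable_smul hp hfh
    (by rwa [eLpNorm_comp_add_right (by linarith)]) x) (hψ.integrable_smul hp hf hfp x)]
  simp only [smul_sub]

theorem GoodKernel.enorm_conv_sub_le {ψ : Space d → ℂ} (hψ : GoodKernel ψ) (h1 : ∫ x, ψ x = 1)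
    {p : ℝ} (hp : 1 ≤ p)
    {f : Space d → Vec d} (hf : Measurable f) (hfp : eLpNorm f (ENNReal.ofReal p) ≠ ∞)
    (x : Space d) :
    ‖conv ψ f x - f x‖ₑ ≤ ∫⁻ y, ‖ψ y‖ₑ * ‖f (x - y) - f x‖ₑ := by
  have e1 : conv ψ f x = ∫ y, ψ y • f (x - y) := by
    rw [conv, ← integral_sub_left_eq_self _ _ x]; simp only [sub_sub_cancel]
  have e2 : f x = ∫ y, ψ y • f x := by rw [integral_smul_const, h1, one_smul]
  have i1 : Integrable fun y => ψ y • f (x - y) := by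
    have := (hψ.integrable_smul hp hf hfp x).comp_sub_left x
    simpa only [sub_sub_cancel] using this
  have : conv ψ f x - f x = ∫ y, ψ y • (f (x - y) - f x) := by
    simp_rw [smul_sub]
    rw [integral_sub i1 (hψ.integrable.smul_const _), ← e1, ← e2]
  rw [this]
  refine (enorm_integral_le_lintegral_enorm _).trans (le_of_eq ?_)
  simp_rw [enorm_smul]

/-- The increments of `f` are of size `‖h‖ ^ σ N` in `L^p`. -/
def HolderBound (σ p : ℝ) (N : ℝ≥0∞) {W : Type*} [NormedAddCommGroup W] (f : Space d → W) : Prop :=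
  ∀ h, eLpNorm (fun x => f (x + h) - f x) (ENNReal.ofReal p) ≤ ‖h‖ₑ ^ σ * N

/-- Since `ψ` has integral one, the mollification error is an average of increments of `f`, and
Minkowski's inequality inserts the Hölder bound under the average. -/
theorem GoodKernel.eLpNorm_conv_sub_le {ψ : Space d → ℂ} (hψ : GoodKernel ψ) (h1 : ∫ x, ψ x = 1)
    {p σ : ℝ} (hp : 1 ≤ p) {N : ℝ≥0∞}
    {f : Space d → Vec d} (hf : Measurable f) (hfp : eLpNorm f (ENNReal.ofReal p) ≠ ∞)
    (hfN : HolderBound σ p N f) :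
    eLpNorm (fun x => conv ψ f x - f x) (ENNReal.ofReal p) ≤ (∫⁻ y, ‖ψ y‖ₑ * ‖y‖ₑ ^ σ) * N := by
  have hm : Measurable ψ := hψ.continuous.measurable
  have hp0 : 0 < p := by linarith
  have hD : Measurable fun z : Space d × Space d => ‖f (z.2 - z.1) - f z.2‖ₑ :=
    ((hf.comp (measurable_snd.sub measurable_fst)).sub (hf.comp measurable_snd)).enorm
  have hF : Measurable (Function.uncurry fun y x : Space d => ‖ψ y‖ₑ * ‖f (x - y) - f x‖ₑ) :=
    (hm.comp measurable_fst).enorm.mul hD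
  have s1 : eLpNorm (fun x => conv ψ f x - f x) (ENNReal.ofReal p) ≤ eLpNorm (fun x => ∫⁻ y, ‖ψ y‖ₑ * ‖f (x - y) - f x‖ₑ) (ENNReal.ofReal p) := by
    refine eLpNorm_mono_enorm fun x => ?_
    rw [enorm_eq_self]
    exact hψ.enorm_conv_sub_le h1 hp hf hfp x
  have s2 : eLpNorm (fun x => ∫⁻ y, ‖ψ y‖ₑ * ‖f (x - y) - f x‖ₑ) (ENNReal.ofReal p) ≤ ∫⁻ y, eLpNorm (fun x => ‖ψ y‖ₑ * ‖f (x - y) - f x‖ₑ) (ENNReal.ofReal p) :=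
    eLpNorm_lintegral_le hF hp
  have s3 : ∫⁻ y, eLpNorm (fun x => ‖ψ y‖ₑ * ‖f (x - y) - f x‖ₑ) (ENNReal.ofReal p) ≤ ∫⁻ y, ‖ψ y‖ₑ * ‖y‖ₑ ^ σ * N := by
    refine lintegral_mono fun y => ?_
    have hDy : Measurable fun x => ‖f (x - y) - f x‖ₑ :=
      ((hf.comp (measurable_sub_const y)).sub hf).enorm
    have e : eLpNorm (fun x => ‖ψ y‖ₑ * ‖f (x - y) - f x‖ₑ) (ENNReal.ofReal p) = ‖ψ y‖ₑ * eLpNorm (fun x => f (x - y) - f x) (ENNReal.ofReal p) := by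
      rw [eLpNorm_const_mul_ennreal hp0 _ hDy, eLpNorm_enorm]
    have := hfN (-y)
    rw [enorm_neg] at this
    simp only [← sub_eq_add_neg] at this
    calc _ ≤ ‖ψ y‖ₑ * (‖y‖ₑ ^ σ * N) := by rw [e]; exact mul_le_mul' le_rfl this
      _ = _ := (mul_assoc _ _ _).symm
  have s4 : ∫⁻ y, ‖ψ y‖ₑ * ‖y‖ₑ ^ σ * N = (∫⁻ y, ‖ψ y‖ₑ * ‖y‖ₑ ^ σ) * N :=
    lintegral_mul_const _ (hm.enorm.mul (measurable_id.enorm.pow_const _))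
  exact s1.trans (s2.trans (s3.trans s4.le))

theorem lintegral_enorm_dil_mul_rpow {ψ : Space d → ℂ} (hψ : Measurable ψ) {l : ℝ} (hl : 0 < l)
    {σ : ℝ} (hσ : 0 ≤ σ) :
    ∫⁻ y, ‖dil 0 l ψ y‖ₑ * ‖y‖ₑ ^ σ = ENNReal.ofReal (l ^ σ) * ∫⁻ y, ‖ψ y‖ₑ * ‖y‖ₑ ^ σ := by
  have h : ∀ y : Space d, ‖dil 0 l ψ y‖ₑ * ‖y‖ₑ ^ σ = ENNReal.ofReal (l ^ d)⁻¹ *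
      ENNReal.ofReal (l ^ σ) * (‖ψ (l⁻¹ • y)‖ₑ * ‖l⁻¹ • y‖ₑ ^ σ) := fun y => by
    have h1 : ‖y‖ₑ ^ σ = ENNReal.ofReal (l ^ σ) * ‖l⁻¹ • y‖ₑ ^ σ := by
      rw [← ENNReal.ofReal_rpow_of_nonneg hl.le hσ, ← ENNReal.mul_rpow_of_nonneg _ _ hσ,
        ← Real.enorm_of_nonneg hl.le, ← enorm_smul, smul_inv_smul₀ hl.ne']
    rw [enorm_dil hl, h1, add_zero]; ring
  simp_rw [h]
  rw [lintegral_const_mul' _ _ (by finiteness),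
    lintegral_comp_inv_smul hl (f := fun y => ‖ψ y‖ₑ * ‖y‖ₑ ^ σ) (by fun_prop), ← mul_assoc,
    mul_right_comm _ _ (ENNReal.ofReal (l ^ d)), ← ENNReal.ofReal_mul (by positivity),
    inv_mul_cancel₀ (by positivity), ENNReal.ofReal_one, one_mul]

theorem integral_dil {ψ : Space d → ℂ} {l : ℝ} (hl : 0 < l) : ∫ y, dil 0 l ψ y = ∫ y, ψ y := by
  unfold dil
  rw [integral_smul, Measure.integral_comp_inv_smul_of_nonneg _ _ hl.le,
    finrank_euclideanSpace_fin, smul_smul, add_zero, inv_mul_cancel₀ (by positivity), one_smul]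

theorem GoodKernel.eLpNorm_conv_dil_sub_le {ψ : Space d → ℂ} (hψ : GoodKernel ψ)
    (h1 : ∫ x, ψ x = 1) {p σ : ℝ} (hp : 1 ≤ p) (hσ : 0 ≤ σ) {N : ℝ≥0∞} {l : ℝ} (hl : 0 < l)
    {f : Space d → Vec d} (hf : Measurable f) (hfp : eLpNorm f (ENNReal.ofReal p) ≠ ∞)
    (hfN : HolderBound σ p N f) :
    eLpNorm (fun x => conv (NavierStokes.dil 0 l ψ) f x - f x) (ENNReal.ofReal p) ≤
      ENNReal.ofReal (l ^ σ) * (∫⁻ y, ‖ψ y‖ₑ * ‖y‖ₑ ^ σ) * N := by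
  rw [← lintegral_enorm_dil_mul_rpow hψ.continuous.measurable hl hσ]
  exact (hψ.dil 0 hl).eLpNorm_conv_sub_le ((integral_dil hl).trans h1) hp hf hfp hfN

/-- The matrix `a ⊗ b`. -/
def tens (a b : Vec d) : Fin d → Fin d → ℂ := fun j k => a j * b k

theorem enorm_tens_le (a b : Vec d) : ‖tens a b‖ₑ ≤ ‖a‖ₑ * ‖b‖ₑ := by
  rw [← ofReal_norm, ← ofReal_norm, ← ofReal_norm, ← ENNReal.ofReal_mul (norm_nonneg _)]
  refine ENNReal.ofReal_le_ofReal ((pi_norm_le_iff_of_nonneg (by positivity)).2 fun j =>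
    (pi_norm_le_iff_of_nonneg (by positivity)).2 fun k => ?_)
  rw [tens, norm_mul]
  exact mul_le_mul (PiLp.norm_apply_le a j) (PiLp.norm_apply_le b k) (norm_nonneg _) (norm_nonneg _)

theorem tens_self_sub (a b : Vec d) :
    tens a a - tens b b = tens (a - b) a + tens b (a - b) := by
  ext j k
  simp only [tens, Pi.sub_apply, Pi.add_apply, PiLp.sub_apply]; ring

theorem enorm_tens_self_sub_le (a b : Vec d) :
    ‖tens a a - tens b b‖ₑ ≤ (‖a‖ₑ + ‖b‖ₑ) * ‖a - b‖ₑ := by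
  rw [tens_self_sub]
  refine (enorm_add_le _ _).trans ((add_le_add (enorm_tens_le _ _) (enorm_tens_le _ _)).trans
    (le_of_eq ?_))
  ring

theorem measurable_tens : Measurable fun z : Vec d × Vec d => tens z.1 z.2 := by
  unfold tens
  refine measurable_pi_lambda _ fun j => measurable_pi_lambda _ fun k => ?_
  fun_prop

theorem measurable_tens_comp {α : Type*} [MeasurableSpace α] {f g : α → Vec d} (hf : Measurable f)
    (hg : Measurable g) : Measurable fun x => tens (f x) (g x) :=
  measurable_tens.comp (hf.prodMk hg)

theorem eLpNorm_le_const_mul {α W W' : Type*} [MeasurableSpace α] {μ : Measure α}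
    [NormedAddCommGroup W] [NormedAddCommGroup W'] [MeasurableSpace W'] [OpensMeasurableSpace W']
    {p : ℝ} (hp : 0 < p)
    {c : ℝ≥0∞} {F : α → W} {g : α → W'} (hg : Measurable g) (h : ∀ᵐ x ∂μ, ‖F x‖ₑ ≤ c * ‖g x‖ₑ) :
    eLpNorm F (ENNReal.ofReal p) μ ≤ c * eLpNorm g (ENNReal.ofReal p) μ := by
  rw [← eLpNorm_enorm g, ← eLpNorm_const_mul_ennreal hp _ hg.enorm]
  exact eLpNorm_mono_enorm_ae (by simpa only [enorm_eq_self] using h)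

end

/-! ### Bounds for the Oseen operator -/

section

variable {d : ℕ}

theorem measurable_oseenKernel_comp {α : Type*} [MeasurableSpace α] (i j k : Fin d) {τ : α → ℝ}
    (hτ : Measurable τ) {x : α → Space d} (hx : Measurable x) :
    Measurable fun a => oseenKernel i j k (τ a) (x a) := by
  have h1 := (stronglyMeasurable_oseenKernel i j k).measurable
  have h2 := h1.comp (hτ.prodMk hx)
  exact h2

theorem measurable_heatLerayDiv {α : Type*} [MeasurableSpace α] {τ : α → ℝ} (hτ : Measurable τ)
    {x : α → Space d} (hx : Measurable x) {F : α → Space d → Fin d → Fin d → ℂ}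
    (hF : Measurable (Function.uncurry F)) :
    Measurable fun a => heatLerayDiv (τ a) (F a) (x a) := by
  unfold heatLerayDiv
  have h : ∀ i j k, Measurable fun a => ∫ y, oseenKernel i j k (τ a) (x a - y) * F a y j k := by
    intro i j k
    have h1 : Measurable fun z : α × Space d => oseenKernel i j k (τ z.1) (x z.1 - z.2) :=
      measurable_oseenKernel_comp i j k (τ := fun z : α × Space d => τ z.1)
        (x := fun z : α × Space d => x z.1 - z.2) (hτ.comp measurable_fst)
        ((hx.comp measurable_fst).sub measurable_snd)
    have h2 : Measurable fun z : α × Space d => F z.1 z.2 j k := by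
      have h3 : Measurable fun z : α × Space d => F z.1 z.2 := hF
      fun_prop
    exact (h1.mul h2).stronglyMeasurable.integral_prod_right.measurable
  refine (WithLp.measurable_toLp 2 _).comp (measurable_pi_lambda _ fun i => ?_)
  exact Finset.measurable_fun_sum _ fun j _ => Finset.measurable_fun_sum _ fun k _ => h i j k

theorem exists_eLpNorm_heatLerayDiv_le (d : ℕ) {p : ℝ} (hp : 1 ≤ p) :
    ∃ c : ℝ≥0, ∀ τ > 0, ∀ F : Space d → Fin d → Fin d → ℂ, Measurable F →
      eLpNorm (heatLerayDiv τ F) (ENNReal.ofReal p) ≤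
        c * timeKernel (1 / 2) τ * eLpNorm F (ENNReal.ofReal p) := by
  obtain ⟨c, hc⟩ := exists_lintegral_oseenAbs_le d
  refine ⟨c, fun τ hτ F hF => ?_⟩
  have := eLpNorm_lintegral_conv_le hp (measurable_oseenAbs (d := d)).of_uncurry_left hF.enorm
    (K := oseenAbs τ)
  rw [eLpNorm_enorm] at this
  refine (eLpNorm_mono_enorm fun x => ?_).trans (this.trans (mul_le_mul' (hc τ hτ) le_rfl))
  rw [enorm_eq_self]
  exact enorm_heatLerayDiv_le τ hF x

theorem heatLerayDiv_sub_of_eLpNorm {τ : ℝ} (hτ : 0 < τ) {p : ℝ} (hp : 1 ≤ p)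
    {F G : Space d → Fin d → Fin d → ℂ} (hF : Measurable F) (hG : Measurable G)
    (hFp : eLpNorm F (ENNReal.ofReal p) ≠ ∞) (hGp : eLpNorm G (ENNReal.ofReal p) ≠ ∞) :
    heatLerayDiv τ (fun y => F y - G y) = fun x => heatLerayDiv τ F x - heatLerayDiv τ G x := by
  ext1 x
  exact heatLerayDiv_sub hF hG
    (lintegral_oseenAbs_mul_ne_top hτ hp hF.enorm (by rwa [eLpNorm_enorm]) x)
    (lintegral_oseenAbs_mul_ne_top hτ hp hG.enorm (by rwa [eLpNorm_enorm]) x)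

theorem heatLerayDiv_shift_sub {τ : ℝ} (hτ : 0 < τ) {p : ℝ} (hp : 1 ≤ p)
    {F : Space d → Fin d → Fin d → ℂ} (hF : Measurable F)
    (hFp : eLpNorm F (ENNReal.ofReal p) ≠ ∞) (h : Space d) :
    (fun x => heatLerayDiv τ F (x + h) - heatLerayDiv τ F x) =
      heatLerayDiv τ fun y => F (y + h) - F y := by
  have hFh : Measurable fun y => F (y + h) := hF.comp (measurable_add_const h)
  rw [heatLerayDiv_sub_of_eLpNorm hτ hp hFh hF
    (by rwa [eLpNorm_comp_add_right (by linarith)]) hFp]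
  simp only [heatLerayDiv_add_const]

theorem exists_eLpNorm_heatLerayDiv_shift_le (d : ℕ) {p σ : ℝ} (hp : 1 ≤ p) (hσ0 : 0 ≤ σ)
    (hσ1 : σ ≤ 1) :
    ∃ c : ℝ≥0, ∀ τ > 0, ∀ F : Space d → Fin d → Fin d → ℂ, Measurable F →
      eLpNorm F (ENNReal.ofReal p) ≠ ∞ →
      HolderBound σ p (c * timeKernel ((1 + σ) / 2) τ * eLpNorm F (ENNReal.ofReal p))
        (heatLerayDiv τ F) := by
  obtain ⟨c, hc⟩ := exists_lintegral_oseenDiff_le d hσ0 hσ1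
  refine ⟨c, fun τ hτ F hF hFp h => ?_⟩
  have hm := measurable_oseenDiff h τ
  have hY := eLpNorm_lintegral_conv_le hp hm hF.enorm
  rw [eLpNorm_enorm] at hY
  have hFe : eLpNorm (fun y => ‖F y‖ₑ) (ENNReal.ofReal p) ≠ ∞ := by rwa [eLpNorm_enorm]
  have hfin := lintegral_oseenAbs_mul_ne_top hτ hp hF.enorm hFe
  have hle : ∀ x, ‖heatLerayDiv τ F (x + h) - heatLerayDiv τ F x‖ₑ ≤
      ‖∫⁻ y, oseenDiff h τ (x - y) * ‖F y‖ₑ‖ₑ := fun x => by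
    rw [enorm_eq_self]
    exact enorm_heatLerayDiv_sub_le hF (hfin x) (hfin (x + h))
  refine (eLpNorm_mono_enorm hle).trans (hY.trans ?_)
  refine (mul_le_mul' (hc τ hτ h) le_rfl).trans (le_of_eq ?_)
  ring

theorem eLpNorm_tens_self_sub_le {p : ℝ} (hp : 0 < p) {a b : Space d → Vec d}
    (ha : Measurable a) (hb : Measurable b) {A B : ℝ≥0∞} (hA : ∀ᵐ x, ‖a x‖ₑ ≤ A)
    (hB : ∀ᵐ x, ‖b x‖ₑ ≤ B) :
    eLpNorm (fun x => tens (a x) (a x) - tens (b x) (b x)) (ENNReal.ofReal p) ≤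
      (A + B) * eLpNorm (fun x => a x - b x) (ENNReal.ofReal p) := by
  refine eLpNorm_le_const_mul hp (ha.sub hb) ?_
  filter_upwards [hA, hB] with x h1 h2
  exact (enorm_tens_self_sub_le _ _).trans (mul_le_mul' (add_le_add h1 h2) le_rfl)

/-! ### Dyadic telescoping of tensor squares. -/

theorem two_rpow_mul (a b : ℝ) : (2 : ℝ≥0∞) ^ a * 2 ^ b = 2 ^ (a + b) :=
  (ENNReal.rpow_add _ _ (by simp) (by simp)).symm

theorem two_rpow_ne_top (a : ℝ) : (2 : ℝ≥0∞) ^ a ≠ ∞ := by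
  rw [show (2 : ℝ≥0∞) = ENNReal.ofReal 2 by simp, ENNReal.ofReal_rpow_of_pos (by norm_num)]
  simp

theorem ofReal_two_pow_inv_rpow (j : ℕ) (σ : ℝ) :
    ENNReal.ofReal (((2 : ℝ) ^ j)⁻¹ ^ σ) = 2 ^ (-(σ * j)) := by
  rw [show (2 : ℝ≥0∞) = ENNReal.ofReal 2 by simp, ENNReal.ofReal_rpow_of_pos (by norm_num)]
  congr 1
  rw [← Real.rpow_natCast, ← Real.rpow_neg (by norm_num), ← Real.rpow_mul (by norm_num)]
  congr 1; ring

/-- Telescoping bound for the tensor squares of a sequence with geometrically decaying increments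
and controlled growth. -/
theorem eLpNorm_tens_sub_tens_le {p r σ : ℝ} (hp : 1 ≤ p) (hrσ : r < σ) :
    ∃ c : ℝ≥0, ∀ (f : ℕ → Space d → Vec d) (M N : ℝ≥0∞), (∀ j, Measurable (f j)) →
      (∀ j : ℕ, ∀ᵐ x, ‖f j x‖ₑ ≤ 2 ^ (r * j) * M) →
      (∀ j : ℕ, eLpNorm (fun x => f (j + 1) x - f j x) (ENNReal.ofReal p) ≤ 2 ^ (-(σ * j)) * N) →
      ∀ J n : ℕ, eLpNorm (fun x => tens (f (J + n) x) (f (J + n) x) - tens (f J x) (f J x))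
        (ENNReal.ofReal p) ≤ c * (2 ^ (-((σ - r) * J)) * M * N) := by
  have hp0 : 0 < p := by linarith
  -- In an increment of the tensor square, one factor grows like `2 ^ (r j)` in sup norm and the
  -- other decays like `2 ^ (-σ j)` in `L^p`, so `θ < 1` is the ratio of a geometric series. The
  -- summand `2 ^ r` of the constant comes from the factor of index `j + 1`.
  set θ : ℝ≥0∞ := 2 ^ (-(σ - r)) with hθ
  have hθ1 : θ < 1 := ENNReal.rpow_lt_one_of_one_lt_of_neg (by simp) (by linarith)
  have hC : (2 ^ r + 1) * (1 - θ)⁻¹ ≠ (∞ : ℝ≥0∞) :=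
    ENNReal.mul_ne_top (ENNReal.add_ne_top.2 ⟨two_rpow_ne_top r, by simp⟩)
      (ENNReal.inv_ne_top.2 (tsub_pos_of_lt hθ1).ne')
  refine ⟨((2 ^ r + 1) * (1 - θ)⁻¹).toNNReal, fun f M N hm hM hN J n => ?_⟩
  rw [ENNReal.coe_toNNReal hC]
  have step : ∀ j : ℕ, eLpNorm (fun x => tens (f (j + 1) x) (f (j + 1) x) - tens (f j x) (f j x))
      (ENNReal.ofReal p) ≤ (2 ^ r + 1) * (2 ^ (-((σ - r) * j)) * M * N) := fun j => by
    refine (eLpNorm_tens_self_sub_le hp0 (hm _) (hm _) (hM (j + 1)) (hM j)).trans ?_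
    refine (mul_le_mul' le_rfl (hN j)).trans (le_of_eq ?_)
    rw [show (r * ((j + 1 : ℕ) : ℝ)) = r + r * j by push_cast; ring,
      show -((σ - r) * j) = r * j + -(σ * j) by ring, ← two_rpow_mul, ← two_rpow_mul]
    ring
  have fin : ∀ n : ℕ, eLpNorm (fun x => tens (f (J + n) x) (f (J + n) x) - tens (f J x) (f J x))
      (ENNReal.ofReal p) ≤
        (2 ^ r + 1) * (2 ^ (-((σ - r) * J)) * M * N) * ∑ i ∈ Finset.range n, θ ^ i := by
    intro n
    induction n with
    | zero => simp
    | succ n ih =>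
      have hadd := eLpNorm_add_le (μ := volume) (p := ENNReal.ofReal p)
        (f := fun x => tens (f (J + n + 1) x) (f (J + n + 1) x) - tens (f (J + n) x) (f (J + n) x))
        (g := fun x => tens (f (J + n) x) (f (J + n) x) - tens (f J x) (f J x))
        ((measurable_tens_comp (hm _) (hm _)).sub (measurable_tens_comp (hm _) (hm _))).aestronglyMeasurable
        ((measurable_tens_comp (hm _) (hm _)).sub (measurable_tens_comp (hm _) (hm _))).aestronglyMeasurable
        (by rw [← ENNReal.ofReal_one]; exact ENNReal.ofReal_le_ofReal hp)
      have he : (fun x => tens (f (J + n + 1) x) (f (J + n + 1) x) - tens (f (J + n) x) (f (J + n) x))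
          + (fun x => tens (f (J + n) x) (f (J + n) x) - tens (f J x) (f J x)) =
          fun x => tens (f (J + n + 1) x) (f (J + n + 1) x) - tens (f J x) (f J x) := by
        ext1 x; simp
      rw [he] at hadd
      rw [Finset.sum_range_succ, mul_add, add_comm (_ * ∑ i ∈ _, _)]
      refine hadd.trans (add_le_add ((step (J + n)).trans (le_of_eq ?_)) ih)
      rw [hθ, ← ENNReal.rpow_natCast, ← ENNReal.rpow_mul,
        show -((σ - r) * ((J + n : ℕ) : ℝ)) = -((σ - r) * J) + -(σ - r) * n by push_cast; ring,
        ← two_rpow_mul]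
      ring
  refine (fin n).trans ?_
  calc _ ≤ (2 ^ r + 1) * (2 ^ (-((σ - r) * J)) * M * N) * (1 - θ)⁻¹ := by
        refine mul_le_mul' le_rfl ?_
        rw [← ENNReal.tsum_geometric]
        exact ENNReal.sum_le_tsum _
    _ = _ := by ring

end

/-! ### The product estimate -/

section

variable {d : ℕ}

theorem continuous_tens : Continuous fun z : Vec d × Vec d => tens z.1 z.2 := by
  unfold tens
  refine continuous_pi fun j => continuous_pi fun k => ?_
  fun_prop

theorem one_le_ofReal {p : ℝ} (hp : 1 ≤ p) : 1 ≤ ENNReal.ofReal p := by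
  rw [← ENNReal.ofReal_one]; exact ENNReal.ofReal_le_ofReal hp

/-- The low frequency part of `f` at scale `2 ^ (-j)`. -/
noncomputable def smooth (ψ : Space d → ℂ) (j : ℕ) (f : Space d → Vec d) : Space d → Vec d :=
  conv (dil 0 ((2 : ℝ) ^ j)⁻¹ ψ) f

theorem GoodKernel.measurable_smooth {ψ : Space d → ℂ} (hψ : GoodKernel ψ) (j : ℕ)
    {f : Space d → Vec d} (hf : Measurable f) : Measurable (smooth ψ j f) :=
  measurable_conv (hψ.dil 0 (l := ((2 : ℝ) ^ j)⁻¹) (by positivity)).continuous.measurable hf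

theorem GoodKernel.eLpNorm_smooth_sub_le {ψ : Space d → ℂ} (hψ : GoodKernel ψ)
    (h1 : ∫ x, ψ x = 1) {p σ : ℝ} (hp : 1 ≤ p) (hσ : 0 ≤ σ) {N : ℝ≥0∞} {f : Space d → Vec d}
    (hf : Measurable f) (hfp : eLpNorm f (ENNReal.ofReal p) ≠ ∞) (hfN : HolderBound σ p N f)
    (j : ℕ) :
    eLpNorm (fun x => smooth ψ j f x - f x) (ENNReal.ofReal p) ≤
      2 ^ (-(σ * j)) * ((∫⁻ y, ‖ψ y‖ₑ * ‖y‖ₑ ^ σ) * N) := by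
  refine (hψ.eLpNorm_conv_dil_sub_le h1 hp hσ (by positivity) hf hfp hfN).trans (le_of_eq ?_)
  rw [ofReal_two_pow_inv_rpow, mul_assoc]

theorem eLpNorm_sub_le_add {p : ℝ} (hp : 1 ≤ p) {W : Type*} [NormedAddCommGroup W]
    {f g h : Space d → W} (hf : AEStronglyMeasurable f) (hg : AEStronglyMeasurable g)
    (hh : AEStronglyMeasurable h) :
    eLpNorm (fun x => f x - h x) (ENNReal.ofReal p) ≤
      eLpNorm (fun x => f x - g x) (ENNReal.ofReal p) +
        eLpNorm (fun x => g x - h x) (ENNReal.ofReal p) := by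
  have := eLpNorm_add_le (hf.sub hg) (hg.sub hh) (one_le_ofReal hp)
  rwa [sub_add_sub_cancel] at this

/-- Telescoping over the scales finer than `2 ^ (-J)` bounds the distance to every later stage
uniformly. The mollifications converge to `f` in `L^p`, hence almost everywhere along a subsequence,
and Fatou's lemma carries the bound to the limit. -/
theorem GoodKernel.exists_eLpNorm_tens_sub_smooth_le {ψ : Space d → ℂ} (hψ : GoodKernel ψ)
    (h1 : ∫ x, ψ x = 1) {p r σ : ℝ} (hp : 1 ≤ p) (hr : 0 < r) (hrσ : r < σ)
    (hψσ : ∫⁻ y, ‖ψ y‖ₑ * ‖y‖ₑ ^ σ ≠ ∞) :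
    ∃ c : ℝ≥0, ∀ (f : Space d → Vec d) (M N : ℝ≥0∞), Measurable f → N ≠ ∞ →
      eLpNorm f (ENNReal.ofReal p) ≠ ∞ → (∀ j : ℕ, ∀ᵐ x, ‖smooth ψ j f x‖ₑ ≤ 2 ^ (r * j) * M) →
      HolderBound σ p N f → ∀ J : ℕ,
      eLpNorm (fun x => tens (f x) (f x) - tens (smooth ψ J f x) (smooth ψ J f x))
        (ENNReal.ofReal p) ≤ c * (2 ^ (-((σ - r) * J)) * M * N) := by
  obtain ⟨c, hc⟩ := eLpNorm_tens_sub_tens_le (d := d) hp hrσ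
  obtain ⟨C, hC⟩ : ∃ C : ℝ≥0, (C : ℝ≥0∞) = ∫⁻ y, ‖ψ y‖ₑ * ‖y‖ₑ ^ σ :=
    ⟨_, ENNReal.coe_toNNReal hψσ⟩
  refine ⟨c * (2 * C), fun f M N hf hN hfp hM hfN J => ?_⟩
  have hσ : 0 < σ := hr.trans hrσ
  have hp0 : 0 < p := by linarith
  have hm : ∀ j, Measurable (smooth ψ j f) := fun j => hψ.measurable_smooth j hf
  have hs := hψ.eLpNorm_smooth_sub_le h1 hp hσ.le hf hfp hfN
  rw [← hC] at hs
  have hinc : ∀ j : ℕ, eLpNorm (fun x => smooth ψ (j + 1) f x - smooth ψ j f x)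
      (ENNReal.ofReal p) ≤ 2 ^ (-(σ * j)) * (2 * (C * N)) := fun j => by
    refine (eLpNorm_sub_le_add hp (hm _).aestronglyMeasurable hf.aestronglyMeasurable
      (hm _).aestronglyMeasurable).trans ?_
    have h2 : eLpNorm (fun x => f x - smooth ψ j f x) (ENNReal.ofReal p) =
        eLpNorm (fun x => smooth ψ j f x - f x) (ENNReal.ofReal p) :=
      eLpNorm_sub_comm f (smooth ψ j f) _ _
    rw [h2]
    have h3 : (2 : ℝ≥0∞) ^ (-(σ * ((j + 1 : ℕ) : ℝ))) ≤ 2 ^ (-(σ * j)) := by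
      refine ENNReal.rpow_le_rpow_of_exponent_le (by simp) ?_
      push_cast
      nlinarith
    refine (add_le_add ((hs (j + 1)).trans (mul_le_mul' h3 le_rfl)) (hs j)).trans (le_of_eq ?_)
    ring
  have hbound := hc (fun j => smooth ψ j f) M (2 * (C * N)) hm hM hinc J
  have htends : Tendsto (fun j => eLpNorm (smooth ψ j f - f) (ENNReal.ofReal p)) atTop (𝓝 0) := by
    have h3 : Tendsto (fun j : ℕ => ((2 : ℝ≥0∞) ^ (-σ)) ^ j * (C * N)) atTop (𝓝 (0 * (C * N))) :=
      ENNReal.Tendsto.mul_const (ENNReal.tendsto_pow_atTop_nhds_zero_of_lt_one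
        (ENNReal.rpow_lt_one_of_one_lt_of_neg (by simp) (by linarith)))
        (Or.inr (ENNReal.mul_ne_top (by simp) hN))
    rw [zero_mul] at h3
    refine tendsto_of_tendsto_of_tendsto_of_le_of_le tendsto_const_nhds h3 (fun _ => zero_le)
      fun j => (hs j).trans (le_of_eq ?_)
    rw [← ENNReal.rpow_natCast, ← ENNReal.rpow_mul, neg_mul]
  obtain ⟨ns, hns, hae⟩ := (tendstoInMeasure_of_tendsto_eLpNorm (by simpa using hp0)
    (fun j => (hm j).aestronglyMeasurable) hf.aestronglyMeasurable htends).exists_seq_tendsto_ae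
  have hae' : ∀ᵐ x, Tendsto (fun n => tens (smooth ψ (ns n) f x) (smooth ψ (ns n) f x) -
      tens (smooth ψ J f x) (smooth ψ J f x)) atTop
      (𝓝 (tens (f x) (f x) - tens (smooth ψ J f x) (smooth ψ J f x))) := by
    filter_upwards [hae] with x hx
    have := (continuous_tens.tendsto (f x, f x)).comp (hx.prodMk_nhds hx)
    exact Tendsto.sub_const this _
  refine (Lp.eLpNorm_le_of_ae_tendsto (C := c * (2 ^ (-((σ - r) * J)) * M * (2 * (C * N)))) ?_
    (fun n => ((measurable_tens_comp (hm _) (hm _)).sub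
      (measurable_tens_comp (hm _) (hm _))).aestronglyMeasurable) hae').trans (le_of_eq ?_)
  · filter_upwards [hns.tendsto_atTop.eventually_ge_atTop J] with n hn
    obtain ⟨k, hk⟩ := Nat.exists_eq_add_of_le hn
    rw [hk]
    exact hbound k
  · push_cast; ring

/-- Selects the dyadic scale that matches the resolution `√τ` of the heat kernel: `2 ^ (-J) < √τ ≤ 2
^ (1 - J)`. The last inequality is the origin of the factor `2 ^ β`. -/
theorem exists_nat_two_pow_near {τ : ℝ} (hτ : 0 < τ) (hτ1 : τ ≤ 1) :
    ∃ J : ℕ, (∀ β : ℝ, 0 ≤ β → (2 : ℝ≥0∞) ^ (-(β * J)) ≤ timeKernel (-(β / 2)) τ) ∧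
      ∀ β : ℝ, 0 ≤ β → (2 : ℝ≥0∞) ^ (β * J) ≤ 2 ^ β * timeKernel (β / 2) τ := by
  have hl : 0 < √τ := Real.sqrt_pos.2 hτ
  have hl1 : √τ ≤ 1 := Real.sqrt_le_one.2 hτ1
  obtain ⟨n, hn1, hn2⟩ := exists_nat_pow_near_of_lt_one hl hl1 (y := 1 / 2) (by norm_num) (by norm_num)
  have e : ((2 : ℝ) ^ (n + 1))⁻¹ = (1 / 2) ^ (n + 1) := by rw [one_div, inv_pow]
  refine ⟨n + 1, fun β hβ => ?_, fun β hβ => ?_⟩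
  · rw [← ofReal_two_pow_inv_rpow, ← neg_div, ← ofReal_sqrt_rpow_neg hτ, neg_neg, e]
    exact ENNReal.ofReal_le_ofReal (Real.rpow_le_rpow (by positivity) hn1.le hβ)
  · have h2 : (2 : ℝ) ^ (n + 1) ≤ 2 * (√τ)⁻¹ := by
      rw [pow_succ, mul_comm]
      refine mul_le_mul_of_nonneg_left ?_ (by norm_num)
      rw [le_inv_comm₀ (by positivity) hl, ← inv_pow, ← one_div]
      exact hn2
    rw [← ofReal_sqrt_rpow_neg hτ, show (2 : ℝ≥0∞) = ENNReal.ofReal 2 by simp,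
      ENNReal.ofReal_rpow_of_pos (by norm_num), ENNReal.ofReal_rpow_of_pos (by norm_num),
      ← ENNReal.ofReal_mul (by positivity)]
    refine ENNReal.ofReal_le_ofReal ?_
    rw [mul_comm β, Real.rpow_mul (by norm_num), Real.rpow_natCast, Real.rpow_neg hl.le,
      ← Real.inv_rpow hl.le, ← Real.mul_rpow (by norm_num) (by positivity)]
    exact Real.rpow_le_rpow (by positivity) h2 hβ

theorem GoodKernel.eLpNorm_smooth_le {ψ : Space d → ℂ} (hψ : GoodKernel ψ) {p : ℝ} (hp : 1 ≤ p)
    {f : Space d → Vec d} (hf : Measurable f) (j : ℕ) :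
    eLpNorm (smooth ψ j f) (ENNReal.ofReal p) ≤
      (∫⁻ x, ‖ψ x‖ₑ) * eLpNorm f (ENNReal.ofReal p) := by
  have hl : (0 : ℝ) < ((2 : ℝ) ^ j)⁻¹ := by positivity
  have h := eLpNorm_conv_le hp (hψ.dil 0 hl).continuous.measurable hf
  rw [lintegral_enorm_dil hl hψ.continuous, pow_zero, inv_one, ENNReal.ofReal_one, one_mul] at h
  exact h

theorem GoodKernel.holderBound_smooth {ψ : Space d → ℂ} (hψ : GoodKernel ψ) {p σ : ℝ} (hp : 1 ≤ p)
    {N : ℝ≥0∞} {f : Space d → Vec d} (hf : Measurable f)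
    (hfp : eLpNorm f (ENNReal.ofReal p) ≠ ∞) (hfN : HolderBound σ p N f) (j : ℕ) :
    HolderBound σ p ((∫⁻ x, ‖ψ x‖ₑ) * N) (smooth ψ j f) := by
  intro h
  have hl : (0 : ℝ) < ((2 : ℝ) ^ j)⁻¹ := by positivity
  have e : (fun x => smooth ψ j f (x + h) - smooth ψ j f x) =
      smooth ψ j (fun y => f (y + h) - f y) := by
    ext1 x
    exact (hψ.dil 0 hl).conv_shift_sub hp hf hfp x h
  have hm : Measurable fun y => f (y + h) - f y := (hf.comp (measurable_add_const h)).sub hf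
  rw [e, mul_left_comm]
  exact (hψ.eLpNorm_smooth_le hp hm j).trans (mul_le_mul' le_rfl (hfN h))

/-- The action of `e^{τΔ} ℙ ∇` on `f ⊗ f`, when `f` is controlled in a Hölder-type space built on
`L^p` and in a Besov space of negative regularity built on `L^∞`. -/
theorem GoodKernel.exists_heatLerayDiv_tens_le {ψ : Space d → ℂ} (hψ : GoodKernel ψ)
    (h1 : ∫ x, ψ x = 1) {p r σ : ℝ} (hp : 1 ≤ p) (hr : 0 < r) (hrσ : r < σ) (hσ1 : σ ≤ 1)
    (hψσ : ∫⁻ y, ‖ψ y‖ₑ * ‖y‖ₑ ^ σ ≠ ∞) :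
    ∃ c : ℝ≥0, ∀ (f : Space d → Vec d) (M N : ℝ≥0∞), Measurable f → M ≠ ∞ → N ≠ ∞ →
      eLpNorm f (ENNReal.ofReal p) ≠ ∞ →
      eLpNorm (fun x => tens (f x) (f x)) (ENNReal.ofReal p) ≠ ∞ →
      (∀ j : ℕ, ∀ᵐ x, ‖smooth ψ j f x‖ₑ ≤ 2 ^ (r * j) * M) →
      HolderBound σ p N f → ∀ τ, 0 < τ → τ ≤ 1 →
      eLpNorm (heatLerayDiv τ fun x => tens (f x) (f x)) (ENNReal.ofReal p) ≤
        c * (timeKernel ((1 + r) / 2) τ * M *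
          (eLpNorm f (ENNReal.ofReal p) + timeKernel (-(σ / 2)) τ * N)) ∧
      HolderBound σ p (c * (timeKernel ((1 + r) / 2) τ * M * N))
        (heatLerayDiv τ fun x => tens (f x) (f x)) := by
  have hp0 : 0 < p := by linarith
  have hσ : 0 < σ := hr.trans hrσ
  obtain ⟨c₁, hc₁⟩ := exists_eLpNorm_heatLerayDiv_le d hp
  obtain ⟨c₂, hc₂⟩ := exists_eLpNorm_heatLerayDiv_shift_le d hp hσ.le hσ1
  obtain ⟨c₃, hc₃⟩ := hψ.exists_eLpNorm_tens_sub_smooth_le h1 hp hr hrσ hψσ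
  obtain ⟨A, hA⟩ : ∃ A : ℝ≥0, (A : ℝ≥0∞) = ∫⁻ y, ‖ψ y‖ₑ :=
    ⟨_, ENNReal.coe_toNNReal hψ.integrable.2.ne⟩
  refine ⟨c₁ * (c₃ + 2 * A) + (c₂ * c₃ + c₁ * (2 * (2 * A))),
    fun f M N hf hM hN hfp hffp hfM hfN τ hτ hτ1 => ?_⟩
  obtain ⟨J, hJ1, hJ2⟩ := exists_nat_two_pow_near hτ hτ1
  have hJr : (2 : ℝ≥0∞) ^ (r * J) ≤ 2 * timeKernel (r / 2) τ := by
    refine (hJ2 r hr.le).trans (mul_le_mul' ?_ le_rfl)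
    conv_rhs => rw [← ENNReal.rpow_one 2]
    exact ENNReal.rpow_le_rpow_of_exponent_le (by simp) (by linarith)
  have hg : Measurable (smooth ψ J f) := hψ.measurable_smooth J hf
  obtain ⟨g, hgdef⟩ : ∃ g, g = smooth ψ J f := ⟨_, rfl⟩
  rw [← hgdef] at hg
  have hgB : ∀ᵐ x, ‖g x‖ₑ ≤ 2 ^ (r * J) * M := by rw [hgdef]; exact hfM J
  have hgp : eLpNorm g (ENNReal.ofReal p) ≤ A * eLpNorm f (ENNReal.ofReal p) := by
    rw [hgdef, hA]; exact hψ.eLpNorm_smooth_le hp hf J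
  have hgN : HolderBound σ p (A * N) g := by
    rw [hgdef, hA]; exact hψ.holderBound_smooth hp hf hfp hfN J
  obtain ⟨F, hF⟩ : ∃ F : Space d → Fin d → Fin d → ℂ, F = fun x => tens (f x) (f x) := ⟨_, rfl⟩
  -- `H` is the tensor square of the part of `f` at scales coarser than `√τ`. The remainder `F - H`
  -- is small in `L^p`, so its increments can be charged to the kernel; `H` is itself Hölder, so its
  -- increments are taken on `H` and the kernel costs only `τ^{-1/2}`.
  obtain ⟨H, hH⟩ : ∃ H : Space d → Fin d → Fin d → ℂ, H = fun x => tens (g x) (g x) := ⟨_, rfl⟩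
  rw [← hF] at hffp ⊢
  have hFm : Measurable F := by rw [hF]; exact measurable_tens_comp hf hf
  have hHm : Measurable H := by rw [hH]; exact measurable_tens_comp hg hg
  have hD : eLpNorm (fun x => F x - H x) (ENNReal.ofReal p) ≤
      c₃ * (timeKernel (-((σ - r) / 2)) τ * M * N) := by
    rw [hF, hH, hgdef]
    refine (hc₃ f M N hf hN hfp hfM hfN J).trans ?_
    gcongr
    exact hJ1 (σ - r) (by linarith)
  have hHp : eLpNorm H (ENNReal.ofReal p) ≤
      2 * timeKernel (r / 2) τ * M * (A * eLpNorm f (ENNReal.ofReal p)) := by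
    refine (eLpNorm_le_const_mul (c := 2 ^ (r * J) * M) hp0 hg ?_).trans
      (mul_le_mul' (mul_le_mul' hJr le_rfl) hgp)
    filter_upwards [hgB] with x hx
    rw [hH]
    exact (enorm_tens_le _ _).trans (mul_le_mul' hx le_rfl)
  have hHN : HolderBound σ p (2 * (2 * timeKernel (r / 2) τ * M) * (A * N)) H := fun h => by
    have hgB' : ∀ᵐ x, ‖g (x + h)‖ₑ ≤ 2 ^ (r * J) * M :=
      (measurePreserving_add_right volume h).quasiMeasurePreserving.ae hgB
    have hgh : Measurable fun x => g (x + h) := hg.comp (measurable_add_const h)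
    rw [hH]
    refine (eLpNorm_tens_self_sub_le hp0 hgh hg hgB' hgB).trans ?_
    rw [← two_mul]
    refine (mul_le_mul' (mul_le_mul' le_rfl (mul_le_mul' hJr le_rfl)) (hgN h)).trans (le_of_eq ?_)
    ring
  have hHp' : eLpNorm H (ENNReal.ofReal p) ≠ ∞ := by
    refine ne_top_of_le_ne_top ?_ hHp
    have := timeKernel_ne_top (r / 2) τ
    finiteness
  have hDp' : eLpNorm (fun x => F x - H x) (ENNReal.ofReal p) ≠ ∞ := by
    refine ne_top_of_le_ne_top ?_ hD
    have := timeKernel_ne_top (-((σ - r) / 2)) τ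
    finiteness
  have hDm : Measurable fun x => F x - H x := hFm.sub hHm
  have hsub := heatLerayDiv_sub_of_eLpNorm hτ hp hFm hHm hffp hHp'
  have hLF : Measurable (heatLerayDiv τ F) :=
    measurable_heatLerayDiv measurable_const measurable_id (F := fun _ => F)
      (hFm.comp measurable_snd)
  have hLH : Measurable (heatLerayDiv τ H) :=
    measurable_heatLerayDiv measurable_const measurable_id (F := fun _ => H)
      (hHm.comp measurable_snd)
  -- The exponent count: the kernel costs `τ^{-1/2}` or `τ^{-(1+σ)/2}`, the remainder gains
  -- `τ^{(σ-r)/2}` and the low frequencies lose `τ^{-r/2}`. Every combination equals `τ^{-(1+r)/2}`,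
  -- with an additional `τ^{σ/2}` in `e2`.
  have e1 : timeKernel (1 / 2) τ * timeKernel (r / 2) τ = timeKernel ((1 + r) / 2) τ := by
    rw [timeKernel_add]; congr 1; ring
  have e2 : timeKernel (1 / 2) τ * timeKernel (-((σ - r) / 2)) τ =
      timeKernel ((1 + r) / 2) τ * timeKernel (-(σ / 2)) τ := by
    rw [timeKernel_add, timeKernel_add]; congr 1; ring
  have e3 : timeKernel ((1 + σ) / 2) τ * timeKernel (-((σ - r) / 2)) τ =
      timeKernel ((1 + r) / 2) τ := by
    rw [timeKernel_add]; congr 1; ring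
  constructor
  · have hsum : eLpNorm (heatLerayDiv τ F) (ENNReal.ofReal p) ≤
        eLpNorm (heatLerayDiv τ fun x => F x - H x) (ENNReal.ofReal p) +
          eLpNorm (heatLerayDiv τ H) (ENNReal.ofReal p) := by
      have := eLpNorm_add_le (hLF.sub hLH).aestronglyMeasurable hLH.aestronglyMeasurable
        (one_le_ofReal hp) (μ := volume)
      rw [sub_add_cancel] at this
      rw [hsub]
      exact this
    refine hsum.trans ((add_le_add ((hc₁ τ hτ _ hDm).trans (mul_le_mul' le_rfl hD))
      ((hc₁ τ hτ _ hHm).trans (mul_le_mul' le_rfl hHp))).trans ?_)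
    calc _ = (c₁ * c₃ : ℝ≥0∞) * ((timeKernel (1 / 2) τ * timeKernel (-((σ - r) / 2)) τ) * M * N) +
          c₁ * (2 * A) * ((timeKernel (1 / 2) τ * timeKernel (r / 2) τ) * M *
            eLpNorm f (ENNReal.ofReal p)) := by ring
      _ ≤ (c₁ * (c₃ + 2 * A)) * (timeKernel ((1 + r) / 2) τ * M *
          (eLpNorm f (ENNReal.ofReal p) + timeKernel (-(σ / 2)) τ * N)) := by
          rw [e1, e2]
          have a1 : (c₁ * c₃ : ℝ≥0∞) ≤ c₁ * (c₃ + 2 * A) := by gcongr; exact le_self_add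
          have a2 : (c₁ * (2 * A) : ℝ≥0∞) ≤ c₁ * (c₃ + 2 * A) := by gcongr; exact le_add_self
          refine (add_le_add (mul_le_mul' a1 le_rfl) (mul_le_mul' a2 le_rfl)).trans (le_of_eq ?_)
          ring
      _ ≤ _ := by
          push_cast
          gcongr
          exact le_self_add
  · intro h
    have hFh : Measurable fun x => heatLerayDiv τ F (x + h) := hLF.comp (measurable_add_const h)
    have hHh : Measurable fun x => heatLerayDiv τ H (x + h) := hLH.comp (measurable_add_const h)
    have hsum : eLpNorm (fun x => heatLerayDiv τ F (x + h) - heatLerayDiv τ F x)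
        (ENNReal.ofReal p) ≤
        eLpNorm (fun x => heatLerayDiv τ (fun x => F x - H x) (x + h) -
          heatLerayDiv τ (fun x => F x - H x) x) (ENNReal.ofReal p) +
        eLpNorm (fun x => heatLerayDiv τ H (x + h) - heatLerayDiv τ H x) (ENNReal.ofReal p) := by
      have := eLpNorm_add_le ((hFh.sub hHh).sub (hLF.sub hLH)).aestronglyMeasurable
        (hHh.sub hLH).aestronglyMeasurable (one_le_ofReal hp) (μ := volume)
      rw [hsub]
      refine le_trans (le_of_eq ?_) this
      congr 1
      ext1 x
      simp only [Pi.add_apply, Pi.sub_apply]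
      abel
    have hHh' : eLpNorm (fun x => heatLerayDiv τ H (x + h) - heatLerayDiv τ H x)
        (ENNReal.ofReal p) ≤ c₁ * timeKernel (1 / 2) τ *
          (‖h‖ₑ ^ σ * (2 * (2 * timeKernel (r / 2) τ * M) * (A * N))) := by
      rw [heatLerayDiv_shift_sub hτ hp hHm hHp']
      exact (hc₁ τ hτ _ ((hHm.comp (measurable_add_const h)).sub hHm)).trans
        (mul_le_mul' le_rfl (hHN h))
    refine hsum.trans ((add_le_add ((hc₂ τ hτ _ hDm hDp' h).trans
      (mul_le_mul' le_rfl (mul_le_mul' le_rfl hD))) hHh').trans ?_)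
    calc _ = (c₂ * c₃ : ℝ≥0∞) * (‖h‖ₑ ^ σ *
            ((timeKernel ((1 + σ) / 2) τ * timeKernel (-((σ - r) / 2)) τ) * M * N)) +
          c₁ * (2 * (2 * A)) * (‖h‖ₑ ^ σ *
            ((timeKernel (1 / 2) τ * timeKernel (r / 2) τ) * M * N)) := by ring
      _ = (c₂ * c₃ + c₁ * (2 * (2 * A))) *
          (‖h‖ₑ ^ σ * (timeKernel ((1 + r) / 2) τ * M * N)) := by rw [e1, e3]; ring
      _ ≤ (c₁ * (c₃ + 2 * A) + (c₂ * c₃ + c₁ * (2 * (2 * A)))) *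
          (‖h‖ₑ ^ σ * (timeKernel ((1 + r) / 2) τ * M * N)) := by
          exact mul_le_mul' le_add_self le_rfl
      _ = _ := by push_cast; ring

end

/-! ### Functions and tempered distributions -/

section

variable {d : ℕ}

theorem Represents.congr {f : 𝓢'(Space d, Vec d)} {g g' : Space d → Vec d} (h : Represents f g)
    (hg : g =ᵐ[volume] g') : Represents f g' := fun φ => by
  have e : (fun x => φ x • g x) =ᵐ[volume] fun x => φ x • g' x := by
    filter_upwards [hg] with x hx
    rw [hx]
  exact ⟨(h φ).1.congr e, (h φ).2.trans (integral_congr_ae e)⟩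

/-- Test against a Gaussian, which vanishes nowhere, and divide by it. -/
theorem Represents.locallyIntegrable {f : 𝓢'(Space d, Vec d)} {g : Space d → Vec d}
    (h : Represents f g) : LocallyIntegrable g := by
  have h0 : ∀ x : Space d, heatSchwartz x ≠ 0 := fun x => by
    rw [heatSchwartz_apply, heatSymbol]
    exact Complex.ofReal_ne_zero.2 (Real.exp_ne_zero _)
  have h1 : LocallyIntegrableOn (fun x => (heatSchwartz x)⁻¹ • heatSchwartz x • g x) univ := by
    refine LocallyIntegrableOn.continuousOn_smul ?_ ?_ ?_
    · exact isOpen_univ.isLocallyClosed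
    · exact ((h heatSchwartz).1.locallyIntegrable).locallyIntegrableOn _
    · exact (heatSchwartz.continuous.inv₀ h0).continuousOn
  rw [locallyIntegrableOn_univ] at h1
  simpa only [inv_smul_smul₀ (h0 _)] using h1

/-- Smooth compactly supported functions are Schwartz functions, so the fundamental lemma of the
calculus of variations applies. In particular the infimum in `lqNorm` runs over a single almost
everywhere class. -/
theorem Represents.ae_eq {f : 𝓢'(Space d, Vec d)} {g g' : Space d → Vec d} (h : Represents f g)
    (h' : Represents f g') : g =ᵐ[volume] g' := by
  refine ae_eq_of_integral_contDiff_smul_eq h.locallyIntegrable h'.locallyIntegrable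
    fun φ hφ hφc => ?_
  have hc : HasCompactSupport fun x => (φ x : ℂ) := hφc.comp_left (g := Complex.ofReal) (by simp)
  have hd : ContDiff ℝ (⊤ : ℕ∞) fun x => (φ x : ℂ) := Complex.ofRealCLM.contDiff.comp hφ
  have e := (h (hc.toSchwartzMap hd)).2.symm.trans (h' (hc.toSchwartzMap hd)).2
  simpa [HasCompactSupport.toSchwartzMap_toFun, Complex.coe_smul] using! e

theorem Represents.lqNorm_eq {f : 𝓢'(Space d, Vec d)} {g : Space d → Vec d} (h : Represents f g)
    {q : ℝ≥0∞} (hg : MemLp g q) : lqNorm q f = eLpNorm g q := by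
  refine le_antisymm (iInf₂_le g ⟨hg, h⟩) (le_iInf₂ fun g' hg' => ?_)
  exact (eLpNorm_congr_ae (h.ae_eq hg'.2)).le

theorem exists_represents_of_lqNorm_lt_top {f : 𝓢'(Space d, Vec d)} {q : ℝ≥0∞}
    (hf : lqNorm q f < ∞) : ∃ g, MemLp g q ∧ Represents f g ∧ eLpNorm g q = lqNorm q f := by
  obtain ⟨g, hg⟩ := iInf_lt_iff.1 hf
  obtain ⟨hg', -⟩ := iInf_lt_iff.1 hg
  exact ⟨g, hg'.1, hg'.2, (hg'.2.lqNorm_eq hg'.1).symm⟩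

theorem Represents.eLpNorm_le {f : 𝓢'(Space d, Vec d)} {g : Space d → Vec d} (h : Represents f g)
    (q : ℝ≥0∞) : eLpNorm g q ≤ lqNorm q f :=
  le_iInf₂ fun _ hg' => (eLpNorm_congr_ae (h.ae_eq hg'.2)).le

theorem Represents.add {f f' : 𝓢'(Space d, Vec d)} {g g' : Space d → Vec d} (h : Represents f g)
    (h' : Represents f' g') : Represents (f + f') fun x => g x + g' x := fun φ => by
  have h1 := h φ
  have h2 := h' φ
  simp only [smul_add]
  refine ⟨h1.1.add h2.1, ?_⟩
  rw [integral_add h1.1 h2.1, ← h1.2, ← h2.2]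
  rfl

theorem lqNorm_add_le {q : ℝ≥0∞} (hq : 1 ≤ q) (f g : 𝓢'(Space d, Vec d)) :
    lqNorm q (f + g) ≤ lqNorm q f + lqNorm q g := by
  rcases eq_or_ne (lqNorm q f) ∞ with hf | hf
  · simp [hf]
  rcases eq_or_ne (lqNorm q g) ∞ with hg | hg
  · simp [hg]
  obtain ⟨F, hF, hFr, hFn⟩ := exists_represents_of_lqNorm_lt_top hf.lt_top
  obtain ⟨G, hG, hGr, hGn⟩ := exists_represents_of_lqNorm_lt_top hg.lt_top
  rw [← hFn, ← hGn, (hFr.add hGr).lqNorm_eq (hF.add hG)]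
  exact eLpNorm_add_le hF.1 hG.1 hq

/-- The transpose of a Fourier multiplier, as it acts on test functions: a correlation with the
kernel of the multiplier. -/
theorem fourier_smulLeftCLM_fourierInv_apply (m φ : 𝓢(Space d, ℂ)) (y : Space d) :
    𝓕 (SchwartzMap.smulLeftCLM ℂ (m : Space d → ℂ) (𝓕⁻ φ)) y =
      ∫ x, φ x * 𝓕⁻ (m : Space d → ℂ) (x - y) := by
  obtain ⟨e, he⟩ : ∃ e : ℝ → ℂ, ∀ t, e t = Complex.exp (↑(2 * Real.pi * t) * Complex.I) :=
    ⟨_, fun t => rfl⟩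
  have hec : Continuous e := by rw [funext he]; fun_prop
  have hen : ∀ t, ‖e t‖ ≤ 1 := fun t => by rw [he]; exact (Complex.norm_exp_ofReal_mul_I _).le
  have hadd : ∀ s t, e (s + t) = e s * e t := fun s t => by
    simp only [he, ← Complex.exp_add]; congr 1; push_cast; ring
  have hF : ∀ (f : Space d → ℂ) (x : Space d), 𝓕⁻ f x = ∫ ξ, e (inner ℝ ξ x) * f ξ := fun f x => by
    rw [Real.fourierInv_eq']; simp_rw [he]; rfl
  have hF' : ∀ (f : Space d → ℂ) (x : Space d), 𝓕 f x = ∫ ξ, e (-inner ℝ ξ x) * f ξ := fun f x => by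
    rw [Real.fourier_eq']; simp_rw [he]
    refine integral_congr_ae (Eventually.of_forall fun ξ => ?_)
    simp only [smul_eq_mul]
    congr 3; push_cast; ring
  have hi : Integrable (Function.uncurry fun x ξ : Space d => e (inner ℝ ξ (x - y)) * (φ x * m ξ))
      (volume.prod volume) := by
    refine (φ.integrable.mul_prod m.integrable).bdd_mul (c := 1) ?_
      (Eventually.of_forall fun z => hen _)
    exact (hec.comp (by fun_prop)).aestronglyMeasurable
  calc 𝓕 (SchwartzMap.smulLeftCLM ℂ (m : Space d → ℂ) (𝓕⁻ φ)) y
      = ∫ ξ, e (-inner ℝ ξ y) * (m ξ * ∫ x, e (inner ℝ x ξ) * φ x) := by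
        rw [SchwartzMap.fourier_coe, hF']
        refine integral_congr_ae (Eventually.of_forall fun ξ => ?_)
        simp only
        rw [SchwartzMap.smulLeftCLM_apply_apply m.hasTemperateGrowth, SchwartzMap.fourierInv_coe, hF,
          smul_eq_mul]
    _ = ∫ ξ, ∫ x, e (inner ℝ ξ (x - y)) * (φ x * m ξ) := by
        refine integral_congr_ae (Eventually.of_forall fun ξ => ?_)
        simp only
        rw [← mul_assoc, ← integral_const_mul]
        refine integral_congr_ae (Eventually.of_forall fun x => ?_)
        simp only
        rw [inner_sub_right, sub_eq_add_neg, hadd, real_inner_comm ξ x]; ring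
    _ = ∫ x, ∫ ξ, e (inner ℝ ξ (x - y)) * (φ x * m ξ) := (integral_integral_swap hi).symm
    _ = _ := by
        refine integral_congr_ae (Eventually.of_forall fun x => ?_)
        simp only
        rw [hF, ← integral_const_mul]
        refine integral_congr_ae (Eventually.of_forall fun ξ => ?_)
        simp only; ring

theorem GoodKernel.exists_conv_le {ψ : Space d → ℂ} (hψ : GoodKernel ψ) {p : ℝ} (hp : 1 ≤ p)
    {g : Space d → ℝ≥0∞} (hg : Measurable g) (hgp : eLpNorm g (ENNReal.ofReal p) ≠ ∞) :
    ∃ c : ℝ≥0, ∀ x, ∫⁻ y, ‖ψ (x - y)‖ₑ * g y ≤ c := by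
  obtain ⟨a, ha⟩ := hψ.bounded
  have h := lintegral_conv_rpow_le (K := fun y => ‖ψ y‖ₑ) hψ.continuous.measurable.enorm hg
    one_pos hp ha
  simp only [ENNReal.rpow_one] at h
  have hp0 : 0 < p := by linarith
  have h1 : 1 / p ≤ 1 := (div_le_one hp0).2 hp
  have hfin : (a : ℝ≥0∞) ^ (1 / p) * (∫⁻ y, ‖ψ y‖ₑ) ^ (1 - 1 / p) * eLpNorm g (ENNReal.ofReal p) < ∞ := by
    refine ENNReal.mul_lt_top (ENNReal.mul_lt_top ?_ ?_) hgp.lt_top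
    · exact ENNReal.rpow_lt_top_of_nonneg (by positivity) (by simp)
    · exact ENNReal.rpow_lt_top_of_nonneg (by linarith) hψ.integrable.2.ne
  exact ⟨_, fun x => (h x).trans (ENNReal.coe_toNNReal hfin.ne).ge⟩

/-- Fourier multipliers with Schwartz symbols act by convolution. -/
theorem Represents.fourierMultiplierCLM {f : 𝓢'(Space d, Vec d)} {g : Space d → Vec d}
    (h : Represents f g) (hg : Measurable g) {p : ℝ} (hp : 1 ≤ p)
    (hgp : eLpNorm g (ENNReal.ofReal p) ≠ ∞) (m : 𝓢(Space d, ℂ)) :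
    Represents (TemperedDistribution.fourierMultiplierCLM (Vec d) (m : Space d → ℂ) f)
      (conv (𝓕⁻ (m : Space d → ℂ)) g) := by
  intro φ
  have hK : GoodKernel (𝓕⁻ (m : Space d → ℂ)) := by
    rw [← SchwartzMap.fourierInv_coe]; exact goodKernel_of_schwartz _
  obtain ⟨K, hKdef⟩ : ∃ K : Space d → ℂ, K = 𝓕⁻ (m : Space d → ℂ) := ⟨_, rfl⟩
  rw [← hKdef] at hK ⊢
  have hKm : Measurable K := hK.continuous.measurable
  have hφm : Measurable φ := φ.continuous.measurable
  obtain ⟨c, hc⟩ := hK.exists_conv_le hp hg.enorm (by rwa [eLpNorm_enorm])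
  have hi : Integrable (Function.uncurry fun x y : Space d => (φ x * K (x - y)) • g y)
      (volume.prod volume) := by
    have hm : Measurable (Function.uncurry fun x y : Space d => (φ x * K (x - y)) • g y) := by
      have h1 : Measurable fun z : Space d × Space d => φ z.1 * K (z.1 - z.2) :=
        (hφm.comp measurable_fst).mul (hKm.comp (measurable_fst.sub measurable_snd))
      exact h1.smul (hg.comp measurable_snd)
    refine ⟨hm.aestronglyMeasurable, ?_⟩
    rw [hasFiniteIntegral_iff_enorm, lintegral_prod _ hm.enorm.aemeasurable]
    calc _ ≤ ∫⁻ x, ‖φ x‖ₑ * c := by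
          refine lintegral_mono fun x => ?_
          simp only [Function.uncurry_apply_pair, enorm_smul, enorm_mul, mul_assoc]
          rw [lintegral_const_mul' _ _ (by simp)]
          exact mul_le_mul' le_rfl (hc x)
      _ < ∞ := by
          rw [lintegral_mul_const' _ _ (by simp)]
          exact ENNReal.mul_lt_top φ.integrable.2 (by simp)
  have e : ∀ x, φ x • conv K g x = ∫ y, (φ x * K (x - y)) • g y := fun x => by
    rw [conv, ← integral_smul]
    simp only [smul_smul]
  simp only [e]
  refine ⟨hi.integral_prod_left, ?_⟩
  rw [integral_integral_swap hi, TemperedDistribution.fourierMultiplierCLM_apply_apply, (h _).2]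
  refine integral_congr_ae (Eventually.of_forall fun y => ?_)
  simp only
  rw [integral_smul_const, fourier_smulLeftCLM_fourierInv_apply, hKdef]

end

/-! ### Low frequencies and the heat semi-group -/

section

variable {d : ℕ}

/-- The convolution kernel of `S_0`. -/
noncomputable def IsCutoff.schwartz {χ : Space d → ℝ} (hχ : IsCutoff χ) : 𝓢(Space d, ℂ) :=
  (show HasCompactSupport fun ξ => (χ ξ : ℂ) from
    hχ.hasCompactSupport.comp_left (g := Complex.ofReal) (by simp)).toSchwartzMap
    (Complex.ofRealCLM.contDiff.comp hχ.contDiff)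

theorem IsCutoff.schwartz_apply {χ : Space d → ℝ} (hχ : IsCutoff χ) (ξ : Space d) :
    hχ.schwartz ξ = χ ξ := rfl

theorem IsCutoff.comp_smul {χ : Space d → ℝ} (hχ : IsCutoff χ) {l : ℝ} (hl : 0 < l) :
    IsCutoff fun ξ => χ (l • ξ) where
  contDiff := hχ.contDiff.comp (contDiff_const_smul l)
  hasCompactSupport := hχ.hasCompactSupport.comp_smul hl.ne'
  eventually_eq_one := by
    have h : Tendsto (fun ξ : Space d => l • ξ) (𝓝 0) (𝓝 0) := by
      have := (continuous_const_smul l).tendsto (0 : Space d)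
      rwa [smul_zero] at this
    exact h.eventually hχ.eventually_eq_one

/-- The convolution kernel of `S_0`. -/
noncomputable def IsCutoff.kernel {χ : Space d → ℝ} (hχ : IsCutoff χ) : 𝓢(Space d, ℂ) :=
  𝓕⁻ hχ.schwartz

theorem IsCutoff.integral_kernel {χ : Space d → ℝ} (hχ : IsCutoff χ) : ∫ x, hχ.kernel x = 1 := by
  have h1 : 𝓕 hχ.kernel 0 = hχ.schwartz 0 := by
    rw [IsCutoff.kernel, FourierTransform.fourier_fourierInv_eq]
  rw [SchwartzMap.fourier_coe, Real.fourier_eq'] at h1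
  simp only [inner_zero_right, mul_zero, Complex.ofReal_zero, zero_mul, Complex.exp_zero,
    one_smul] at h1
  rw [h1, IsCutoff.schwartz_apply, hχ.eventually_eq_one.self_of_nhds, Complex.ofReal_one]

/-- For exponents in `[0, 1]` the weight is at most `1 + ‖y‖`, whose product with a Schwartz
function is integrable. -/
theorem lintegral_enorm_schwartz_mul_rpow_ne_top (f : 𝓢(Space d, ℂ)) {σ : ℝ} (hσ0 : 0 ≤ σ)
    (hσ1 : σ ≤ 1) : ∫⁻ y, ‖f y‖ₑ * ‖y‖ₑ ^ σ ≠ ∞ := by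
  have h1 : ∀ y : Space d, ‖f y‖ₑ * ‖y‖ₑ ^ σ ≤ ‖f y‖ₑ + ‖‖y‖ ^ 1 * ‖f y‖‖ₑ := fun y => by
    rw [pow_one, enorm_mul, enorm_norm, enorm_norm, mul_comm ‖y‖ₑ]
    rcases le_or_gt ‖y‖ₑ 1 with h | h
    · exact (mul_le_of_le_one_right zero_le (ENNReal.rpow_le_one h hσ0)).trans le_self_add
    · refine le_trans (mul_le_mul' le_rfl ?_) le_add_self
      conv_rhs => rw [← ENNReal.rpow_one ‖y‖ₑ]
      exact ENNReal.rpow_le_rpow_of_exponent_le h.le hσ1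
  refine ((lintegral_mono h1).trans_lt ?_).ne
  rw [lintegral_add_left f.continuous.enorm.measurable]
  exact ENNReal.add_lt_top.2 ⟨f.integrable.2, (f.integrable_pow_mul volume 1).2⟩

theorem Represents.lowFreq {f : 𝓢'(Space d, Vec d)} {g : Space d → Vec d}
    (h : Represents f g) (hg : Measurable g) {p : ℝ} (hp : 1 ≤ p)
    (hgp : eLpNorm g (ENNReal.ofReal p) ≠ ∞) {χ : Space d → ℝ} (hχ : IsCutoff χ) (j : ℕ) :
    Represents (lowFreq χ j f) (smooth hχ.kernel j g) := by
  have hl : (0 : ℝ) < ((2 : ℝ) ^ j)⁻¹ := by positivity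
  have h1 := h.fourierMultiplierCLM hg hp hgp (hχ.comp_smul hl).schwartz
  have e1 : ((hχ.comp_smul hl).schwartz : Space d → ℂ) = fun ξ => hχ.schwartz (((2 : ℝ) ^ j)⁻¹ • ξ) :=
    rfl
  rw [e1, fourierInv_comp_smul hl, ← SchwartzMap.fourierInv_coe] at h1
  exact h1

theorem lowFreq_succ {χ : Space d → ℝ} (hχ : IsCutoff χ) (j : ℕ) (f : 𝓢'(Space d, Vec d)) :
    lowFreq χ (j + 1) f = lowFreq χ j f + dyadicBlock χ j f := by
  have hl : ∀ j : ℕ, (0 : ℝ) < ((2 : ℝ) ^ j)⁻¹ := fun j => by positivity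
  have ht : ∀ j : ℕ, Function.HasTemperateGrowth fun ξ : Space d => (χ (((2 : ℝ) ^ j)⁻¹ • ξ) : ℂ) :=
    fun j => (hχ.comp_smul (hl j)).schwartz.hasTemperateGrowth
  have e : (fun ξ : Space d => (annulusCutoff χ (((2 : ℝ) ^ j)⁻¹ • ξ) : ℂ)) =
      (fun ξ => (χ (((2 : ℝ) ^ (j + 1))⁻¹ • ξ) : ℂ)) - fun ξ => (χ (((2 : ℝ) ^ j)⁻¹ • ξ) : ℂ) := by
    ext1 ξ
    simp only [annulusCutoff, Pi.sub_apply, Complex.ofReal_sub, smul_smul, pow_succ, mul_inv_rev]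
  have h := TemperedDistribution.smulLeftCLM_add (F := Vec d) (ht j) ((ht (j + 1)).sub (ht j))
  rw [add_sub_cancel] at h
  simp only [NavierStokes.lowFreq, dyadicBlock, e, TemperedDistribution.fourierMultiplierCLM_apply, h,
    add_apply, FourierTransform.fourierInv_add]

/-- `S_j` is the sum of `S_0` and the blocks below `j`. As the regularity is negative, the block
bounds grow geometrically and their sum is comparable to the last one. -/
theorem exists_lqNorm_lowFreq_le {r : ℝ} (hr : 0 < r) :
    ∃ C : ℝ≥0, ∀ {d : ℕ} {χ : Space d → ℝ} (_ : IsCutoff χ) (f : 𝓢'(Space d, Vec d)) (j : ℕ),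
      lqNorm ∞ (lowFreq χ j f) ≤ 2 ^ (r * j) * (C * besovNorm χ (-r) ∞ f) := by
  have h2 : (1 : ℝ) < 2 ^ r := Real.one_lt_rpow (by norm_num) hr
  have h2' : 0 < (2 : ℝ) ^ r - 1 := by linarith
  have e2 : (2 : ℝ≥0∞) ^ r = ENNReal.ofReal (2 ^ r) := by
    rw [show (2 : ℝ≥0∞) = ENNReal.ofReal 2 by simp, ENNReal.ofReal_rpow_of_pos (by norm_num)]
  have h1 : (1 : ℝ≥0∞) ≤ 2 ^ r := by
    rw [e2, ← ENNReal.ofReal_one]; exact ENNReal.ofReal_le_ofReal h2.le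
  -- The sum of the geometric series with ratio `2 ^ (-r)`; the relation `C + 1 ≤ C * 2 ^ r` closes
  -- the induction on `j`.
  obtain ⟨C, hC⟩ : ∃ C : ℝ, C = 1 + 1 / (2 ^ r - 1) := ⟨_, rfl⟩
  have hC1 : 1 ≤ C := by rw [hC]; have : 0 < 1 / ((2 : ℝ) ^ r - 1) := by positivity
                         linarith
  have hC2 : C + 1 ≤ C * 2 ^ r := by
    have : C * (2 ^ r - 1) = (2 ^ r - 1) + 1 := by rw [hC]; field_simp
    linarith
  refine ⟨C.toNNReal, fun {d χ} hχ f j => ?_⟩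
  change _ ≤ 2 ^ (r * j) * (ENNReal.ofReal C * _)
  obtain ⟨B, hB⟩ : ∃ B, B = besovNorm χ (-r) ∞ f := ⟨_, rfl⟩
  rw [← hB]
  have hS0 : lqNorm ∞ (lowFreq χ 0 f) ≤ B := by
    have : (2 : ℝ≥0∞) ^ (-(-r)) * lqNorm ∞ (lowFreq χ 0 f) ≤ B := by
      rw [hB]; exact le_max_left _ _
    rw [neg_neg] at this
    exact (le_mul_of_one_le_left zero_le h1).trans this
  have hD : ∀ j : ℕ, lqNorm ∞ (dyadicBlock χ j f) ≤ 2 ^ (r * j) * B := fun j => by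
    have : (2 : ℝ≥0∞) ^ (-r * j) * lqNorm ∞ (dyadicBlock χ j f) ≤ B := by
      rw [hB]
      exact (le_iSup (fun j : ℕ => (2 : ℝ≥0∞) ^ (-r * j) * lqNorm ∞ (dyadicBlock χ j f)) j).trans
        (le_max_right _ _)
    calc _ = 2 ^ (r * j) * ((2 : ℝ≥0∞) ^ (-r * j) * lqNorm ∞ (dyadicBlock χ j f)) := by
          rw [← mul_assoc, two_rpow_mul, show r * j + -r * j = 0 by ring, ENNReal.rpow_zero, one_mul]
      _ ≤ _ := mul_le_mul' le_rfl this
  induction j with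
  | zero =>
    rw [Nat.cast_zero, mul_zero, ENNReal.rpow_zero, one_mul]
    refine hS0.trans (le_mul_of_one_le_left zero_le ?_)
    rw [← ENNReal.ofReal_one]; exact ENNReal.ofReal_le_ofReal hC1
  | succ j ih =>
    rw [lowFreq_succ hχ]
    refine (lqNorm_add_le le_top _ _).trans ((add_le_add ih (hD j)).trans ?_)
    have hC3 : ENNReal.ofReal C + 1 ≤ ENNReal.ofReal C * 2 ^ r := by
      rw [e2, ← ENNReal.ofReal_mul (by linarith), ← ENNReal.ofReal_one,
        ← ENNReal.ofReal_add (by linarith) (by norm_num)]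
      exact ENNReal.ofReal_le_ofReal hC2
    calc _ = 2 ^ (r * j) * ((ENNReal.ofReal C + 1) * B) := by ring
      _ ≤ 2 ^ (r * j) * ((ENNReal.ofReal C * 2 ^ r) * B) := by gcongr
      _ = _ := by
          rw [show r * ((j + 1 : ℕ) : ℝ) = r * j + r by push_cast; ring, ← two_rpow_mul]; ring

/-- The kernel of the heat semi-group. -/
noncomputable def heatKernel (t : ℝ) : Space d → ℂ := 𝓕⁻ (heatSymbol t)

theorem goodKernel_heatKernel_one : GoodKernel (heatKernel (d := d) 1) := by
  have : heatSymbol (d := d) 1 = heatSchwartz := by ext1 ξ; rw [heatSchwartz_apply]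
  rw [heatKernel, this, ← SchwartzMap.fourierInv_coe]
  exact goodKernel_of_schwartz _

theorem heatKernel_eq_dil {t : ℝ} (ht : 0 < t) :
    heatKernel (d := d) t = dil 0 (√t) (heatKernel 1) := fourierInv_heatSymbol ht

theorem Represents.heat {f : 𝓢'(Space d, Vec d)} {g : Space d → Vec d}
    (h : Represents f g) (hg : Measurable g) {p : ℝ} (hp : 1 ≤ p)
    (hgp : eLpNorm g (ENNReal.ofReal p) ≠ ∞) {t : ℝ} (ht : 0 < t) :
    Represents (heat t f) (conv (heatKernel t) g) := by
  have e : heatSymbol (d := d) t = (gaussian (d := d) (c := 4 * Real.pi ^ 2 * t)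
      (by positivity)).postcompCLM Complex.ofRealCLM := by
    ext1 ξ
    rw [SchwartzMap.postcompCLM_apply, heatSymbol]
    rfl
  have := h.fourierMultiplierCLM hg hp hgp ((gaussian (d := d) (c := 4 * Real.pi ^ 2 * t)
      (by positivity)).postcompCLM Complex.ofRealCLM)
  rwa [← e] at this

end

/-! ### The Duhamel term -/

section

variable {d : ℕ}

theorem timeKernel_rpow {α s τ : ℝ} (hs : 0 < s) : timeKernel α τ ^ s = timeKernel (α * s) τ := by
  rcases le_or_gt τ 0 with h | h
  · rw [timeKernel_of_nonpos h, timeKernel_of_nonpos h, ENNReal.zero_rpow_of_pos hs]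
  · rw [timeKernel_of_pos h, timeKernel_of_pos h,
      ENNReal.ofReal_rpow_of_nonneg (by positivity) hs.le, ← Real.rpow_mul h.le, neg_mul]

theorem timeKernel_mono {α β τ : ℝ} (hτ : τ ≤ 1) (h : α ≤ β) : timeKernel α τ ≤ timeKernel β τ := by
  rcases le_or_gt τ 0 with h' | h'
  · rw [timeKernel_of_nonpos h', timeKernel_of_nonpos h']
  · rw [timeKernel_of_pos h', timeKernel_of_pos h']
    exact ENNReal.ofReal_le_ofReal (Real.rpow_le_rpow_of_exponent_ge h' hτ (by linarith))

theorem timeKernel_zero {τ : ℝ} (hτ : 0 < τ) : timeKernel 0 τ = 1 := by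
  rw [timeKernel_of_pos hτ]; simp

theorem exists_lintegral_timeKernel_mul_timeKernel_le {α γ : ℝ} (hα0 : 0 ≤ α) (hα1 : α < 1)
    (hγ0 : 0 ≤ γ) (hγ1 : γ < 1) : ∃ c : ℝ≥0, ∀ t : ℝ,
      ∫⁻ s, timeKernel α (t - s) * timeKernel γ s ≤ c * timeKernel (α + γ - 1) t := by
  obtain ⟨c, hc⟩ := exists_lintegral_timeKernel_mul_le hα0 hα1 hγ0 hγ1
  refine ⟨c, fun t => ?_⟩
  rcases le_or_gt t 0 with h | h
  · refine le_of_eq_of_le ?_ zero_le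
    refine lintegral_eq_zero_of_ae_eq_zero (Eventually.of_forall fun s => ?_)
    simp only [Pi.zero_apply]
    rcases le_or_gt s 0 with hs | hs
    · rw [timeKernel_of_nonpos hs, mul_zero]
    · rw [timeKernel_of_nonpos (by linarith), zero_mul]
  · refine (hc t h).trans (le_of_eq ?_)
    rw [timeKernel_of_pos h]; congr 3; ring

/-- The interpolation estimate behind the construction of solutions with bounded `√t ‖v(t)‖_∞`. -/
theorem exists_lintegral_oseenAbs_mul_le {q r : ℝ} (hq : (d : ℝ) ≤ q) (hq1 : 1 ≤ q) (hr0 : 0 < r)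
    (hr1 : r < 1) :
    ∃ C : ℝ≥0, ∀ (v : Space d → ℝ≥0∞) (R β : ℝ≥0∞), Measurable v → (∀ y, v y ≤ β) →
      eLpNorm v (ENNReal.ofReal q) ≤ R → ∀ τ ≤ 1, 0 < τ → ∀ x,
      ∫⁻ y, oseenAbs τ (x - y) * v y ≤ C * (timeKernel ((1 + r) / 2) τ * R ^ r * β ^ (1 - r)) := by
  obtain ⟨a, ha⟩ := exists_oseenAbs_le d
  obtain ⟨b, hb⟩ := exists_lintegral_oseenAbs_le d
  have hq0 : 0 < q := by linarith
  have hrq : r ≤ q := by linarith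
  have h0 : 0 < r / q := by positivity
  have h1 : 0 < 1 - r / q := by
    have : r / q < 1 := (div_lt_one hq0).2 (by linarith)
    linarith
  obtain ⟨C, hC⟩ : ∃ C : ℝ≥0, (C : ℝ≥0∞) = (a : ℝ≥0∞) ^ (r / q) * (b : ℝ≥0∞) ^ (1 - r / q) :=
    ⟨_, ENNReal.coe_toNNReal (ENNReal.mul_ne_top
      (ENNReal.rpow_ne_top_of_nonneg h0.le (by simp)) (ENNReal.rpow_ne_top_of_nonneg h1.le (by simp)))⟩
  refine ⟨C, fun v R β hv hβ hR τ hτ1 hτ x => ?_⟩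
  have hK : Measurable (oseenAbs (d := d) τ) := measurable_oseenAbs.of_uncurry_left
  -- The exponent on the left is `1/2 + (d/2)(r/q)`, which is at most `(1 + r)/2` because `d ≤ q`;
  -- raising it uses `τ ≤ 1`.
  have hexp : timeKernel ((d + 1) / 2) τ ^ (r / q) * timeKernel (1 / 2) τ ^ (1 - r / q) ≤
      timeKernel ((1 + r) / 2) τ := by
    rw [timeKernel_rpow h0, timeKernel_rpow h1, timeKernel_add]
    refine timeKernel_mono hτ1 ?_
    have : (d : ℝ) * (r / q) ≤ r := by
      rw [mul_div_assoc', div_le_iff₀ hq0, mul_comm]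
      exact mul_le_mul_of_nonneg_left hq hr0.le
    nlinarith
  calc ∫⁻ y, oseenAbs τ (x - y) * v y
      ≤ ∫⁻ y, (oseenAbs τ (x - y) * v y ^ r) * β ^ (1 - r) := by
        refine lintegral_mono fun y => ?_
        rw [mul_assoc]
        refine mul_le_mul' le_rfl ?_
        calc v y = v y ^ r * v y ^ (1 - r) := by
              rw [← ENNReal.rpow_add_of_nonneg _ _ hr0.le (by linarith), add_sub_cancel,
                ENNReal.rpow_one]
          _ ≤ _ := mul_le_mul' le_rfl (ENNReal.rpow_le_rpow (hβ y) (by linarith))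
    _ = (∫⁻ y, oseenAbs τ (x - y) * v y ^ r) * β ^ (1 - r) :=
        lintegral_mul_const _ ((hK.comp (measurable_const_sub x)).mul (hv.pow_const _))
    _ ≤ ((a * timeKernel ((d + 1) / 2) τ) ^ (r / q) * (b * timeKernel (1 / 2) τ) ^ (1 - r / q) *
          R ^ r) * β ^ (1 - r) := by
        refine mul_le_mul' ((lintegral_conv_rpow_le hK hv hr0 hrq (ha τ hτ) x).trans ?_) le_rfl
        gcongr
        exact hb τ hτ
    _ = C * ((timeKernel ((d + 1) / 2) τ ^ (r / q) * timeKernel (1 / 2) τ ^ (1 - r / q)) *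
          R ^ r * β ^ (1 - r)) := by
        rw [ENNReal.mul_rpow_of_nonneg _ _ h0.le, ENNReal.mul_rpow_of_nonneg _ _ h1.le, hC]
        ring
    _ ≤ _ := by gcongr

/-- The Duhamel term `∫_0^t e^{(t-s)Δ} ℙ ∇F(s) ds`, as a function. -/
noncomputable def duhamel (F : ℝ → Space d → Fin d → Fin d → ℂ) (t : ℝ) (x : Space d) : Vec d :=
  ∫ s in Ioc 0 t, heatLerayDiv (t - s) (F s) x

/-- A scalar integral which dominates the Duhamel term. -/
noncomputable def absDuhamel (f : ℝ → Space d → ℝ≥0∞) (t : ℝ) (x : Space d) : ℝ≥0∞ :=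
  ∫⁻ s in Ioc 0 t, ∫⁻ y, oseenAbs (t - s) (x - y) * f s y

theorem measurable_inner_absDuhamel {f : ℝ → Space d → ℝ≥0∞} (hf : Measurable (Function.uncurry f))
    (t : ℝ) :
    Measurable fun z : Space d × ℝ => ∫⁻ y, oseenAbs (t - z.2) (z.1 - y) * f z.2 y := by
  have h0 := measurable_oseenAbs (d := d)
  have h1 : Measurable fun w : (Space d × ℝ) × Space d => (t - w.1.2, w.1.1 - w.2) := by fun_prop
  have h2 := h0.comp h1
  have h3 : Measurable fun w : (Space d × ℝ) × Space d => (w.1.2, w.2) := by fun_prop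
  have h4 := hf.comp h3
  have h5 := h2.mul h4
  exact h5.lintegral_prod_right'

theorem measurable_heatLerayDiv_sub {F : ℝ → Space d → Fin d → Fin d → ℂ}
    (hF : Measurable (Function.uncurry F)) (t : ℝ) (x : Space d) :
    Measurable fun s => heatLerayDiv (t - s) (F s) x :=
  measurable_heatLerayDiv (measurable_const_sub t) measurable_const hF

theorem measurable_uncurry_duhamel {F : ℝ → Space d → Fin d → Fin d → ℂ}
    (hF : Measurable (Function.uncurry F)) :
    Measurable (Function.uncurry (duhamel F)) := by
  have h1 : Measurable fun w : (ℝ × Space d) × ℝ => heatLerayDiv (w.1.1 - w.2) (F w.2) w.1.2 := by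
    refine measurable_heatLerayDiv (α := (ℝ × Space d) × ℝ) (τ := fun w => w.1.1 - w.2)
      (x := fun w => w.1.2) (F := fun w => F w.2) (by fun_prop) (by fun_prop) ?_
    have h3 : Measurable fun z : ((ℝ × Space d) × ℝ) × Space d => (z.1.2, z.2) := by fun_prop
    have h4 := hF.comp h3
    exact h4
  have hs : MeasurableSet {w : (ℝ × Space d) × ℝ | w.2 ∈ Ioc 0 w.1.1} := by
    have h1 : MeasurableSet {w : (ℝ × Space d) × ℝ | 0 < w.2} :=
      measurableSet_lt measurable_const measurable_snd
    have h2 : MeasurableSet {w : (ℝ × Space d) × ℝ | w.2 ≤ w.1.1} :=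
      measurableSet_le measurable_snd (measurable_fst.comp measurable_fst)
    exact h1.inter h2
  have h2 := ((h1.indicator hs).stronglyMeasurable.integral_prod_right' (ν := volume)).measurable
  have e : Function.uncurry (duhamel F) = fun z : ℝ × Space d => ∫ s,
      {w : (ℝ × Space d) × ℝ | w.2 ∈ Ioc 0 w.1.1}.indicator
        (fun w => heatLerayDiv (w.1.1 - w.2) (F w.2) w.1.2) (z, s) := by
    ext1 z
    rw [Function.uncurry, duhamel, ← integral_indicator measurableSet_Ioc]
    rfl
  rw [e]
  exact h2

theorem enorm_duhamel_le {F : ℝ → Space d → Fin d → Fin d → ℂ}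
    (hF : Measurable (Function.uncurry F)) (t : ℝ) (x : Space d) :
    ‖duhamel F t x‖ₑ ≤ absDuhamel (fun s y => ‖F s y‖ₑ) t x := by
  refine (enorm_integral_le_lintegral_enorm _).trans (lintegral_mono fun s => ?_)
  exact enorm_heatLerayDiv_le _ hF.of_uncurry_left x

theorem integrable_heatLerayDiv {F : ℝ → Space d → Fin d → Fin d → ℂ}
    (hF : Measurable (Function.uncurry F)) {t : ℝ} {x : Space d}
    (h : absDuhamel (fun s y => ‖F s y‖ₑ) t x ≠ ∞) :
    Integrable (fun s => heatLerayDiv (t - s) (F s) x) (volume.restrict (Ioc 0 t)) := by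
  refine ⟨(measurable_heatLerayDiv_sub hF t x).aestronglyMeasurable, ?_⟩
  rw [hasFiniteIntegral_iff_enorm]
  refine lt_of_le_of_lt (lintegral_mono fun s => ?_) h.lt_top
  exact enorm_heatLerayDiv_le _ hF.of_uncurry_left x

theorem duhamel_sub {F G : ℝ → Space d → Fin d → Fin d → ℂ}
    (hF : Measurable (Function.uncurry F)) (hG : Measurable (Function.uncurry G))
    {t : ℝ} {x : Space d}
    (h : absDuhamel (fun s y => ‖F s y‖ₑ) t x ≠ ∞)
    (h' : absDuhamel (fun s y => ‖G s y‖ₑ) t x ≠ ∞) :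
    duhamel F t x - duhamel G t x = duhamel (fun s y => F s y - G s y) t x := by
  have key : ∀ {F : ℝ → Space d → Fin d → Fin d → ℂ}, Measurable (Function.uncurry F) →
      absDuhamel (fun s y => ‖F s y‖ₑ) t x ≠ ∞ →
      ∀ᵐ s ∂volume.restrict (Ioc 0 t), ∫⁻ y, oseenAbs (t - s) (x - y) * ‖F s y‖ₑ < ∞ :=
    fun {F} hF h => by
    have hm := measurable_inner_absDuhamel (f := fun s y => ‖F s y‖ₑ) hF.enorm t
    have hp : Measurable fun s : ℝ => (x, s) := measurable_prodMk_left
    have hm' := hm.comp hp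
    exact ae_lt_top hm' h
  rw [duhamel, duhamel, ← integral_sub (integrable_heatLerayDiv hF h) (integrable_heatLerayDiv hG h')]
  refine integral_congr_ae ?_
  filter_upwards [key hF h, key hG h'] with s hs hs'
  exact (heatLerayDiv_sub hF.of_uncurry_left hG.of_uncurry_left hs.ne hs'.ne).symm

end

/-! ### Bounds for the Duhamel term and the heat flow -/

section

variable {d : ℕ}

theorem measurable_oseenAbs_apply (τ : ℝ) : Measurable (oseenAbs (d := d) τ) :=
  measurable_oseenAbs.of_uncurry_left

theorem setLIntegral_Ioc_le {t : ℝ} {f g : ℝ → ℝ≥0∞} (h : ∀ s, 0 < s → s < t → f s ≤ g s) :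
    ∫⁻ s in Ioc 0 t, f s ≤ ∫⁻ s, g s := by
  rw [← setLIntegral_congr (Ioo_ae_eq_Ioc (a := (0 : ℝ)) (b := t))]
  exact (setLIntegral_mono' measurableSet_Ioo fun s hs => h s hs.1 hs.2).trans
    (setLIntegral_le_lintegral _ _)

/-- The kernel contributes the exponent `(1 + r)/2` and the source `1/2 + (1 - r)/2 = 1 - r/2`.
Their sum exceeds one by exactly `1/2`, so the Beta integral reproduces the weight `t^{-1/2}`. -/
theorem exists_absDuhamel_le {q r : ℝ} (hq : (d : ℝ) ≤ q) (hq1 : 1 ≤ q) (hr0 : 0 < r)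
    (hr1 : r < 1) :
    ∃ C : ℝ≥0, ∀ (f v : ℝ → Space d → ℝ≥0∞) (a b R : ℝ≥0∞), (∀ s, Measurable (v s)) →
      (∀ s y, f s y ≤ a * timeKernel (1 / 2) s * v s y) →
      (∀ s y, v s y ≤ b * timeKernel (1 / 2) s) → (∀ s, eLpNorm (v s) (ENNReal.ofReal q) ≤ R) →
      ∀ t ≤ 1, ∀ x, absDuhamel f t x ≤ C * (a * (R ^ r * b ^ (1 - r))) * timeKernel (1 / 2) t := by
  obtain ⟨c, hc⟩ := exists_lintegral_oseenAbs_mul_le (d := d) hq hq1 hr0 hr1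
  obtain ⟨k, hk⟩ := exists_lintegral_timeKernel_mul_timeKernel_le (α := (1 + r) / 2) (γ := 1 - r / 2)
    (by linarith) (by linarith) (by linarith) (by linarith)
  refine ⟨c * k, fun f v a b R hv hf hb hR t ht x => ?_⟩
  have hr1' : 0 < 1 - r := by linarith
  have step : ∀ s, 0 < s → s < t → ∫⁻ y, oseenAbs (t - s) (x - y) * f s y ≤
      c * (a * (R ^ r * b ^ (1 - r))) *
        (timeKernel ((1 + r) / 2) (t - s) * timeKernel (1 - r / 2) s) := fun s hs hst => by
    have hK : Measurable fun y => oseenAbs (t - s) (x - y) :=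
      (measurable_oseenAbs_apply (t - s)).comp (measurable_const_sub x)
    have e : timeKernel (1 / 2) s * timeKernel (1 / 2) s ^ (1 - r) = timeKernel (1 - r / 2) s := by
      rw [timeKernel_rpow hr1', timeKernel_add]; congr 1; ring
    calc _ ≤ ∫⁻ y, a * timeKernel (1 / 2) s * (oseenAbs (t - s) (x - y) * v s y) := by
          refine lintegral_mono fun y => ?_
          rw [mul_left_comm]
          exact mul_le_mul' le_rfl (hf s y)
      _ = a * timeKernel (1 / 2) s * ∫⁻ y, oseenAbs (t - s) (x - y) * v s y :=
          lintegral_const_mul _ (hK.mul (hv s))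
      _ ≤ a * timeKernel (1 / 2) s * (c * (timeKernel ((1 + r) / 2) (t - s) * R ^ r *
            (b * timeKernel (1 / 2) s) ^ (1 - r))) :=
          mul_le_mul' le_rfl (hc _ R _ (hv s) (hb s) (hR s) _ (by linarith) (by linarith) x)
      _ = c * (a * (R ^ r * b ^ (1 - r))) * (timeKernel ((1 + r) / 2) (t - s) *
            (timeKernel (1 / 2) s * timeKernel (1 / 2) s ^ (1 - r))) := by
          rw [ENNReal.mul_rpow_of_nonneg _ _ hr1'.le]; ring
      _ = _ := by rw [e]
  refine (setLIntegral_Ioc_le step).trans ?_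
  rw [lintegral_const_mul]
  · refine (mul_le_mul' le_rfl (hk t)).trans (le_of_eq ?_)
    rw [show (1 + r) / 2 + (1 - r / 2) - 1 = 1 / 2 by ring]
    push_cast; ring
  · have := measurable_timeKernel ((1 + r) / 2)
    exact (this.comp (measurable_const_sub t)).mul (measurable_timeKernel _)

theorem eLpNorm_duhamel_le {F : ℝ → Space d → Fin d → Fin d → ℂ}
    (hF : Measurable (Function.uncurry F)) {p : ℝ} (hp : 1 ≤ p) (t : ℝ) :
    eLpNorm (duhamel F t) (ENNReal.ofReal p) ≤
      ∫⁻ s in Ioc 0 t, eLpNorm (heatLerayDiv (t - s) (F s)) (ENNReal.ofReal p) := by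
  have h1 : Measurable fun w : ℝ × Space d => heatLerayDiv (t - w.1) (F w.1) w.2 := by
    refine measurable_heatLerayDiv (α := ℝ × Space d) (τ := fun w => t - w.1)
      (x := fun w => w.2) (F := fun w => F w.1) (by fun_prop) (by fun_prop) ?_
    have h3 : Measurable fun z : (ℝ × Space d) × Space d => (z.1.1, z.2) := by fun_prop
    have h4 := hF.comp h3
    exact h4
  have h2 := eLpNorm_lintegral_le (μ := volume.restrict (Ioc 0 t)) (ν := (volume : Measure (Space d)))
    (F := fun s x => ‖heatLerayDiv (t - s) (F s) x‖ₑ) h1.enorm hp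
  simp only [eLpNorm_enorm] at h2
  refine (eLpNorm_mono_enorm fun x => ?_).trans h2
  rw [enorm_eq_self]
  exact enorm_integral_le_lintegral_enorm _

/-- The kernel and the source both have exponent `1/2`, so the Beta integral is bounded uniformly in
`t`. -/
theorem exists_eLpNorm_duhamel_le (d : ℕ) {q : ℝ} (hq1 : 1 ≤ q) :
    ∃ C : ℝ≥0, ∀ (F : ℝ → Space d → Fin d → Fin d → ℂ) (a : ℝ≥0∞), Measurable (Function.uncurry F) →
      (∀ s, eLpNorm (F s) (ENNReal.ofReal q) ≤ a * timeKernel (1 / 2) s) →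
      ∀ t, eLpNorm (duhamel F t) (ENNReal.ofReal q) ≤ C * a := by
  obtain ⟨c, hc⟩ := exists_eLpNorm_heatLerayDiv_le d hq1
  obtain ⟨k, hk⟩ := exists_lintegral_timeKernel_mul_timeKernel_le (α := 1 / 2) (γ := 1 / 2)
    (by norm_num) (by norm_num) (by norm_num) (by norm_num)
  refine ⟨c * k, fun F a hF ha t => (eLpNorm_duhamel_le hF hq1 t).trans ?_⟩
  have step : ∀ s, 0 < s → s < t → eLpNorm (heatLerayDiv (t - s) (F s)) (ENNReal.ofReal q) ≤
      c * a * (timeKernel (1 / 2) (t - s) * timeKernel (1 / 2) s) := fun s hs hst => by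
    refine (hc _ (by linarith) _ hF.of_uncurry_left).trans ((mul_le_mul' le_rfl (ha s)).trans
      (le_of_eq ?_))
    ring
  refine (setLIntegral_Ioc_le step).trans ?_
  rw [lintegral_const_mul]
  · refine (mul_le_mul' le_rfl (hk t)).trans ?_
    have h1 : timeKernel (1 / 2 + 1 / 2 - 1) t ≤ 1 := by
      norm_num
      rcases le_or_gt t 0 with h | h
      · rw [timeKernel_of_nonpos h]; exact zero_le
      · rw [timeKernel_zero h]
    calc _ ≤ c * a * (k * 1) := by gcongr
      _ = _ := by push_cast; ring
  · exact ((measurable_timeKernel _).comp (measurable_const_sub t)).mul (measurable_timeKernel _)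

/-! ### Smoothing by the heat flow. -/

theorem measurable_heatKernel : Measurable fun z : ℝ × Space d => heatKernel z.1 z.2 := by
  simp only [heatKernel, Real.fourierInv_eq']
  have h : Measurable fun w : (ℝ × Space d) × Space d =>
      Complex.exp (↑(2 * Real.pi * inner ℝ w.2 w.1.2) * Complex.I) • heatSymbol w.1.1 w.2 := by
    unfold heatSymbol
    fun_prop
  exact h.stronglyMeasurable.integral_prod_right.measurable

theorem measurable_conv_heatKernel {g : Space d → Vec d} (hg : Measurable g) :
    Measurable fun z : ℝ × Space d => conv (heatKernel z.1) g z.2 := by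
  have h0 := measurable_heatKernel (d := d)
  have h1 : Measurable fun w : (ℝ × Space d) × Space d => (w.1.1, w.1.2 - w.2) := by fun_prop
  have h2 := h0.comp h1
  have h3 : Measurable fun w : (ℝ × Space d) × Space d => heatKernel w.1.1 (w.1.2 - w.2) := h2
  have h4 := h3.smul (hg.comp (measurable_snd (α := ℝ × Space d) (β := Space d)))
  have h5 := (h4.stronglyMeasurable.integral_prod_right' (ν := volume)).measurable
  exact h5

theorem goodKernel_heatKernel {t : ℝ} (ht : 0 < t) : GoodKernel (heatKernel (d := d) t) := by
  rw [heatKernel_eq_dil ht]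
  exact goodKernel_heatKernel_one.dil 0 (Real.sqrt_pos.2 ht)

theorem lintegral_heatKernel {t : ℝ} (ht : 0 < t) :
    ∫⁻ x, ‖heatKernel (d := d) t x‖ₑ = ∫⁻ x, ‖heatKernel (d := d) 1 x‖ₑ := by
  rw [heatKernel_eq_dil ht, lintegral_enorm_dil (Real.sqrt_pos.2 ht)
    goodKernel_heatKernel_one.continuous, pow_zero, inv_one, ENNReal.ofReal_one, one_mul]

theorem exists_eLpNorm_conv_heatKernel_le (d : ℕ) {q : ℝ} (hq : 1 ≤ q) :
    ∃ A : ℝ≥0, ∀ g : Space d → Vec d, Measurable g → ∀ t, 0 < t →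
      eLpNorm (conv (heatKernel t) g) (ENNReal.ofReal q) ≤ A * eLpNorm g (ENNReal.ofReal q) := by
  refine ⟨(∫⁻ x, ‖heatKernel (d := d) 1 x‖ₑ).toNNReal, fun g hg t ht => ?_⟩
  rw [ENNReal.coe_toNNReal goodKernel_heatKernel_one.integrable.2.ne, ← lintegral_heatKernel ht]
  exact eLpNorm_conv_le hq (goodKernel_heatKernel ht).continuous.measurable hg

theorem exists_enorm_conv_heatKernel_le_of_bounded (d : ℕ) :
    ∃ A : ℝ≥0, ∀ (g : Space d → Vec d) (B : ℝ≥0∞), (∀ x, ‖g x‖ₑ ≤ B) → ∀ t, 0 < t → ∀ x,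
      ‖conv (heatKernel t) g x‖ₑ ≤ A * B := by
  refine ⟨(∫⁻ x, ‖heatKernel (d := d) 1 x‖ₑ).toNNReal, fun g B hB t ht x => ?_⟩
  rw [ENNReal.coe_toNNReal goodKernel_heatKernel_one.integrable.2.ne, ← lintegral_heatKernel ht]
  have hm : Measurable fun y => ‖heatKernel (d := d) t y‖ₑ :=
    (goodKernel_heatKernel ht).continuous.measurable.enorm
  refine (enorm_conv_le _ _ _).trans ((lintegral_mono fun y => mul_le_mul' le_rfl (hB y)).trans ?_)
  have hm' : Measurable fun y => ‖heatKernel (d := d) t (x - y)‖ₑ :=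
    hm.comp (measurable_const_sub x)
  rw [lintegral_mul_const _ hm',
    lintegral_sub_left_eq_self (fun y => ‖heatKernel (d := d) t y‖ₑ) x]

/-- Hölder between the sup norm `t^{-d/2}` and the `L¹` norm of the heat kernel gives the rate
`t^{-d/(2q)}`, no worse than `t^{-1/2}` when `d ≤ q` and `t ≤ 1`. -/
theorem exists_enorm_conv_heatKernel_le {q : ℝ} (hq : (d : ℝ) ≤ q) (hq1 : 1 ≤ q) :
    ∃ A : ℝ≥0, ∀ g : Space d → Vec d, Measurable g → ∀ t, 0 < t → t ≤ 1 → ∀ x,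
      ‖conv (heatKernel t) g x‖ₑ ≤ A * eLpNorm g (ENNReal.ofReal q) * timeKernel (1 / 2) t := by
  obtain ⟨a, ha⟩ := (goodKernel_heatKernel_one (d := d)).bounded
  have hq0 : 0 < q := by linarith
  have h0 : 0 < 1 / q := by positivity
  have h1 : 0 ≤ 1 - 1 / q := by
    have : 1 / q ≤ 1 := (div_le_one hq0).2 hq1
    linarith
  obtain ⟨A, hA⟩ : ∃ A : ℝ≥0, (A : ℝ≥0∞) =
      (a : ℝ≥0∞) ^ (1 / q) * (∫⁻ x, ‖heatKernel (d := d) 1 x‖ₑ) ^ (1 - 1 / q) :=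
    ⟨_, ENNReal.coe_toNNReal (ENNReal.mul_ne_top (ENNReal.rpow_ne_top_of_nonneg h0.le (by simp))
      (ENNReal.rpow_ne_top_of_nonneg h1 goodKernel_heatKernel_one.integrable.2.ne))⟩
  refine ⟨A, fun g hg t ht ht1 x => (enorm_conv_le _ _ _).trans ?_⟩
  have hb : ∀ y, ‖heatKernel (d := d) t y‖ₑ ≤ a * timeKernel (d / 2) t := fun y => by
    rw [heatKernel_eq_dil ht, enorm_dil (Real.sqrt_pos.2 ht), ofReal_sqrt_pow_inv ht, mul_comm]
    exact mul_le_mul' (ha _) le_rfl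
  have h := lintegral_conv_rpow_le (K := fun y => ‖heatKernel (d := d) t y‖ₑ)
    (goodKernel_heatKernel ht).continuous.measurable.enorm hg.enorm one_pos hq1 hb x
  simp only [ENNReal.rpow_one, eLpNorm_enorm] at h
  refine h.trans ?_
  rw [lintegral_heatKernel ht, ENNReal.mul_rpow_of_nonneg _ _ h0.le, timeKernel_rpow h0, hA]
  have : timeKernel (d / 2 * (1 / q)) t ≤ timeKernel (1 / 2) t := by
    refine timeKernel_mono ht1 ?_
    rw [mul_one_div, div_div, div_le_div_iff₀ (by positivity) (by norm_num)]
    linarith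
  calc _ = (a : ℝ≥0∞) ^ (1 / q) * (∫⁻ x, ‖heatKernel (d := d) 1 x‖ₑ) ^ (1 - 1 / q) *
        eLpNorm g (ENNReal.ofReal q) * timeKernel (d / 2 * (1 / q)) t := by ring
    _ ≤ _ := by gcongr

/-- When `q = d` the preceding bound is scale invariant and small times alone do not improve it.
Instead `g` is approximated in `L^q` by a bounded function: the error contributes at most half of
`ε`, and the bounded part has a bounded heat flow, negligible against `t^{-1/2}`. -/
theorem exists_enorm_conv_heatKernel_small {q : ℝ} (hq : (d : ℝ) ≤ q) (hq1 : 1 ≤ q)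
    {g : Space d → Vec d} (hg : Measurable g) (hgq : eLpNorm g (ENNReal.ofReal q) ≠ ∞)
    {ε : ℝ≥0∞} (hε : ε ≠ 0) :
    ∃ δ : ℝ, 0 < δ ∧ δ ≤ 1 ∧ ∀ t, 0 < t → t ≤ δ → ∀ x,
      ‖conv (heatKernel t) g x‖ₑ ≤ ε * timeKernel (1 / 2) t := by
  rcases eq_or_ne ε ∞ with rfl | hεt
  · refine ⟨1, one_pos, le_rfl, fun t ht ht1 x => ?_⟩
    rw [ENNReal.top_mul]
    · exact le_top
    · rw [timeKernel_of_pos ht]; simpa using by positivity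
  obtain ⟨A, hA⟩ := exists_enorm_conv_heatKernel_le hq hq1
  obtain ⟨B, hB⟩ := exists_enorm_conv_heatKernel_le_of_bounded d
  have hη : ε / 2 / (A + 1) ≠ 0 := by
    refine (ENNReal.div_pos (ENNReal.half_pos hε).ne' (by finiteness)).ne'
  obtain ⟨b, hb1, hb2⟩ := MemLp.exists_boundedContinuous_eLpNorm_sub_le (μ := volume)
    ENNReal.ofReal_ne_top ⟨hg.aestronglyMeasurable, hgq.lt_top⟩ hη
  have hbm : Measurable b := b.continuous.measurable
  obtain ⟨κ, hκ⟩ : ∃ κ : ℝ≥0, (κ : ℝ≥0∞) = ε / 2 :=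
    ⟨_, ENNReal.coe_toNNReal (ENNReal.div_ne_top hεt (by norm_num))⟩
  have hκ0 : 0 < (κ : ℝ) := by
    have : (κ : ℝ≥0∞) ≠ 0 := hκ ▸ (ENNReal.half_pos hε).ne'
    exact_mod_cast pos_iff_ne_zero.2 (by simpa using this)
  obtain ⟨M, hM⟩ : ∃ M : ℝ, M = B * ‖b‖ + 1 := ⟨_, rfl⟩
  have hM0 : 0 < M := by rw [hM]; positivity
  -- The condition `t ≤ (κ / M) ^ 2` says that `M ≤ κ / √t`, and `M` dominates the heat flow of the
  -- bounded part; the `+ 1` in `M` makes it positive.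
  refine ⟨min 1 ((κ / M) ^ 2), by positivity, min_le_left _ _, fun t ht htδ x => ?_⟩
  have ht1 : t ≤ 1 := htδ.trans (min_le_left _ _)
  have hG := goodKernel_heatKernel (d := d) ht
  have hsub : conv (heatKernel t) g x =
      conv (heatKernel t) (fun y => g y - b y) x + conv (heatKernel t) b x := by
    rw [conv, conv, conv, ← integral_add]
    · simp only [← smul_add, sub_add_cancel]
    · exact hG.integrable_smul hq1 (hg.sub hbm) (ne_top_of_le_ne_top (by
        refine ENNReal.div_ne_top (ENNReal.div_ne_top hεt (by norm_num)) (by simp)) hb1) x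
    · exact hG.integrable_smul hq1 hbm hb2.2.ne x
  rw [hsub]
  refine (enorm_add_le _ _).trans ?_
  have h1 : ‖conv (heatKernel t) (fun y => g y - b y) x‖ₑ ≤ ε / 2 * timeKernel (1 / 2) t := by
    refine (hA _ (hg.sub hbm) t ht ht1 x).trans (mul_le_mul' ?_ le_rfl)
    refine (mul_le_mul' (le_self_add (b := 1)) hb1).trans ?_
    exact ENNReal.mul_div_le
  have h2 : ‖conv (heatKernel t) b x‖ₑ ≤ ε / 2 * timeKernel (1 / 2) t := by
    refine (hB b (ENNReal.ofReal ‖b‖) (fun x => ?_) t ht x).trans ?_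
    · rw [← ofReal_norm]; exact ENNReal.ofReal_le_ofReal (b.norm_coe_le_norm x)
    · have hs : √t ≤ κ / M := by
        rw [← Real.sqrt_sq (show 0 ≤ (κ : ℝ) / M by positivity)]
        exact Real.sqrt_le_sqrt (htδ.trans (min_le_right _ _))
      rw [← hκ, timeKernel_of_pos ht, Real.rpow_neg ht.le, ← Real.sqrt_eq_rpow,
        ← ENNReal.ofReal_coe_nnreal, ← ENNReal.ofReal_coe_nnreal,
        ← ENNReal.ofReal_mul (by positivity), ← ENNReal.ofReal_mul (by positivity)]
      refine ENNReal.ofReal_le_ofReal ?_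
      have h3 : B * ‖b‖ ≤ M := by rw [hM]; linarith
      have h4 : M ≤ κ * (√t)⁻¹ := by
        rw [← div_eq_mul_inv, le_div_iff₀ (Real.sqrt_pos.2 ht), mul_comm]
        exact (le_div_iff₀ hM0).1 hs
      linarith
  calc _ ≤ ε / 2 * timeKernel (1 / 2) t + ε / 2 * timeKernel (1 / 2) t := add_le_add h1 h2
    _ = _ := by rw [← add_mul, ENNReal.add_halves]

end

/-! ### Solutions which are small in the scaling-invariant norm -/

section

variable {d : ℕ}

theorem exists_coe_eq_of_ne_top {a : ℝ≥0∞} (ha : a ≠ ∞) : ∃ b : ℝ≥0, (b : ℝ≥0∞) = a :=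
  ⟨_, ENNReal.coe_toNNReal ha⟩

theorem eventually_mul_rpow_le {K η : ℝ≥0∞} {s : ℝ} (hK : K ≠ ∞) (hs : 0 < s) (hη : η ≠ 0) :
    ∀ᶠ x in 𝓝 (0 : ℝ≥0∞), K * x ^ s ≤ η := by
  have h1 : Tendsto (fun x : ℝ≥0∞ => K * x ^ s) (𝓝 0) (𝓝 (K * 0 ^ s)) :=
    ENNReal.Tendsto.const_mul ((ENNReal.continuous_rpow_const (y := s)).tendsto 0) (Or.inr hK)
  rw [ENNReal.zero_rpow_of_pos hs, mul_zero] at h1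
  exact (h1.eventually (gt_mem_nhds (pos_iff_ne_zero.2 hη))).mono fun x hx => hx.le

theorem exists_nnreal_pos_of_eventually {P : ℝ≥0∞ → Prop} (h : ∀ᶠ x in 𝓝 0, P x) :
    ∃ ε : ℝ≥0, 0 < ε ∧ P ε := by
  have h1 : ∀ᶠ x in 𝓝[>] (0 : ℝ≥0∞), P x := h.filter_mono nhdsWithin_le_nhds
  have h2 : ∀ᶠ x in 𝓝[>] (0 : ℝ≥0∞), x < 1 :=
    (gt_mem_nhds (by simp)).filter_mono nhdsWithin_le_nhds
  obtain ⟨x, hx, hx1, hx0⟩ := (h1.and (h2.and self_mem_nhdsWithin)).exists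
  have hxt : x ≠ ∞ := (hx1.trans ENNReal.one_lt_top).ne
  refine ⟨x.toNNReal, ENNReal.toNNReal_pos (ne_of_gt hx0) hxt, ?_⟩
  rwa [ENNReal.coe_toNNReal hxt]

/-- The quadratic nonlinearity `v ⊗ v`. -/
def tensSelf (v : ℝ → Space d → Vec d) : ℝ → Space d → Fin d → Fin d → ℂ :=
  fun s y => tens (v s y) (v s y)

theorem measurable_tensSelf {v : ℝ → Space d → Vec d} (hv : Measurable (Function.uncurry v)) :
    Measurable (Function.uncurry (tensSelf v)) :=
  measurable_tens_comp hv hv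

/-- Functions with `√t ‖v(t)‖_∞ ≤ b` and `‖v(t)‖_q ≤ R`. -/
structure KatoBall (q : ℝ) (b R : ℝ≥0) (v : ℝ → Space d → Vec d) : Prop where
  measurable : Measurable (Function.uncurry v)
  bound : ∀ t x, ‖v t x‖ₑ ≤ b * timeKernel (1 / 2) t
  eLpNorm_le : ∀ t, eLpNorm (v t) (ENNReal.ofReal q) ≤ R

/-- The map whose fixed points are the mild solutions on `]0, δ]`. -/
noncomputable def katoMap (g : Space d → Vec d) (δ : ℝ) (v : ℝ → Space d → Vec d) (t : ℝ)
    (x : Space d) : Vec d :=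
  if t ∈ Ioc 0 δ then conv (heatKernel t) g x - duhamel (tensSelf v) t x else 0

theorem measurable_katoMap {g : Space d → Vec d} (hg : Measurable g) (δ : ℝ)
    {v : ℝ → Space d → Vec d} (hv : Measurable (Function.uncurry v)) :
    Measurable (Function.uncurry (katoMap g δ v)) := by
  have h1 := measurable_conv_heatKernel hg
  have h2 := measurable_uncurry_duhamel (measurable_tensSelf hv)
  have hs : MeasurableSet {z : ℝ × Space d | z.1 ∈ Ioc 0 δ} := measurable_fst measurableSet_Ioc
  exact Measurable.ite hs (h1.sub h2) measurable_const

variable {q r : ℝ}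

theorem KatoBall.measurable_apply {b R : ℝ≥0} {v : ℝ → Space d → Vec d} (hv : KatoBall q b R v)
    (t : ℝ) : Measurable (v t) := hv.measurable.of_uncurry_left

/-- The estimates behind the fixed point: stability of the weighted sup norm, stability of the `L^q`
norm, and a Lipschitz bound in the weighted sup norm. For fixed `R`, each of the three gains a
positive power of `b`. -/
theorem exists_enorm_duhamel_tensSelf_le (hq : (d : ℝ) ≤ q) (hq1 : 1 ≤ q) (hr0 : 0 < r)
    (hr1 : r < 1) :
    ∃ C : ℝ≥0, ∀ (b R : ℝ≥0) (v : ℝ → Space d → Vec d), KatoBall q b R v →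
      (∀ t ≤ 1, ∀ x, absDuhamel (fun s y => ‖tensSelf v s y‖ₑ) t x ≤
        C * (b * ((R : ℝ≥0∞) ^ r * (b : ℝ≥0∞) ^ (1 - r))) * timeKernel (1 / 2) t) ∧
      (∀ t, eLpNorm (duhamel (tensSelf v) t) (ENNReal.ofReal q) ≤ C * (b * R)) ∧
      ∀ w, KatoBall q b R w → ∀ γ : ℝ≥0∞,
        (∀ t x, ‖v t x - w t x‖ₑ ≤ γ * timeKernel (1 / 2) t) → ∀ t ≤ 1, ∀ x,
        ‖duhamel (tensSelf v) t x - duhamel (tensSelf w) t x‖ₑ ≤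
          C * (γ * (((2 * R : ℝ≥0) : ℝ≥0∞) ^ r * ((2 * b : ℝ≥0) : ℝ≥0∞) ^ (1 - r))) *
            timeKernel (1 / 2) t := by
  obtain ⟨C₁, hC₁⟩ := exists_absDuhamel_le (d := d) hq hq1 hr0 hr1
  obtain ⟨C₂, hC₂⟩ := exists_eLpNorm_duhamel_le d hq1
  have hq0 : 0 < q := by linarith
  have habs : ∀ {b R : ℝ≥0} {v : ℝ → Space d → Vec d}, KatoBall q b R v → ∀ t ≤ 1, ∀ x,
      absDuhamel (fun s y => ‖tensSelf v s y‖ₑ) t x ≤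
        C₁ * (b * ((R : ℝ≥0∞) ^ r * (b : ℝ≥0∞) ^ (1 - r))) * timeKernel (1 / 2) t :=
    fun {b R v} hv => by
      refine hC₁ _ (fun s y => ‖v s y‖ₑ) b b R (fun s => (hv.measurable_apply s).enorm)
        (fun s y => ?_) hv.bound (fun s => ?_)
      · exact (enorm_tens_le _ _).trans (mul_le_mul' (hv.bound s y) le_rfl)
      · rw [eLpNorm_enorm]; exact hv.eLpNorm_le s
  have hle : (C₁ : ℝ≥0∞) ≤ ((C₁ + C₂ : ℝ≥0) : ℝ≥0∞) := by push_cast; exact le_self_add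
  have hle' : (C₂ : ℝ≥0∞) ≤ ((C₁ + C₂ : ℝ≥0) : ℝ≥0∞) := by push_cast; exact le_add_self
  refine ⟨C₁ + C₂, fun b R v hv => ⟨fun t ht x => ?_, fun t => ?_, fun w hw γ hγ t ht x => ?_⟩⟩
  · refine (habs hv t ht x).trans ?_
    gcongr
  · refine (hC₂ (tensSelf v) (b * R) (measurable_tensSelf hv.measurable) (fun s => ?_) t).trans
      (mul_le_mul' hle' le_rfl)
    refine (eLpNorm_le_const_mul (c := b * timeKernel (1 / 2) s) hq0 (hv.measurable_apply s)
      (Eventually.of_forall fun y => ?_)).trans ?_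
    · exact (enorm_tens_le _ _).trans (mul_le_mul' (hv.bound s y) le_rfl)
    · rw [mul_right_comm]
      exact mul_le_mul' (mul_le_mul' le_rfl (hv.eLpNorm_le s)) le_rfl
  · have hfin : ∀ {v : ℝ → Space d → Vec d}, KatoBall q b R v →
        absDuhamel (fun s y => ‖tensSelf v s y‖ₑ) t x ≠ ∞ := fun {v} hv => by
      refine ne_top_of_le_ne_top (ENNReal.mul_ne_top (ENNReal.mul_ne_top (by simp)
        (ENNReal.mul_ne_top (by simp) (ENNReal.mul_ne_top ?_ ?_))) (timeKernel_ne_top _ _))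
        (habs hv t ht x)
      · exact ENNReal.rpow_ne_top_of_nonneg hr0.le (by simp)
      · exact ENNReal.rpow_ne_top_of_nonneg (by linarith) (by simp)
    have hmv := measurable_tensSelf hv.measurable
    have hmw := measurable_tensSelf hw.measurable
    rw [duhamel_sub hmv hmw (hfin hv) (hfin hw)]
    have hmd : Measurable (Function.uncurry fun s y => tensSelf v s y - tensSelf w s y) :=
      hmv.sub hmw
    refine (enorm_duhamel_le hmd t x).trans ((hC₁ _ (fun s y => ‖v s y‖ₑ + ‖w s y‖ₑ) γ
      (2 * b : ℝ≥0) (2 * R : ℝ≥0) (fun s => (hv.measurable_apply s).enorm.add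
        (hw.measurable_apply s).enorm) (fun s y => ?_) (fun s y => ?_) (fun s => ?_) t ht x).trans ?_)
    · refine (enorm_tens_self_sub_le _ _).trans ?_
      rw [mul_comm]
      exact mul_le_mul' (hγ s y) le_rfl
    · refine (add_le_add (hv.bound s y) (hw.bound s y)).trans (le_of_eq ?_)
      push_cast; ring
    · have := eLpNorm_add_le (μ := volume) (hv.measurable_apply s).enorm.aestronglyMeasurable
        (hw.measurable_apply s).enorm.aestronglyMeasurable (one_le_ofReal hq1)
      refine this.trans ?_
      rw [eLpNorm_enorm, eLpNorm_enorm]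
      refine (add_le_add (hv.eLpNorm_le s) (hw.eLpNorm_le s)).trans (le_of_eq ?_)
      push_cast; ring
    · gcongr

/-- Existence of a mild solution with small `√t ‖v(t)‖_∞` on a short time interval. -/
theorem exists_katoSolution (hq : (d : ℝ) ≤ q) (hq1 : 1 ≤ q) {g : Space d → Vec d}
    (hg : Measurable g) (hgq : eLpNorm g (ENNReal.ofReal q) ≠ ∞) :
    ∃ R : ℝ≥0, ∀ η : ℝ≥0∞, η ≠ 0 → ∃ δ : ℝ, 0 < δ ∧ δ ≤ 1 ∧ ∃ (b : ℝ≥0)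
      (v : ℝ → Space d → Vec d), (b : ℝ≥0∞) ≤ η ∧ KatoBall q b R v ∧
      ∀ t, 0 < t → t ≤ δ → ∀ x,
        v t x = conv (heatKernel t) g x - duhamel (tensSelf v) t x := by
  -- Here `1 / 2` is only an interpolation parameter, for which any value in `]0, 1[` would serve;
  -- it is independent of the Besov regularity in the uniqueness statement.
  obtain ⟨C, hC⟩ := exists_enorm_duhamel_tensSelf_le (r := 1 / 2) hq hq1 (by norm_num)
    (by norm_num)
  obtain ⟨A, hA⟩ := exists_eLpNorm_conv_heatKernel_le d hq1
  obtain ⟨G, hG⟩ := exists_coe_eq_of_ne_top hgq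
  -- Twice the bound for the heat flow, so that half is left for the Duhamel term. It is fixed
  -- before `η`, which allows the smallness asked of `b` to depend on `R`.
  obtain ⟨R, hR⟩ : ∃ R : ℝ≥0, R = 2 * (A * G) := ⟨_, rfl⟩
  refine ⟨R, fun η hη => ?_⟩
  have hK : (C : ℝ≥0∞) * (((2 * R : ℝ≥0) : ℝ≥0∞) ^ (1 / 2 : ℝ) * 4 ^ (1 / 2 : ℝ)) ≠ ∞ :=
    ENNReal.mul_ne_top ENNReal.coe_ne_top (ENNReal.mul_ne_top
      (ENNReal.rpow_ne_top_of_nonneg (by norm_num) ENNReal.coe_ne_top)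
      (ENNReal.rpow_ne_top_of_nonneg (by norm_num) (by simp)))
  -- With `b = 2 ε` the three conditions say that `b ≤ η`, that the map contracts by `1/2` (the `4`
  -- is `2 b / ε`), and that the Duhamel term takes at most `R / 2` in `L^q`.
  obtain ⟨ε, hε0, ⟨hε1, hε2⟩, hε3⟩ := exists_nnreal_pos_of_eventually
    (((eventually_mul_rpow_le (K := 2) (s := 1) (by simp) one_pos hη).and
      (eventually_mul_rpow_le hK (s := 1 / 2) (η := 1 / 2) (by norm_num) (by simp))).and
      (eventually_mul_rpow_le (K := C * 2) (s := 1) (η := 1 / 2) (by finiteness) one_pos (by simp)))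
  rw [ENNReal.rpow_one] at hε1 hε3
  obtain ⟨δ, hδ0, hδ1, hδ⟩ := exists_enorm_conv_heatKernel_small hq hq1 hg hgq
    (ε := ε) (by simpa using hε0.ne')
  obtain ⟨b, hb⟩ : ∃ b : ℝ≥0, b = 2 * ε := ⟨_, rfl⟩
  have hb' : (b : ℝ≥0∞) = 2 * ε := by rw [hb]; push_cast; rfl
  have hsmall : (C : ℝ≥0∞) * (((2 * R : ℝ≥0) : ℝ≥0∞) ^ (1 / 2 : ℝ) *
      ((2 * b : ℝ≥0) : ℝ≥0∞) ^ (1 - 1 / 2 : ℝ)) ≤ 1 / 2 := by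
    refine le_trans (le_of_eq ?_) hε2
    have : ((2 * b : ℝ≥0) : ℝ≥0∞) = 4 * ε := by rw [hb]; push_cast; ring
    rw [this, show (1 - 1 / 2 : ℝ) = 1 / 2 by norm_num,
      ENNReal.mul_rpow_of_nonneg _ _ (by norm_num)]
    ring
  have htk : ∀ {t : ℝ}, ∀ γ : ℝ≥0∞, (C : ℝ≥0∞) * (γ * (((2 * R : ℝ≥0) : ℝ≥0∞) ^ (1 / 2 : ℝ) *
      ((2 * b : ℝ≥0) : ℝ≥0∞) ^ (1 - 1 / 2 : ℝ))) * timeKernel (1 / 2) t ≤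
      γ / 2 * timeKernel (1 / 2) t := fun {t} γ => by
    refine mul_le_mul' ?_ le_rfl
    rw [mul_left_comm]
    refine (mul_le_mul' le_rfl hsmall).trans (le_of_eq ?_)
    rw [one_div, ENNReal.div_eq_inv_mul, mul_comm]
  have hmap : ∀ v, KatoBall q b R v → KatoBall q b R (katoMap g δ v) := fun v hv => by
    obtain ⟨h1, h2, -⟩ := hC b R v hv
    refine ⟨measurable_katoMap hg δ hv.measurable, fun t x => ?_, fun t => ?_⟩
    · unfold katoMap
      split_ifs with ht
      · have ht1 : t ≤ 1 := ht.2.trans hδ1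
        have h3 : ‖duhamel (tensSelf v) t x‖ₑ ≤ b / 2 * timeKernel (1 / 2) t := by
          refine (enorm_duhamel_le (measurable_tensSelf hv.measurable) t x).trans
            ((h1 t ht1 x).trans (le_trans ?_ (htk b)))
          have e1 : (R : ℝ≥0∞) ≤ ((2 * R : ℝ≥0) : ℝ≥0∞) := by
            push_cast; exact le_mul_of_one_le_left zero_le (by norm_num)
          have e2 : (b : ℝ≥0∞) ≤ ((2 * b : ℝ≥0) : ℝ≥0∞) := by
            push_cast; exact le_mul_of_one_le_left zero_le (by norm_num)
          gcongr
        refine enorm_sub_le.trans ((add_le_add (hδ t ht.1 ht.2 x) h3).trans (le_of_eq ?_))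
        rw [hb', mul_comm 2 (ε : ℝ≥0∞), ENNReal.mul_div_cancel_right (by simp) (by simp)]
        ring
      · simp
    · by_cases ht : t ∈ Ioc 0 δ
      · have e : katoMap g δ v t = conv (heatKernel t) g - duhamel (tensSelf v) t := by
          ext1 x; rw [katoMap, if_pos ht]; rfl
        have hm1 : Measurable (conv (heatKernel t) g) :=
          measurable_conv (goodKernel_heatKernel ht.1).continuous.measurable hg
        have hm2 : Measurable (duhamel (tensSelf v) t) :=
          (measurable_uncurry_duhamel (measurable_tensSelf hv.measurable)).of_uncurry_left
        rw [e]
        refine (eLpNorm_sub_le hm1.aestronglyMeasurable hm2.aestronglyMeasurable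
          (one_le_ofReal hq1)).trans ((add_le_add (hA g hg t ht.1) (h2 t)).trans ?_)
        rw [← hG, hb', ← mul_assoc, ← mul_assoc]
        refine (add_le_add le_rfl (mul_le_mul' hε3 le_rfl)).trans (le_of_eq ?_)
        rw [hR]; push_cast
        rw [← mul_assoc (1 / 2 : ℝ≥0∞), one_div, ENNReal.inv_mul_cancel (by simp) (by simp)]
        ring
      · have e : katoMap g δ v t = 0 := by ext1 x; rw [katoMap, if_neg ht]; rfl
        rw [e, eLpNorm_zero]; exact zero_le
  have hcontr : ∀ v w, KatoBall q b R v → KatoBall q b R w → ∀ γ : ℝ≥0∞,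
      (∀ t x, ‖v t x - w t x‖ₑ ≤ γ * timeKernel (1 / 2) t) → ∀ t x,
      ‖katoMap g δ v t x - katoMap g δ w t x‖ₑ ≤ γ / 2 * timeKernel (1 / 2) t := by
    intro v w hv hw γ hγ t x
    unfold katoMap
    split_ifs with ht
    · rw [sub_sub_sub_cancel_left, ← enorm_neg, neg_sub]
      exact ((hC b R v hv).2.2 w hw γ hγ t (ht.2.trans hδ1) x).trans (htk γ)
    · simp
  obtain ⟨u, hu⟩ : ∃ u : ℕ → ℝ → Space d → Vec d, u = fun n => (katoMap g δ)^[n] 0 := ⟨_, rfl⟩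
  have hu0 : u 0 = 0 := by rw [hu]; rfl
  have hus : ∀ n, u (n + 1) = katoMap g δ (u n) := fun n => by
    rw [hu]; exact Function.iterate_succ_apply' _ _ _
  have hball : ∀ n, KatoBall q b R (u n) := fun n => by
    induction n with
    | zero =>
      rw [hu0]
      refine ⟨measurable_const, fun t x => by simp, fun t => ?_⟩
      exact (eLpNorm_zero (α := Space d) (ε := Vec d)).le.trans zero_le
    | succ n ih => rw [hus]; exact hmap _ ih
  have hinc : ∀ n t x, ‖u n t x - u (n + 1) t x‖ₑ ≤ b / 2 ^ n * timeKernel (1 / 2) t := fun n => by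
    induction n with
    | zero =>
      intro t x
      rw [hu0, Pi.zero_apply, Pi.zero_apply, zero_sub, enorm_neg, pow_zero, div_one]
      exact (hball 1).bound t x
    | succ n ih =>
      intro t x
      have h := hcontr _ _ (hball n) (hball (n + 1)) _ ih t x
      rw [← hus, ← hus] at h
      refine h.trans (le_of_eq ?_)
      simp only [div_eq_mul_inv, ENNReal.inv_pow]
      ring
  have hedist : ∀ t x n, edist (u n t x) (u (n + 1) t x) ≤ b * timeKernel (1 / 2) t / 2 ^ n :=
    fun t x n => by
      rw [edist_eq_enorm_sub]
      refine (hinc n t x).trans (le_of_eq ?_)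
      simp only [div_eq_mul_inv, ENNReal.inv_pow]; ring
  have hlim : ∀ t x, ∃ a, Tendsto (fun n => u n t x) atTop (𝓝 a) := fun t x =>
    cauchySeq_tendsto_of_complete (cauchySeq_of_edist_le_geometric_two _
      (ENNReal.mul_ne_top (by simp) (timeKernel_ne_top (1 / 2) t)) (hedist t x))
  choose v hv using hlim
  have hvm : Measurable (Function.uncurry v) :=
    measurable_of_tendsto_metrizable (fun n => (hball n).measurable)
      (tendsto_pi_nhds.2 fun z => hv z.1 z.2)
  have hvball : KatoBall q b R v := by
    refine ⟨hvm, fun t x => ?_, fun t => ?_⟩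
    · exact le_of_tendsto ((continuous_enorm.tendsto _).comp (hv t x))
        (Eventually.of_forall fun n => (hball n).bound t x)
    · exact Lp.eLpNorm_le_of_ae_tendsto (u := atTop) (f := fun n => u n t)
        (Eventually.of_forall fun n => (hball n).eLpNorm_le t)
        (fun n => ((hball n).measurable_apply t).aestronglyMeasurable)
        (Eventually.of_forall fun x => hv t x)
  have hrate : ∀ n t x, ‖u n t x - v t x‖ₑ ≤ (2 * b / 2 ^ n) * timeKernel (1 / 2) t := fun n t x => by
    rw [← edist_eq_enorm_sub]
    refine (edist_le_of_edist_le_geometric_two_of_tendsto _ (hedist t x) (hv t x) n).trans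
      (le_of_eq ?_)
    simp only [div_eq_mul_inv, ENNReal.inv_pow]; ring
  refine ⟨δ, hδ0, hδ1, b, v, hb' ▸ hε1, hvball, fun t ht htδ x => ?_⟩
  have hfix : katoMap g δ v t x = v t x := by
    refine tendsto_nhds_unique (f := fun n => u (n + 1) t x) (l := atTop) ?_
      ((tendsto_add_atTop_iff_nat 1).2 (hv t x))
    rw [tendsto_iff_edist_tendsto_0]
    have h0 : Tendsto (fun n : ℕ => (2 * b / 2 ^ n / 2 : ℝ≥0∞) * timeKernel (1 / 2) t) atTop (𝓝 0) := by
      have h1 : Tendsto (fun n : ℕ => (2⁻¹ : ℝ≥0∞) ^ n * (2 * b * 2⁻¹ * timeKernel (1 / 2) t)) atTop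
          (𝓝 (0 * (2 * b * 2⁻¹ * timeKernel (1 / 2) t))) := by
        refine ENNReal.Tendsto.mul_const (ENNReal.tendsto_pow_atTop_nhds_zero_of_lt_one
          (by simp)) (Or.inr ?_)
        have := timeKernel_ne_top (1 / 2) t
        finiteness
      rw [zero_mul] at h1
      refine h1.congr fun n => ?_
      simp only [div_eq_mul_inv, ENNReal.inv_pow]; ring
    refine tendsto_of_tendsto_of_tendsto_of_le_of_le tendsto_const_nhds h0 (fun _ => zero_le)
      fun n => ?_
    rw [edist_eq_enorm_sub, hus]
    exact hcontr _ _ (hball n) hvball _ (hrate n) t x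
  rw [← hfix, katoMap, if_pos ⟨ht, htδ⟩]

end

/-! ### Smoothing and the Oseen integral -/

section

variable {d : ℕ} {q r : ℝ}

/-- The same interpolation as for the Oseen kernel, now with a mollifier at scale `2 ^ (-j)`. It is
meant for `v`, whose low frequencies thereby obey a Besov bound of regularity `-r` with constant of
order `R ^ r * b ^ (1 - r) * s^{-(1-r)/2}`. -/
theorem exists_enorm_smooth_le {ψ : Space d → ℂ} (hψ : GoodKernel ψ) (hq : (d : ℝ) ≤ q)
    (hq1 : 1 ≤ q) (hr0 : 0 < r) (hr1 : r < 1) :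
    ∃ C : ℝ≥0, ∀ (f : Space d → Vec d) (R β : ℝ≥0∞), Measurable f → (∀ y, ‖f y‖ₑ ≤ β) →
      eLpNorm f (ENNReal.ofReal q) ≤ R → ∀ (j : ℕ) (x : Space d),
      ‖smooth ψ j f x‖ₑ ≤ 2 ^ (r * j) * (C * (R ^ r * β ^ (1 - r))) := by
  obtain ⟨a, ha⟩ := hψ.bounded
  obtain ⟨b, hb⟩ := exists_coe_eq_of_ne_top hψ.integrable.2.ne
  have hq0 : 0 < q := by linarith
  have hrq : r ≤ q := by linarith
  have h0 : 0 < r / q := by positivity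
  have h1 : 0 < 1 - r / q := by
    have : r / q < 1 := (div_lt_one hq0).2 (by linarith)
    linarith
  obtain ⟨C, hC⟩ : ∃ C : ℝ≥0, (C : ℝ≥0∞) = (a : ℝ≥0∞) ^ (r / q) * (b : ℝ≥0∞) ^ (1 - r / q) :=
    exists_coe_eq_of_ne_top (ENNReal.mul_ne_top
      (ENNReal.rpow_ne_top_of_nonneg h0.le ENNReal.coe_ne_top)
      (ENNReal.rpow_ne_top_of_nonneg h1.le ENNReal.coe_ne_top))
  refine ⟨C, fun f R β hf hβ hR j x => ?_⟩
  have hl : (0 : ℝ) < ((2 : ℝ) ^ j)⁻¹ := by positivity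
  have hK : Measurable fun y => ‖dil 0 ((2 : ℝ) ^ j)⁻¹ ψ y‖ₑ :=
    (hψ.dil 0 hl).continuous.measurable.enorm
  have e1 : ∀ y, ‖dil 0 ((2 : ℝ) ^ j)⁻¹ ψ y‖ₑ ≤ 2 ^ ((d : ℝ) * j) * a := fun y => by
    rw [enorm_dil hl]
    refine mul_le_mul' (le_of_eq ?_) (ha _)
    rw [add_zero, inv_pow, inv_inv, show (2 : ℝ≥0∞) = ENNReal.ofReal 2 by simp,
      ENNReal.ofReal_rpow_of_pos (by norm_num)]
    congr 1
    rw [← pow_mul, mul_comm (d : ℝ), ← Nat.cast_mul, Real.rpow_natCast]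
  have e2 : ∫⁻ y, ‖dil 0 ((2 : ℝ) ^ j)⁻¹ ψ y‖ₑ = b := by
    rw [lintegral_enorm_dil hl hψ.continuous, pow_zero, inv_one, ENNReal.ofReal_one, one_mul, hb]
  have e3 : ((2 : ℝ≥0∞) ^ ((d : ℝ) * j)) ^ (r / q) ≤ 2 ^ (r * j) := by
    rw [← ENNReal.rpow_mul]
    refine ENNReal.rpow_le_rpow_of_exponent_le (by norm_num) ?_
    rw [mul_div_assoc', div_le_iff₀ hq0]
    have : (d : ℝ) * (r * j) ≤ q * (r * j) := mul_le_mul_of_nonneg_right hq (by positivity)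
    linarith
  calc ‖smooth ψ j f x‖ₑ
      ≤ ∫⁻ y, ‖dil 0 ((2 : ℝ) ^ j)⁻¹ ψ (x - y)‖ₑ * ‖f y‖ₑ := enorm_conv_le _ _ _
    _ ≤ ∫⁻ y, (‖dil 0 ((2 : ℝ) ^ j)⁻¹ ψ (x - y)‖ₑ * ‖f y‖ₑ ^ r) * β ^ (1 - r) := by
        refine lintegral_mono fun y => ?_
        rw [mul_assoc]
        refine mul_le_mul' le_rfl ?_
        calc ‖f y‖ₑ = ‖f y‖ₑ ^ r * ‖f y‖ₑ ^ (1 - r) := by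
              rw [← ENNReal.rpow_add_of_nonneg _ _ hr0.le (by linarith), add_sub_cancel,
                ENNReal.rpow_one]
          _ ≤ _ := mul_le_mul' le_rfl (ENNReal.rpow_le_rpow (hβ y) (by linarith))
    _ = (∫⁻ y, ‖dil 0 ((2 : ℝ) ^ j)⁻¹ ψ (x - y)‖ₑ * ‖f y‖ₑ ^ r) * β ^ (1 - r) :=
        lintegral_mul_const _ ((hK.comp (measurable_const_sub x)).mul (hf.enorm.pow_const _))
    _ ≤ ((2 ^ ((d : ℝ) * j) * a) ^ (r / q) * (b : ℝ≥0∞) ^ (1 - r / q) * R ^ r) * β ^ (1 - r) := by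
        refine mul_le_mul' ((lintegral_conv_rpow_le hK hf.enorm hr0 hrq e1 x).trans ?_) le_rfl
        rw [e2, eLpNorm_enorm]
        gcongr
    _ = (2 ^ ((d : ℝ) * j)) ^ (r / q) * (C * (R ^ r * β ^ (1 - r))) := by
        rw [ENNReal.mul_rpow_of_nonneg _ _ h0.le, hC]
        ring
    _ ≤ _ := by gcongr

theorem GoodKernel.smooth_sub {ψ : Space d → ℂ} (hψ : GoodKernel ψ) {p : ℝ} (hp : 1 ≤ p)
    {f g : Space d → Vec d} (hf : Measurable f) (hfp : eLpNorm f (ENNReal.ofReal p) ≠ ∞)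
    (hg : Measurable g) (hgp : eLpNorm g (ENNReal.ofReal p) ≠ ∞) (j : ℕ) (x : Space d) :
    smooth ψ j (fun y => f y - g y) x = smooth ψ j f x - smooth ψ j g x := by
  have hl : (0 : ℝ) < ((2 : ℝ) ^ j)⁻¹ := by positivity
  have h1 := (hψ.dil 0 hl).integrable_smul hp hf hfp x
  have h2 := (hψ.dil 0 hl).integrable_smul hp hg hgp x
  simp only [smooth, conv, smul_sub]
  exact integral_sub h1 h2

theorem eLpNorm_tens_self_le (hq : 0 < q) (f : Space d → Vec d) :
    eLpNorm (fun x => tens (f x) (f x)) (ENNReal.ofReal (q / 2)) ≤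
      eLpNorm f (ENNReal.ofReal q) ^ (2 : ℝ) := by
  rw [eLpNorm_ofReal (by positivity), eLpNorm_ofReal hq, ← ENNReal.rpow_mul,
    show 1 / (q / 2) = 1 / q * 2 by field_simp]
  refine ENNReal.rpow_le_rpow (lintegral_mono fun x => ?_) (by positivity)
  refine (ENNReal.rpow_le_rpow (enorm_tens_le _ _) (by positivity)).trans (le_of_eq ?_)
  rw [← sq, ← ENNReal.rpow_natCast, ← ENNReal.rpow_mul]
  congr 1; push_cast; ring

/-- The Oseen integral depends only on almost everywhere classes in space and on almost every
earlier time. This permits changing representatives, and in the end turns agreement at almost every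
time into agreement at every time. -/
theorem oseenIntegral_congr {F G : ℝ → Space d → Fin d → Fin d → ℂ} {t : ℝ} (ht : 0 ≤ t)
    (h : ∀ᵐ s ∂volume.restrict (Ioc 0 t), F s =ᵐ[volume] G s) (φ : 𝓢(Space d, ℂ)) :
    oseenIntegral F t φ = oseenIntegral G t φ := by
  rw [oseenIntegral, oseenIntegral, intervalIntegral.integral_of_le ht,
    intervalIntegral.integral_of_le ht]
  congr 1
  refine integral_congr_ae ?_
  filter_upwards [h] with s hs
  simp only [heatLerayDiv_congr hs]

theorem exists_lintegral_enorm_schwartz_mul_le (φ : 𝓢(Space d, ℂ)) {p : ℝ} (hp : 1 ≤ p) :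
    ∃ c : ℝ≥0, ∀ g : Space d → ℝ≥0∞, Measurable g →
      ∫⁻ x, ‖φ x‖ₑ * g x ≤ c * eLpNorm g (ENNReal.ofReal p) := by
  have hφ := goodKernel_of_schwartz φ
  obtain ⟨a, ha⟩ := hφ.bounded
  have hp0 : 0 < p := by linarith
  have h1 : 1 / p ≤ 1 := (div_le_one hp0).2 hp
  have hm : Measurable fun y => ‖φ (-y)‖ₑ :=
    (hφ.continuous.measurable.comp measurable_neg).enorm
  have hI : ∫⁻ y, ‖φ (-y)‖ₑ = ∫⁻ y, ‖φ y‖ₑ := lintegral_neg_eq_self (fun y => ‖φ y‖ₑ)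
  obtain ⟨c, hc⟩ := exists_coe_eq_of_ne_top
    (a := (a : ℝ≥0∞) ^ (1 / p) * (∫⁻ y, ‖φ (-y)‖ₑ) ^ (1 - 1 / p)) (ENNReal.mul_ne_top
      (ENNReal.rpow_ne_top_of_nonneg (by positivity) ENNReal.coe_ne_top)
      (ENNReal.rpow_ne_top_of_nonneg (by linarith) (by rw [hI]; exact hφ.integrable.2.ne)))
  refine ⟨c, fun g hg => ?_⟩
  have h := lintegral_conv_rpow_le hm hg one_pos hp (fun x => ha (-x)) 0
  simp only [ENNReal.rpow_one, zero_sub, neg_neg] at h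
  rw [hc]
  exact h

theorem integrable_smul_of_lintegral_eLpNorm {G : ℝ → Space d → Vec d}
    (hG : Measurable (Function.uncurry G)) {p : ℝ} (hp : 1 ≤ p) {μ : Measure ℝ} [SFinite μ]
    (h : ∫⁻ s, eLpNorm (G s) (ENNReal.ofReal p) ∂μ ≠ ∞) (φ : 𝓢(Space d, ℂ)) :
    Integrable (Function.uncurry fun s x => φ x • G s x) (μ.prod volume) := by
  have hφm : Measurable fun w : ℝ × Space d => φ w.2 :=
    Measurable.fun_comp φ.continuous.measurable measurable_snd
  have h2 : Measurable (Function.uncurry fun s x => φ x • G s x) := hφm.smul hG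
  obtain ⟨c, hc⟩ := exists_lintegral_enorm_schwartz_mul_le φ hp
  refine ⟨h2.aestronglyMeasurable, ?_⟩
  rw [hasFiniteIntegral_iff_enorm, lintegral_prod _ h2.enorm.aemeasurable]
  refine lt_of_le_of_lt (b := ∫⁻ s, c * eLpNorm (G s) (ENNReal.ofReal p) ∂μ)
    (lintegral_mono fun s => ?_) ?_
  · have hs : Measurable (G s) := hG.of_uncurry_left
    have h3 := hc _ hs.enorm
    rw [eLpNorm_enorm] at h3
    simpa only [Function.uncurry_apply_pair, enorm_smul] using h3
  · rw [lintegral_const_mul' _ _ ENNReal.coe_ne_top]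
    exact ENNReal.mul_lt_top ENNReal.coe_lt_top h.lt_top

theorem measurable_uncurry_heatLerayDiv_sub {F : ℝ → Space d → Fin d → Fin d → ℂ}
    (hF : Measurable (Function.uncurry F)) (t : ℝ) :
    Measurable (Function.uncurry fun s x => heatLerayDiv (t - s) (F s) x) := by
  refine measurable_heatLerayDiv (α := ℝ × Space d) (τ := fun w => t - w.1)
    (x := fun w => w.2) (F := fun w => F w.1) (by fun_prop) (by fun_prop) ?_
  have h3 : Measurable fun z : (ℝ × Space d) × Space d => (z.1.1, z.2) := by fun_prop
  have h4 := hF.comp h3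
  exact h4

/-- The Duhamel term represents the Oseen integral. -/
theorem integrable_and_oseenIntegral_eq {F : ℝ → Space d → Fin d → Fin d → ℂ}
    (hF : Measurable (Function.uncurry F)) {p : ℝ} (hp : 1 ≤ p) {t : ℝ} (ht : 0 ≤ t)
    (h : ∫⁻ s in Ioc 0 t, eLpNorm (heatLerayDiv (t - s) (F s)) (ENNReal.ofReal p) ≠ ∞)
    (φ : 𝓢(Space d, ℂ)) :
    Integrable (fun x => φ x • duhamel F t x) ∧
      oseenIntegral F t φ = -∫ x, φ x • duhamel F t x := by
  have hint := integrable_smul_of_lintegral_eLpNorm (measurable_uncurry_heatLerayDiv_sub hF t) hp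
    h φ
  have e : ∀ x, φ x • duhamel F t x = ∫ s in Ioc 0 t, φ x • heatLerayDiv (t - s) (F s) x :=
    fun x => (integral_smul _ _).symm
  simp_rw [e]
  have h1 := hint.integral_prod_right
  refine ⟨h1, ?_⟩
  rw [oseenIntegral, intervalIntegral.integral_of_le ht]
  have h2 := integral_integral_swap hint
  rw [h2]

end

/-! ### Bounds for mild solutions -/

section

variable {d : ℕ} {T q r : ℝ}

theorem ae_ne_top_of_lintegral_rpow {α : Type*} [MeasurableSpace α] {μ : Measure α}
    {A : α → ℝ≥0∞} (hA : Measurable A) {e : ℝ} (he : 0 < e) (h : ∫⁻ t, A t ^ e ∂μ ≠ ∞) :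
    ∀ᵐ t ∂μ, A t ≠ ∞ := by
  filter_upwards [ae_lt_top (hA.pow_const e) h] with t ht hAt
  rw [hAt, ENNReal.top_rpow_of_pos he] at ht
  exact lt_irrefl _ ht

theorem lintegral_indicator_rpow {S : Set ℝ} (hS : MeasurableSet S) (f : ℝ → ℝ≥0∞) {e : ℝ}
    (he : 0 < e) : ∫⁻ s, S.indicator f s ^ e = ∫⁻ s in S, f s ^ e := by
  rw [← lintegral_indicator hS]
  refine lintegral_congr fun s => ?_
  by_cases hs : s ∈ S
  · rw [indicator_of_mem hs, indicator_of_mem hs]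
  · rw [indicator_of_notMem hs, indicator_of_notMem hs, ENNReal.zero_rpow_of_pos he]

theorem MemLpTime.exists_measurable {p : ℝ≥0∞} {N : 𝓢'(Space d, Vec d) → ℝ≥0∞}
    {u : ℝ → 𝓢'(Space d, Vec d)} (h : MemLpTime T p N u) {e : ℝ} (he : 0 < e)
    (hep : ENNReal.ofReal e ≤ p) :
    ∃ A : ℝ → ℝ≥0∞, Measurable A ∧ (∀ᵐ t ∂volume.restrict (Icc 0 T), N (u t) = A t) ∧
      (∀ᵐ t ∂volume.restrict (Icc 0 T), A t ≠ ∞) ∧ ∫⁻ t in Icc 0 T, A t ^ e ≠ ∞ := by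
  have h1 : MemLp (fun t => N (u t)) (ENNReal.ofReal e) (volume.restrict (Icc 0 T)) :=
    MemLp.mono_exponent h hep
  obtain ⟨A, hA, hAe⟩ := h1.1
  have h2 : eLpNorm A (ENNReal.ofReal e) (volume.restrict (Icc 0 T)) < ∞ :=
    (eLpNorm_congr_ae hAe).symm.trans_lt h1.2
  have h3 : ∫⁻ t in Icc 0 T, A t ^ e ≠ ∞ := by
    have := lintegral_rpow_enorm_lt_top_of_eLpNorm_lt_top (by simpa using he) (by simp) h2
    rw [ENNReal.toReal_ofReal he.le] at this
    exact this.ne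
  exact ⟨A, hA.measurable, hAe, ae_ne_top_of_lintegral_rpow hA.measurable he h3, h3⟩

/-- Bounds for a function of time and space: the norm in `L^q` at time `t` is at most `A t`, and the
low frequencies satisfy a Besov estimate with constant `m t`. -/
structure BoundedBy (ψ : Space d → ℂ) (r q : ℝ) (A m : ℝ → ℝ≥0∞) (U : ℝ → Space d → Vec d) :
    Prop where
  measurable : Measurable (Function.uncurry U)
  measurable_left : Measurable A
  measurable_right : Measurable m
  left_ne_top : ∀ t, A t ≠ ∞
  right_ne_top : ∀ t, m t ≠ ∞
  lintegral_left : ∫⁻ t, A t ^ (4 / (1 + r)) ≠ ∞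
  lintegral_right : ∫⁻ t, m t ^ (2 / (1 - r)) ≠ ∞
  eLpNorm_le : ∀ t, eLpNorm (U t) (ENNReal.ofReal q) ≤ A t
  smooth_le : ∀ t (j : ℕ), ∀ᵐ x, ‖smooth ψ j (U t) x‖ₑ ≤ 2 ^ (r * j) * m t

theorem smooth_zero (ψ : Space d → ℂ) (j : ℕ) : smooth ψ j 0 = 0 := by
  ext1 x; simp [smooth, conv]

/-- A mild solution is given by a function of time and space which satisfies bounds at every
time. -/
theorem IsMildSolution.exists_boundedBy (hr : r ∈ Ioo (0 : ℝ) 1) (hq1 : 1 ≤ q)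
    {χ : Space d → ℝ} (hχ : IsCutoff χ) {u₀ : 𝓢'(Space d, Vec d)}
    {u : ℝ → 𝓢'(Space d, Vec d)} (h : IsMildSolution T u₀ u) {p : ℝ≥0∞}
    (hp : ENNReal.ofReal (4 / (1 + r)) ≤ p)
    (hB : MemLpTime T (ENNReal.ofReal (2 / (1 - r))) (besovNorm χ (-r) ∞) u)
    (hL : MemLpTime T p (lqNorm (ENNReal.ofReal q)) u) :
    ∃ (A m : ℝ → ℝ≥0∞) (U : ℝ → Space d → Vec d), BoundedBy hχ.kernel r q A m U ∧
      (∀ᵐ t ∂volume.restrict (Ico 0 T), Represents (u t) (U t)) ∧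
      ∀ t ∈ Ico 0 T, ∀ φ, u t φ = heat t u₀ φ + oseenIntegral (tensSelf U) t φ := by
  obtain ⟨hr0, hr1⟩ := hr
  have hr1' : 0 < 1 - r := by linarith
  obtain ⟨V, hV, hVr, hVi⟩ := h
  obtain ⟨A₀, hA₀, hA₀e, hA₀t, hA₀i⟩ := hL.exists_measurable (e := 4 / (1 + r)) (by positivity) hp
  obtain ⟨m₀, hm₀, hm₀e, hm₀t, hm₀i⟩ := hB.exists_measurable (e := 2 / (1 - r)) (by positivity)
    le_rfl
  obtain ⟨C, hC⟩ := exists_lqNorm_lowFreq_le hr0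
  obtain ⟨W, hW, hVW⟩ := hV.aestronglyMeasurable
  have hle : ae (volume.restrict (Ico 0 T)) ≤ ae (volume.restrict (Icc 0 T)) :=
    ae_mono (Measure.restrict_mono Ico_subset_Icc_self le_rfl)
  -- `S` is a measurable set of times, of full measure, at which all the almost everywhere
  -- statements hold together. Putting `U`, `A` and `m` equal to zero off `S` makes the bounds valid
  -- at every time and the time integrals finite over the whole line.
  obtain ⟨S, hS, hSm, hSp⟩ := ((Measure.ae_ae_of_ae_prod hVW).and (hVr.and
    ((hA₀e.filter_mono hle).and ((hA₀t.filter_mono hle).and ((hm₀e.filter_mono hle).and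
      ((hm₀t.filter_mono hle).and (ae_restrict_mem measurableSet_Ico))))))).exists_measurable_mem
  have hSI : S ⊆ Icc 0 T := fun t ht => Ico_subset_Icc_self (hSp t ht).2.2.2.2.2.2
  have hU : ∀ t ∈ S, V t =ᵐ[volume] fun x => W (t, x) := fun t ht => (hSp t ht).1
  have hrep : ∀ t ∈ S, Represents (u t) fun x => W (t, x) := fun t ht =>
    (hSp t ht).2.1.congr (hU t ht)
  obtain ⟨U, hUdef⟩ : ∃ U : ℝ → Space d → Vec d,
    U = fun t x => (Prod.fst ⁻¹' S).indicator W (t, x) := ⟨_, rfl⟩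
  have hUS : ∀ t ∈ S, U t = fun x => W (t, x) := fun t ht => by
    rw [hUdef]; ext1 x; exact indicator_of_mem (show (t, x) ∈ Prod.fst ⁻¹' S from ht) _
  have hUS' : ∀ t ∉ S, U t = 0 := fun t ht => by
    rw [hUdef]; ext1 x; exact indicator_of_notMem (show (t, x) ∉ Prod.fst ⁻¹' S from ht) _
  have hUm : Measurable (Function.uncurry U) := by
    rw [hUdef]
    exact hW.measurable.indicator (measurable_fst hSm)
  have hint : ∀ {B : ℝ → ℝ≥0∞} {e : ℝ}, 0 < e → ∫⁻ t in Icc 0 T, B t ^ e ≠ ∞ →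
      ∫⁻ t, S.indicator B t ^ e ≠ ∞ := fun {B e} he hBe => by
    rw [lintegral_indicator_rpow hSm _ he]
    exact ne_top_of_le_ne_top hBe (lintegral_mono_set hSI)
  have hUle : ∀ t, eLpNorm (U t) (ENNReal.ofReal q) ≤ S.indicator A₀ t := fun t => by
    by_cases ht : t ∈ S
    · rw [hUS t ht, indicator_of_mem ht, ← (hSp t ht).2.2.1]
      exact (hrep t ht).eLpNorm_le _
    · rw [hUS' t ht, eLpNorm_zero]; exact zero_le
  have hfin : ∀ t, S.indicator A₀ t ≠ ∞ := fun t => by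
    by_cases ht : t ∈ S
    · rw [indicator_of_mem ht]; exact (hSp t ht).2.2.2.1
    · rw [indicator_of_notMem ht]; exact ENNReal.zero_ne_top
  refine ⟨S.indicator A₀, S.indicator fun t => C * m₀ t, U,
    ⟨hUm, hA₀.indicator hSm, (hm₀.const_mul _).indicator hSm, hfin, fun t => ?_,
      hint (by positivity) hA₀i, hint (by positivity) ?_, hUle, fun t j => ?_⟩, ?_, fun t ht φ => ?_⟩
  · by_cases ht : t ∈ S
    · rw [indicator_of_mem ht]
      exact ENNReal.mul_ne_top ENNReal.coe_ne_top (hSp t ht).2.2.2.2.2.1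
    · rw [indicator_of_notMem ht]; exact ENNReal.zero_ne_top
  · have he : 0 < 2 / (1 - r) := by positivity
    simp_rw [ENNReal.mul_rpow_of_nonneg _ _ he.le]
    rw [lintegral_const_mul _ (hm₀.pow_const _)]
    exact ENNReal.mul_ne_top (ENNReal.rpow_ne_top_of_nonneg he.le ENNReal.coe_ne_top) hm₀i
  · by_cases ht : t ∈ S
    · have hm : Measurable (U t) := hUm.of_uncurry_left
      have h1 : Represents (u t) (U t) := by rw [hUS t ht]; exact hrep t ht
      have h2 := (h1.lowFreq hm hq1 (ne_top_of_le_ne_top (hfin t) (hUle t)) hχ j).eLpNorm_le ∞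
      have h3 := h2.trans (hC hχ (u t) j)
      rw [eLpNorm_exponent_top] at h3
      rw [indicator_of_mem ht, ← (hSp t ht).2.2.2.2.1]
      exact (enorm_ae_le_eLpNormEssSup _ _).mono fun x hx => hx.trans h3
    · rw [hUS' t ht, smooth_zero]
      simp
  · filter_upwards [hS] with t ht
    rw [hUS t ht]; exact hrep t ht
  · rw [hVi t ht φ]
    congr 1
    refine oseenIntegral_congr ht.1 ?_ φ
    have hsub : Ioc 0 t ⊆ Ico 0 T := fun s hs => ⟨hs.1.le, hs.2.trans_lt ht.2⟩
    filter_upwards [ae_mono (Measure.restrict_mono hsub le_rfl) hS] with s hs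
    filter_upwards [hU s hs] with x hx
    have e : U s x = V s x := by rw [hUS s hs, hx]
    simp only [tensSelf, e]
    rfl

end

/-! ### The integral equation almost everywhere -/

section

variable {d : ℕ} {T q r : ℝ}

/-- By Minkowski's inequality the time integral of `‖G s x‖` is an `L^p` function of `x`, hence
finite at almost every point. -/
theorem ae_integrable_of_lintegral_eLpNorm {G : ℝ → Space d → Vec d}
    (hG : Measurable (Function.uncurry G)) {p : ℝ} (hp : 1 ≤ p) {μ : Measure ℝ} [SFinite μ]
    (h : ∫⁻ s, eLpNorm (G s) (ENNReal.ofReal p) ∂μ ≠ ∞) :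
    ∀ᵐ x, Integrable (fun s => G s x) μ := by
  have h1 := eLpNorm_lintegral_le (μ := μ) (ν := (volume : Measure (Space d)))
    (F := fun s x => ‖G s x‖ₑ) hG.enorm hp
  simp only [eLpNorm_enorm] at h1
  have h2 := ne_top_of_le_ne_top h h1
  have hm : Measurable fun x => ∫⁻ s, ‖G s x‖ₑ ∂μ := hG.enorm.lintegral_prod_left'
  rw [eLpNorm_ofReal (by linarith)] at h2
  simp only [enorm_eq_self] at h2
  have h3 : ∫⁻ x, (∫⁻ s, ‖G s x‖ₑ ∂μ) ^ p ≠ ∞ := fun h' => by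
    rw [h', ENNReal.top_rpow_of_pos (by positivity)] at h2
    exact h2 rfl
  filter_upwards [ae_ne_top_of_lintegral_rpow hm (by linarith) h3] with x hx
  exact ⟨hG.of_uncurry_right.aestronglyMeasurable, hx.lt_top⟩

/-- Minkowski's inequality in `s`. The size bound serves only to make the integral converge at
almost every point, so that increments may be taken under it; it does not enter the conclusion. -/
theorem holderBound_integral {G : ℝ → Space d → Vec d}
    (hG : Measurable (Function.uncurry G)) {p σ : ℝ} (hp : 1 ≤ p) {μ : Measure ℝ} [SFinite μ]
    {c : ℝ≥0∞} (hc : c ≠ ∞) {H : ℝ → ℝ≥0∞}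
    (h : ∀ᵐ s ∂μ, eLpNorm (G s) (ENNReal.ofReal p) ≤ c * H s ∧ HolderBound σ p (H s) (G s)) :
    HolderBound σ p (∫⁻ s, H s ∂μ) (fun x => ∫ s, G s x ∂μ) := by
  intro k
  rcases eq_or_ne k 0 with rfl | hk
  · simp
  have hk0 : ‖k‖ₑ ^ σ ≠ 0 := by
    simp [ENNReal.rpow_eq_zero_iff, hk]
  have hkt : ‖k‖ₑ ^ σ ≠ ∞ := by
    simp [ENNReal.rpow_eq_top_iff, hk]
  rcases eq_or_ne (∫⁻ s, H s ∂μ) ∞ with hH | hH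
  · rw [hH, ENNReal.mul_top hk0]; exact le_top
  have hfin : ∫⁻ s, eLpNorm (G s) (ENNReal.ofReal p) ∂μ ≠ ∞ := by
    refine ne_top_of_le_ne_top (ENNReal.mul_ne_top hc hH) ?_
    rw [← lintegral_const_mul' _ _ hc]
    exact lintegral_mono_ae (h.mono fun s hs => hs.1)
  have hint := ae_integrable_of_lintegral_eLpNorm hG hp hfin
  have hint' : ∀ᵐ x, Integrable (fun s => G s (x + k)) μ :=
    (quasiMeasurePreserving_add_right volume k).ae hint
  have hGk : Measurable (Function.uncurry fun s x => G s (x + k) - G s x) := by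
    have h1 : Measurable fun z : ℝ × Space d => (z.1, z.2 + k) := by fun_prop
    have h2 := hG.comp h1
    exact h2.sub hG
  have h2 := eLpNorm_lintegral_le (μ := μ) (ν := (volume : Measure (Space d)))
    (F := fun s x => ‖G s (x + k) - G s x‖ₑ) hGk.enorm hp
  simp only [eLpNorm_enorm] at h2
  refine (eLpNorm_mono_enorm_ae ?_).trans (h2.trans ?_)
  · filter_upwards [hint, hint'] with x hx hx'
    rw [← integral_sub hx' hx, enorm_eq_self]
    exact enorm_integral_le_lintegral_enorm _
  · rw [← lintegral_const_mul' _ _ hkt]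
    exact lintegral_mono_ae (h.mono fun s hs => hs.2 k)

theorem HolderBound.duhamel {F : ℝ → Space d → Fin d → Fin d → ℂ}
    (hF : Measurable (Function.uncurry F)) {p σ : ℝ} (hp : 1 ≤ p) {t : ℝ} {c : ℝ≥0∞} (hc : c ≠ ∞)
    {H : ℝ → ℝ≥0∞}
    (h : ∀ᵐ s ∂volume.restrict (Ioo 0 t),
      eLpNorm (heatLerayDiv (t - s) (F s)) (ENNReal.ofReal p) ≤ c * H s ∧
        HolderBound σ p (H s) (heatLerayDiv (t - s) (F s))) :
    eLpNorm (duhamel F t) (ENNReal.ofReal p) ≤ c * ∫⁻ s, H s ∧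
      HolderBound σ p (∫⁻ s, H s) (duhamel F t) := by
  have hle : ∫⁻ s in Ioc 0 t, H s ≤ ∫⁻ s, H s := setLIntegral_le_lintegral _ _
  rw [restrict_Ioo_eq_restrict_Ioc] at h
  constructor
  · refine (eLpNorm_duhamel_le hF hp t).trans (le_trans ?_ (mul_le_mul' le_rfl hle))
    rw [← lintegral_const_mul' _ _ hc]
    exact lintegral_mono_ae (h.mono fun s hs => hs.1)
  · intro k
    exact (holderBound_integral (measurable_uncurry_heatLerayDiv_sub hF t) hp hc h k).trans
      (mul_le_mul' le_rfl hle)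

/-- The forcing term is integrable in time at almost every time. -/
theorem ae_lintegral_heatLerayDiv_ne_top {F : ℝ → Space d → Fin d → Fin d → ℂ}
    (hF : Measurable (Function.uncurry F)) {p : ℝ} (hp : 1 ≤ p) (hr : r ∈ Ioo (0 : ℝ) 1)
    {f : ℝ → ℝ≥0∞} (hf : Measurable f) (hfi : ∫⁻ s in Ioc 0 T, f s ^ (2 / (1 + r)) ≠ ∞)
    (hFf : ∀ s, eLpNorm (F s) (ENNReal.ofReal p) ≤ f s) :
    ∀ᵐ t ∂volume.restrict (Ioc 0 T),
      ∫⁻ s in Ioc 0 t, eLpNorm (heatLerayDiv (t - s) (F s)) (ENNReal.ofReal p) ≠ ∞ := by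
  obtain ⟨hr0, hr1⟩ := hr
  obtain ⟨c, hc⟩ := exists_eLpNorm_heatLerayDiv_le d hp
  -- The exponents satisfy `r/2 = (1 + r)/2 + 1/2 - 1`. The bound for the Duhamel integrand is then
  -- in `L^{2/r}` in time, in particular finite at almost every time.
  obtain ⟨k, hk⟩ := exists_hardyLittlewoodSobolev (α := 1 / 2) (b := 2 / (1 + r)) (a := 2 / r)
    (by norm_num) (by norm_num) (by rw [lt_div_iff₀ (by linarith)]; linarith) (by positivity)
    (by field_simp; ring)
  have hg : Measurable ((Ioc 0 T).indicator f) := hf.indicator measurableSet_Ioc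
  have he : 0 < 2 / (1 + r) := by positivity
  have h1 : ∫⁻ s, (Ioc 0 T).indicator f s ^ (2 / (1 + r)) ≠ ∞ := by
    rwa [lintegral_indicator_rpow measurableSet_Ioc _ he]
  have h2 := ne_top_of_le_ne_top (ENNReal.mul_ne_top ENNReal.coe_ne_top
    (ENNReal.rpow_ne_top_of_nonneg (by positivity) h1)) (hk _ hg)
  have h3 : ∫⁻ t, (∫⁻ s, timeKernel (1 / 2) (t - s) * (Ioc 0 T).indicator f s) ^ (2 / r) ≠ ∞ :=
    fun h' => by
      rw [h', ENNReal.top_rpow_of_pos (by positivity)] at h2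
      exact h2 rfl
  have hm : Measurable fun t => ∫⁻ s, timeKernel (1 / 2) (t - s) * (Ioc 0 T).indicator f s := by
    have h4 : Measurable fun z : ℝ × ℝ =>
        timeKernel (1 / 2) (z.1 - z.2) * (Ioc 0 T).indicator f z.2 :=
      ((measurable_timeKernel _).comp (measurable_fst.sub measurable_snd)).mul
        (hg.comp measurable_snd)
    exact h4.lintegral_prod_right'
  have h4 := ae_ne_top_of_lintegral_rpow hm (by positivity) h3
  filter_upwards [ae_restrict_of_ae h4, ae_restrict_mem measurableSet_Ioc] with t ht htT
  refine ne_top_of_le_ne_top (ENNReal.mul_ne_top (ENNReal.coe_ne_top (r := c)) ht) ?_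
  rw [← lintegral_const_mul' _ _ ENNReal.coe_ne_top]
  refine setLIntegral_Ioc_le fun s hs0 hst => ?_
  rw [indicator_of_mem (show s ∈ Ioc 0 T from ⟨hs0, hst.le.trans htT.2⟩), ← mul_assoc]
  exact (hc _ (sub_pos.2 hst) _ hF.of_uncurry_left).trans (mul_le_mul' le_rfl (hFf s))

theorem duhamel_sub_ae {F G : ℝ → Space d → Fin d → Fin d → ℂ}
    (hF : Measurable (Function.uncurry F)) (hG : Measurable (Function.uncurry G)) {p : ℝ}
    (hp : 1 ≤ p) (hFp : ∀ s, eLpNorm (F s) (ENNReal.ofReal p) ≠ ∞)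
    (hGp : ∀ s, eLpNorm (G s) (ENNReal.ofReal p) ≠ ∞) {t : ℝ}
    (hFt : ∫⁻ s in Ioc 0 t, eLpNorm (heatLerayDiv (t - s) (F s)) (ENNReal.ofReal p) ≠ ∞)
    (hGt : ∫⁻ s in Ioc 0 t, eLpNorm (heatLerayDiv (t - s) (G s)) (ENNReal.ofReal p) ≠ ∞) :
    ∀ᵐ x, duhamel (fun s y => F s y - G s y) t x = duhamel F t x - duhamel G t x := by
  filter_upwards [ae_integrable_of_lintegral_eLpNorm (measurable_uncurry_heatLerayDiv_sub hF t) hp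
    hFt, ae_integrable_of_lintegral_eLpNorm (measurable_uncurry_heatLerayDiv_sub hG t) hp hGt]
    with x hx hx'
  rw [duhamel, duhamel, duhamel, ← integral_sub hx hx', ← restrict_Ioo_eq_restrict_Ioc]
  -- The endpoint `s = t` is discarded because linearity of `heatLerayDiv` is only available at
  -- positive heat times.
  refine setIntegral_congr_fun measurableSet_Ioo fun s hs => ?_
  exact congrFun (heatLerayDiv_sub_of_eLpNorm (sub_pos.2 hs.2) hp hF.of_uncurry_left
    hG.of_uncurry_left (hFp s) (hGp s)) x

theorem BoundedBy.eLpNorm_tensSelf_le {ψ : Space d → ℂ} {A m : ℝ → ℝ≥0∞} {U : ℝ → Space d → Vec d}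
    (h : BoundedBy ψ r q A m U) (hq : 0 < q) (s : ℝ) :
    eLpNorm (tensSelf U s) (ENNReal.ofReal (q / 2)) ≤ A s ^ (2 : ℝ) :=
  (eLpNorm_tens_self_le hq (U s)).trans (ENNReal.rpow_le_rpow (h.eLpNorm_le s) (by norm_num))

theorem BoundedBy.lintegral_sq {ψ : Space d → ℂ} {A m : ℝ → ℝ≥0∞} {U : ℝ → Space d → Vec d}
    (h : BoundedBy ψ r q A m U) : ∫⁻ s, (A s ^ (2 : ℝ)) ^ (2 / (1 + r)) ≠ ∞ := by
  simp_rw [← ENNReal.rpow_mul]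
  rw [show 2 * (2 / (1 + r)) = 4 / (1 + r) by ring]
  exact h.lintegral_left

/-- A mild solution satisfies the integral equation almost everywhere. -/
theorem BoundedBy.ae_eq {ψ : Space d → ℂ} {A m : ℝ → ℝ≥0∞} {U : ℝ → Space d → Vec d}
    (h : BoundedBy ψ r q A m U) (hr : r ∈ Ioo (0 : ℝ) 1) (hq : 2 ≤ q) {u₀ : 𝓢'(Space d, Vec d)}
    {g : Space d → Vec d} (hu₀ : Represents u₀ g) (hg : Measurable g)
    (hgq : eLpNorm g (ENNReal.ofReal q) ≠ ∞) {u : ℝ → 𝓢'(Space d, Vec d)}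
    (hu : ∀ᵐ t ∂volume.restrict (Ico 0 T), Represents (u t) (U t))
    (hmild : ∀ t ∈ Ico 0 T, ∀ φ, u t φ = heat t u₀ φ + oseenIntegral (tensSelf U) t φ) :
    ∀ᵐ t ∂volume.restrict (Ioo 0 T),
      U t =ᵐ[volume] fun x => conv (heatKernel t) g x - duhamel (tensSelf U) t x := by
  have hF := measurable_tensSelf h.measurable
  have hp : 1 ≤ q / 2 := by linarith
  have h1 := ae_lintegral_heatLerayDiv_ne_top (T := T) hF hp hr (h.measurable_left.pow_const 2)
    (ne_top_of_le_ne_top h.lintegral_sq (setLIntegral_le_lintegral _ _))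
    (h.eLpNorm_tensSelf_le (by linarith))
  have hle : ae (volume.restrict (Ioo 0 T)) ≤ ae (volume.restrict (Ico 0 T)) :=
    ae_mono (Measure.restrict_mono Ioo_subset_Ico_self le_rfl)
  have hle' : ae (volume.restrict (Ioo 0 T)) ≤ ae (volume.restrict (Ioc 0 T)) :=
    ae_mono (Measure.restrict_mono Ioo_subset_Ioc_self le_rfl)
  filter_upwards [hu.filter_mono hle, h1.filter_mono hle', ae_restrict_mem measurableSet_Ioo]
    with t ht ht1 htT
  -- Both functions represent the distribution `u t`, the second by the mild formulation.
  refine ht.ae_eq fun φ => ?_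
  obtain ⟨hi, he⟩ := integrable_and_oseenIntegral_eq hF hp htT.1.le ht1 φ
  obtain ⟨hi', he'⟩ := hu₀.heat hg (by linarith) hgq htT.1 φ
  simp only [smul_sub]
  refine ⟨hi'.sub hi, ?_⟩
  rw [integral_sub hi' hi, ← he', hmild t (Ioo_subset_Ico_self htT), he, sub_eq_add_neg]

end

/-! ### Bounds for the difference of the nonlinearities -/

section

variable {d : ℕ} {T q r σ : ℝ}

/-- Expansion around `b`: once the square of the difference is removed, each remaining term contains
`b` once and the sup bound of `v` suffices. Only the square requires the product estimate. -/
theorem enorm_tens_sub_tens_sub_tens_le (a b : Vec d) :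
    ‖tens a a - tens b b - tens (a - b) (a - b)‖ₑ ≤ 2 * ‖b‖ₑ * ‖a - b‖ₑ := by
  have e : tens a a - tens b b - tens (a - b) (a - b) = tens b (a - b) + tens (a - b) b := by
    ext j k
    simp only [tens, Pi.sub_apply, Pi.add_apply, PiLp.sub_apply]
    ring
  rw [e]
  refine (enorm_add_le _ _).trans ((add_le_add (enorm_tens_le _ _) (enorm_tens_le _ _)).trans
    (le_of_eq ?_))
  ring

theorem HolderBound.add {p : ℝ} (hp : 1 ≤ p) {N N' : ℝ≥0∞} {f g : Space d → Vec d}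
    (hfm : Measurable f) (hgm : Measurable g) (hf : HolderBound σ p N f)
    (hg : HolderBound σ p N' g) : HolderBound σ p (N + N') (fun x => f x + g x) := fun h => by
  have h1 : Measurable fun x => f (x + h) - f x := (hfm.comp (measurable_add_const h)).sub hfm
  have h2 : Measurable fun x => g (x + h) - g x := (hgm.comp (measurable_add_const h)).sub hgm
  have h3 := eLpNorm_add_le (μ := volume) h1.aestronglyMeasurable h2.aestronglyMeasurable
    (one_le_ofReal hp)
  rw [mul_add]
  refine le_trans (le_of_eq ?_) (h3.trans (add_le_add (hf h) (hg h)))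
  congr 1
  ext1 x
  simp only [Pi.add_apply]
  abel

theorem HolderBound.mono {p : ℝ} {N N' : ℝ≥0∞} {f : Space d → Vec d} (hf : HolderBound σ p N f)
    (h : N ≤ N') : HolderBound σ p N' f :=
  fun k => (hf k).trans (mul_le_mul' le_rfl h)

theorem HolderBound.congr_neg {p : ℝ} {N : ℝ≥0∞} {f g : Space d → Vec d} (hf : HolderBound σ p N f)
    (h : ∀ᵐ x, g x = -f x) : HolderBound σ p N g := fun k => by
  have h' : ∀ᵐ x, g (x + k) = -f (x + k) := (quasiMeasurePreserving_add_right volume k).ae h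
  refine le_trans (le_of_eq (eLpNorm_congr_norm_ae ?_)) (hf k)
  filter_upwards [h, h'] with x hx hx'
  rw [hx, hx', ← norm_neg]
  congr 1; abel

theorem measurable_heatLerayDiv_apply (τ : ℝ) {F : Space d → Fin d → Fin d → ℂ}
    (hF : Measurable F) : Measurable (heatLerayDiv τ F) := by
  have hs : Measurable fun z : Space d × Space d => z.2 := measurable_snd
  have h := hF.comp hs
  exact measurable_heatLerayDiv (τ := fun _ : Space d => τ) (x := fun x => x) (F := fun _ => F)
    measurable_const measurable_id h

theorem heatLerayDiv_eq_add {τ : ℝ} (hτ : 0 < τ) {p : ℝ} (hp : 1 ≤ p)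
    {F G : Space d → Fin d → Fin d → ℂ} (hF : Measurable F) (hG : Measurable G)
    (hFG : eLpNorm (fun x => F x - G x) (ENNReal.ofReal p) ≠ ∞)
    (hGp : eLpNorm G (ENNReal.ofReal p) ≠ ∞) :
    heatLerayDiv τ F =
      fun x => heatLerayDiv τ G x + heatLerayDiv τ (fun x => F x - G x) x := by
  have hFp : eLpNorm F (ENNReal.ofReal p) ≠ ∞ := by
    have h3 := eLpNorm_add_le (μ := volume) (hF.sub hG).aestronglyMeasurable
      hG.aestronglyMeasurable (one_le_ofReal hp)
    rw [sub_add_cancel] at h3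
    exact ne_top_of_le_ne_top (ENNReal.add_ne_top.2 ⟨hFG, hGp⟩) h3
  rw [heatLerayDiv_sub_of_eLpNorm hτ hp hF hG hFp hGp]
  ext1 x
  rw [add_sub_cancel]

theorem eLpNorm_tens_sub_tens_sub_tens_le {p : ℝ} (hp : 0 < p) {U v : Space d → Vec d}
    (hU : Measurable U) (hv : Measurable v) {B : ℝ≥0∞} (hvB : ∀ x, ‖v x‖ₑ ≤ B) :
    eLpNorm (fun x => tens (U x) (U x) - tens (v x) (v x) - tens (U x - v x) (U x - v x))
      (ENNReal.ofReal p) ≤ 2 * B * eLpNorm (fun x => U x - v x) (ENNReal.ofReal p) := by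
  have hw : Measurable fun x => U x - v x := hU.sub hv
  refine eLpNorm_le_const_mul hp hw (Eventually.of_forall fun x => ?_)
  exact (enorm_tens_sub_tens_sub_tens_le _ _).trans
    (mul_le_mul' (mul_le_mul' le_rfl (hvB x)) le_rfl)

/-- Bounds for `e^{τΔ} ℙ ∇(U ⊗ U - v ⊗ v)` in terms of bounds for `U - v`. -/
theorem exists_heatLerayDiv_tens_sub_tens_le {ψ : Space d → ℂ} (hψ : GoodKernel ψ)
    (h1 : ∫ x, ψ x = 1) {p : ℝ} (hp : 1 ≤ p) (hr : 0 < r) (hrσ : r < σ) (hσ1 : σ ≤ 1)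
    (hψσ : ∫⁻ y, ‖ψ y‖ₑ * ‖y‖ₑ ^ σ ≠ ∞) :
    ∃ c : ℝ≥0, ∀ (U v : Space d → Vec d) (M N B D D' : ℝ≥0∞), Measurable U → Measurable v →
      M ≠ ∞ → N ≠ ∞ → B ≠ ∞ → D ≠ ∞ → (∀ x, ‖v x‖ₑ ≤ B) →
      eLpNorm (fun x => U x - v x) (ENNReal.ofReal p) ≤ D * N →
      eLpNorm (fun x => tens (U x - v x) (U x - v x)) (ENNReal.ofReal p) ≠ ∞ →
      (∀ j : ℕ, ∀ᵐ x, ‖smooth ψ j (fun y => U y - v y) x‖ₑ ≤ 2 ^ (r * j) * M) →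
      HolderBound σ p N (fun x => U x - v x) → ∀ τ, 0 < τ → τ ≤ 1 → D ≤ D' →
      timeKernel (-(σ / 2)) τ ≤ D' →
      eLpNorm (heatLerayDiv τ fun x => tens (U x) (U x) - tens (v x) (v x)) (ENNReal.ofReal p) ≤
        D' * (c * (timeKernel ((1 + r) / 2) τ * (M * N) +
          timeKernel ((1 + σ) / 2) τ * (B * D * N))) ∧
      HolderBound σ p (c * (timeKernel ((1 + r) / 2) τ * (M * N) +
          timeKernel ((1 + σ) / 2) τ * (B * D * N)))
        (heatLerayDiv τ fun x => tens (U x) (U x) - tens (v x) (v x)) := by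
  have hp0 : 0 < p := by linarith
  have hσ : 0 < σ := hr.trans hrσ
  obtain ⟨c₁, hc₁⟩ := hψ.exists_heatLerayDiv_tens_le h1 hp hr hrσ hσ1 hψσ
  obtain ⟨c₂, hc₂⟩ := exists_eLpNorm_heatLerayDiv_le d hp
  obtain ⟨c₃, hc₃⟩ := exists_eLpNorm_heatLerayDiv_shift_le d hp hσ.le hσ1
  refine ⟨2 * (c₁ + c₂ + c₃), fun U v M N B D D' hU hv hM hN hB hD hvB hw hww hwM hwN τ hτ hτ1
    hD' hτD' => ?_⟩
  have hE0 := eLpNorm_tens_sub_tens_sub_tens_le hp0 hU hv hvB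
  obtain ⟨w, hwdef⟩ : ∃ w : Space d → Vec d, w = fun x => U x - v x := ⟨_, rfl⟩
  have hwm : Measurable w := by rw [hwdef]; exact hU.sub hv
  have hwx : ∀ x, U x - v x = w x := fun x => by rw [hwdef]
  simp only [hwx] at hw hww hwM hwN hE0
  obtain ⟨W, hW⟩ : ∃ W : Space d → Fin d → Fin d → ℂ, W = fun x => tens (w x) (w x) := ⟨_, rfl⟩
  obtain ⟨G, hG⟩ : ∃ G : Space d → Fin d → Fin d → ℂ,
    G = fun x => tens (U x) (U x) - tens (v x) (v x) := ⟨_, rfl⟩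
  have hWm : Measurable W := by rw [hW]; exact measurable_tens_comp hwm hwm
  have hGm : Measurable G := by
    rw [hG]; exact (measurable_tens_comp hU hU).sub (measurable_tens_comp hv hv)
  rw [← hG]
  have hc₁' := hc₁ w M N hwm hM hN (ne_top_of_le_ne_top (ENNReal.mul_ne_top hD hN) hw) hww hwM hwN
    τ hτ hτ1
  rw [← hW] at hww hc₁'
  have hGx : ∀ x, tens (U x) (U x) - tens (v x) (v x) = G x := fun x => by rw [hG]
  have hWx : ∀ x, tens (w x) (w x) = W x := fun x => by rw [hW]
  simp only [hGx, hWx] at hE0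
  have hEm : Measurable fun x => G x - W x := hGm.sub hWm
  have hE : eLpNorm (fun x => G x - W x) (ENNReal.ofReal p) ≤ 2 * B * (D * N) := by
    exact hE0.trans (mul_le_mul' le_rfl hw)
  have hEt : eLpNorm (fun x => G x - W x) (ENNReal.ofReal p) ≠ ∞ :=
    ne_top_of_le_ne_top (by finiteness) hE
  have hGe := heatLerayDiv_eq_add hτ hp hGm hWm hEt hww
  have hmW := measurable_heatLerayDiv_apply τ hWm
  have hmE := measurable_heatLerayDiv_apply τ hEm
  -- `D` and `D'` stand for `s^{σ/2}` and `t^{σ/2}`. The size bound is to be `D'` times the Hölder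
  -- bound, so that one majorant serves both; hence `τ^{-1/2}` is written as `τ^{σ/2} τ^{-(1+σ)/2}`.
  have htk : timeKernel (1 / 2) τ ≤ D' * timeKernel ((1 + σ) / 2) τ := by
    rw [show (1 / 2 : ℝ) = -(σ / 2) + (1 + σ) / 2 by ring, ← timeKernel_add]
    exact mul_le_mul' hτD' le_rfl
  rw [hGe]
  constructor
  · refine (eLpNorm_add_le (f := heatLerayDiv τ W) (g := heatLerayDiv τ fun x => G x - W x)
      hmW.aestronglyMeasurable hmE.aestronglyMeasurable (one_le_ofReal hp)).trans ?_
    calc _ ≤ c₁ * (timeKernel ((1 + r) / 2) τ * M * (D' * N + D' * N)) +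
          c₂ * (D' * timeKernel ((1 + σ) / 2) τ) * (2 * B * (D * N)) := by
          refine add_le_add (hc₁'.1.trans ?_) ((hc₂ τ hτ _ hEm).trans ?_)
          · gcongr
            exact hw.trans (mul_le_mul' hD' le_rfl)
          · gcongr
      _ = D' * ((2 * c₁) * (timeKernel ((1 + r) / 2) τ * (M * N)) +
          (2 * c₂) * (timeKernel ((1 + σ) / 2) τ * (B * D * N))) := by ring
      _ ≤ D' * ((2 * (c₁ + c₂ + c₃)) * (timeKernel ((1 + r) / 2) τ * (M * N)) +
          (2 * (c₁ + c₂ + c₃)) * (timeKernel ((1 + σ) / 2) τ * (B * D * N))) := by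
          gcongr
          · rw [add_assoc]; exact le_self_add
          · exact le_add_self.trans le_self_add
      _ = _ := by push_cast; ring
  · refine (HolderBound.add hp hmW hmE hc₁'.2 (hc₃ τ hτ _ hEm hEt)).mono ?_
    calc _ ≤ c₁ * (timeKernel ((1 + r) / 2) τ * M * N) +
          c₃ * timeKernel ((1 + σ) / 2) τ * (2 * B * (D * N)) := by gcongr
      _ = c₁ * (timeKernel ((1 + r) / 2) τ * (M * N)) +
          (2 * c₃) * (timeKernel ((1 + σ) / 2) τ * (B * D * N)) := by ring
      _ ≤ (2 * (c₁ + c₂ + c₃)) * (timeKernel ((1 + r) / 2) τ * (M * N)) +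
          (2 * (c₁ + c₂ + c₃)) * (timeKernel ((1 + σ) / 2) τ * (B * D * N)) := by
          gcongr
          · calc (c₁ : ℝ≥0∞) ≤ c₁ + c₂ + c₃ := by rw [add_assoc]; exact le_self_add
              _ ≤ 2 * (c₁ + c₂ + c₃) := le_mul_of_one_le_left zero_le (by norm_num)
          · exact le_add_self
      _ = _ := by push_cast; ring

/-- One step of the iteration on bounds for the difference of two solutions. -/
noncomputable def majorantStep (r σ : ℝ) (c η β : ℝ≥0∞) (m N : ℝ → ℝ≥0∞) (t : ℝ) : ℝ≥0∞ :=
  c * ((∫⁻ s, timeKernel ((1 + r) / 2) (t - s) * (m s * N s)) +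
    (η * (∫⁻ s, timeKernel ((1 + r) / 2) (t - s) * timeKernel ((1 - r) / 2) s * N s) +
      β * ∫⁻ s, timeKernel ((1 + σ) / 2) (t - s) * timeKernel ((1 - σ) / 2) s * N s))

theorem measurable_lintegral_timeKernel_mul (α : ℝ) {f : ℝ → ℝ≥0∞} (hf : Measurable f) :
    Measurable fun t => ∫⁻ s, timeKernel α (t - s) * f s := by
  have h : Measurable fun z : ℝ × ℝ => timeKernel α (z.1 - z.2) * f z.2 :=
    ((measurable_timeKernel _).comp (measurable_fst.sub measurable_snd)).mul
      (hf.comp measurable_snd)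
  exact h.lintegral_prod_right'

theorem measurable_majorantStep (r σ : ℝ) (c η β : ℝ≥0∞) {m N : ℝ → ℝ≥0∞} (hm : Measurable m)
    (hN : Measurable N) : Measurable (majorantStep r σ c η β m N) := by
  have h1 := measurable_lintegral_timeKernel_mul ((1 + r) / 2) (hm.mul hN)
  have h2 := measurable_lintegral_timeKernel_mul ((1 + r) / 2)
    ((measurable_timeKernel ((1 - r) / 2)).mul hN)
  have h3 := measurable_lintegral_timeKernel_mul ((1 + σ) / 2)
    ((measurable_timeKernel ((1 - σ) / 2)).mul hN)
  simp only [Pi.mul_apply, ← mul_assoc] at h1 h2 h3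
  unfold majorantStep
  simp only [← mul_assoc]
  exact (h1.add ((h2.const_mul η).add (h3.const_mul β))).const_mul c

theorem lintegral_eq_majorantStep (r σ : ℝ) (c η β : ℝ≥0∞) {m N : ℝ → ℝ≥0∞} (hm : Measurable m)
    (hN : Measurable N) (t : ℝ) :
    ∫⁻ s, c * (timeKernel ((1 + r) / 2) (t - s) * ((m s + η * timeKernel ((1 - r) / 2) s) * N s) +
      timeKernel ((1 + σ) / 2) (t - s) * (β * timeKernel ((1 - σ) / 2) s * N s)) =
      majorantStep r σ c η β m N t := by
  have hk : ∀ α, Measurable fun s => timeKernel α (t - s) := fun α =>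
    (measurable_timeKernel α).comp (measurable_const_sub t)
  have h1 : Measurable fun s => timeKernel ((1 + r) / 2) (t - s) * (m s * N s) :=
    (hk ((1 + r) / 2)).mul (hm.mul hN)
  have h2 : Measurable fun s => timeKernel ((1 + r) / 2) (t - s) * timeKernel ((1 - r) / 2) s * N s :=
    ((hk ((1 + r) / 2)).mul (measurable_timeKernel ((1 - r) / 2))).mul hN
  have h3 : Measurable fun s => timeKernel ((1 + σ) / 2) (t - s) * timeKernel ((1 - σ) / 2) s * N s :=
    ((hk ((1 + σ) / 2)).mul (measurable_timeKernel ((1 - σ) / 2))).mul hN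
  have e : ∀ s, c * (timeKernel ((1 + r) / 2) (t - s) *
        ((m s + η * timeKernel ((1 - r) / 2) s) * N s) +
      timeKernel ((1 + σ) / 2) (t - s) * (β * timeKernel ((1 - σ) / 2) s * N s)) =
      c * (timeKernel ((1 + r) / 2) (t - s) * (m s * N s) +
        (η * (timeKernel ((1 + r) / 2) (t - s) * timeKernel ((1 - r) / 2) s * N s) +
          β * (timeKernel ((1 + σ) / 2) (t - s) * timeKernel ((1 - σ) / 2) s * N s))) :=
    fun s => by ring
  simp_rw [e]
  rw [majorantStep, ← lintegral_const_mul η h2, ← lintegral_const_mul β h3,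
    ← lintegral_add_left (h2.const_mul η), ← lintegral_add_left h1, ← lintegral_const_mul c]
  exact h1.add ((h2.const_mul η).add (h3.const_mul β))

/-- For the first term, Hölder puts `m N` in `L^{2/(1+σ)}`, because `(1-r)/2 + (r+σ)/2 = (1+σ)/2`,
and Hardy-Littlewood-Sobolev with kernel exponent `(1+r)/2` leads back to `L^a`. The other two
kernels have degree `-1`, so Hardy's inequality applies: its condition `1/a < (1+r)/2` amounts to `σ
< 1`, and `1/a < (1+σ)/2` to `r < 1`. -/
theorem exists_lintegral_majorantStep_le (hr : 0 < r) (hrσ : r < σ) (hσ1 : σ < 1) {a : ℝ}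
    (ha : 1 / a = (r + σ) / 2) :
    ∃ K : ℝ≥0, ∀ (c η β : ℝ≥0∞) (m N : ℝ → ℝ≥0∞), Measurable m → Measurable N →
      (∫⁻ t, majorantStep r σ c η β m N t ^ a) ^ (1 / a) ≤
        K * c * ((∫⁻ s, m s ^ (2 / (1 - r))) ^ ((1 - r) / 2) + η + β) *
          (∫⁻ s, N s ^ a) ^ (1 / a) := by
  have ha0 : 0 < a := by
    have : 0 < 1 / a := by rw [ha]; linarith
    exact one_div_pos.1 this
  have ha1 : 1 ≤ a := by
    have : 1 / a < 1 := by rw [ha]; linarith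
    exact ((div_lt_one ha0).1 this).le
  have hb : 1 < 2 / (1 + σ) := by rw [lt_div_iff₀ (by linarith)]; linarith
  obtain ⟨k₁, hk₁⟩ := exists_hardyLittlewoodSobolev (α := (1 + r) / 2) (a := a) (b := 2 / (1 + σ))
    (by linarith) (by linarith) hb ha0 (by rw [ha, one_div_div]; ring)
  obtain ⟨k₂, hk₂⟩ := exists_hardy (α := (1 + r) / 2) (by linarith) ha1 (by rw [ha]; linarith)
  obtain ⟨k₃, hk₃⟩ := exists_hardy (α := (1 + σ) / 2) (by linarith) ha1 (by rw [ha]; linarith)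
  rw [show 1 - (1 + r) / 2 = (1 - r) / 2 by ring] at hk₂
  rw [show 1 - (1 + σ) / 2 = (1 - σ) / 2 by ring] at hk₃
  refine ⟨k₁ + k₂ + k₃, fun c η β m N hm hN => ?_⟩
  obtain ⟨I₁, hI₁⟩ : ∃ I : ℝ → ℝ≥0∞,
    I = fun t => ∫⁻ s, timeKernel ((1 + r) / 2) (t - s) * (m s * N s) := ⟨_, rfl⟩
  obtain ⟨I₂, hI₂⟩ : ∃ I : ℝ → ℝ≥0∞,
    I = fun t => ∫⁻ s, timeKernel ((1 + r) / 2) (t - s) * timeKernel ((1 - r) / 2) s * N s :=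
    ⟨_, rfl⟩
  obtain ⟨I₃, hI₃⟩ : ∃ I : ℝ → ℝ≥0∞,
    I = fun t => ∫⁻ s, timeKernel ((1 + σ) / 2) (t - s) * timeKernel ((1 - σ) / 2) s * N s :=
    ⟨_, rfl⟩
  have hm₁ : Measurable I₁ := by
    rw [hI₁]; exact measurable_lintegral_timeKernel_mul ((1 + r) / 2) (hm.mul hN)
  have hm₂ : Measurable I₂ := by
    have h2 := measurable_lintegral_timeKernel_mul ((1 + r) / 2)
      ((measurable_timeKernel ((1 - r) / 2)).mul hN)
    simp only [Pi.mul_apply, ← mul_assoc] at h2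
    rw [hI₂]; exact h2
  have hm₃ : Measurable I₃ := by
    have h2 := measurable_lintegral_timeKernel_mul ((1 + σ) / 2)
      ((measurable_timeKernel ((1 - σ) / 2)).mul hN)
    simp only [Pi.mul_apply, ← mul_assoc] at h2
    rw [hI₃]; exact h2
  have hscale : ∀ (c : ℝ≥0∞) {f : ℝ → ℝ≥0∞}, Measurable f →
      (∫⁻ t, (c * f t) ^ a) ^ (1 / a) = c * (∫⁻ t, f t ^ a) ^ (1 / a) := fun c f hf => by
    simp_rw [ENNReal.mul_rpow_of_nonneg _ _ ha0.le]
    rw [lintegral_const_mul _ (hf.pow_const _), ENNReal.mul_rpow_of_nonneg _ _ (by positivity),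
      ← ENNReal.rpow_mul, mul_one_div_cancel ha0.ne', ENNReal.rpow_one]
  have hadd : ∀ {f g : ℝ → ℝ≥0∞}, Measurable f → Measurable g →
      (∫⁻ t, (f t + g t) ^ a) ^ (1 / a) ≤
        (∫⁻ t, f t ^ a) ^ (1 / a) + (∫⁻ t, g t ^ a) ^ (1 / a) := fun hf hg =>
    ENNReal.lintegral_Lp_add_le hf.aemeasurable hg.aemeasurable ha1
  have hstep : ∀ t, majorantStep r σ c η β m N t = c * (I₁ t + (η * I₂ t + β * I₃ t)) := fun t => by
    rw [hI₁, hI₂, hI₃]; rfl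
  have hmN : (∫⁻ s, (m s * N s) ^ (2 / (1 + σ))) ^ (1 / (2 / (1 + σ))) ≤
      (∫⁻ s, m s ^ (2 / (1 - r))) ^ ((1 - r) / 2) * (∫⁻ s, N s ^ a) ^ (1 / a) := by
    have hr1 : 0 < 1 - r := by linarith
    have hσ : 0 < 1 + σ := by linarith
    have hrs : 0 < r + σ := by linarith
    have h1 := ENNReal.lintegral_mul_norm_pow_le (μ := volume)
      (hm.pow_const (2 / (1 - r))).aemeasurable (hN.pow_const a).aemeasurable
      (p := (1 - r) / (1 + σ)) (q := (r + σ) / (1 + σ)) (by positivity) (by positivity)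
      (by field_simp; ring)
    have e : ∀ s, (m s * N s) ^ (2 / (1 + σ)) =
        (m s ^ (2 / (1 - r))) ^ ((1 - r) / (1 + σ)) * (N s ^ a) ^ ((r + σ) / (1 + σ)) := fun s => by
      rw [ENNReal.mul_rpow_of_nonneg _ _ (by positivity), ← ENNReal.rpow_mul, ← ENNReal.rpow_mul]
      congr 2
      · field_simp
      · have : a = 2 / (r + σ) := by
          rw [← one_div_one_div a, ha, one_div_div]
        rw [this]; field_simp
    simp_rw [e]
    refine (ENNReal.rpow_le_rpow h1 (by positivity)).trans (le_of_eq ?_)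
    rw [ENNReal.mul_rpow_of_nonneg _ _ (by positivity), ← ENNReal.rpow_mul, ← ENNReal.rpow_mul]
    congr 2
    · field_simp
    · rw [ha]; field_simp
  simp_rw [hstep]
  have hm₂' : Measurable fun t => η * I₂ t := hm₂.const_mul η
  have hm₃' : Measurable fun t => β * I₃ t := hm₃.const_mul β
  have hm₂₃ : Measurable fun t => η * I₂ t + β * I₃ t := hm₂'.add hm₃'
  have hm₁₂₃ : Measurable fun t => I₁ t + (η * I₂ t + β * I₃ t) := hm₁.add hm₂₃
  rw [hscale c hm₁₂₃]
  have key₁ := (hk₁ (fun s => m s * N s) (hm.mul hN)).trans (mul_le_mul' le_rfl hmN)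
  have key₂ := hk₂ N hN
  have key₃ := hk₃ N hN
  obtain ⟨Y, hY⟩ : ∃ Y, Y = (∫⁻ s, N s ^ a) ^ (1 / a) := ⟨_, rfl⟩
  obtain ⟨X, hX⟩ : ∃ X, X = (∫⁻ s, m s ^ (2 / (1 - r))) ^ ((1 - r) / 2) := ⟨_, rfl⟩
  have e₁ : (∫⁻ t, I₁ t ^ a) ^ (1 / a) ≤ k₁ * (X * Y) := by rw [hI₁, hX, hY]; exact key₁
  have e₂ : (∫⁻ t, I₂ t ^ a) ^ (1 / a) ≤ k₂ * Y := by rw [hI₂, hY]; exact key₂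
  have e₃ : (∫⁻ t, I₃ t ^ a) ^ (1 / a) ≤ k₃ * Y := by rw [hI₃, hY]; exact key₃
  rw [← hX, ← hY]
  calc _ ≤ c * (k₁ * (X * Y) + (η * (k₂ * Y) + β * (k₃ * Y))) := by
        refine mul_le_mul' le_rfl ((hadd hm₁ hm₂₃).trans (add_le_add e₁
          ((hadd hm₂' hm₃').trans (add_le_add ?_ ?_))))
        · rw [hscale η hm₂]; exact mul_le_mul' le_rfl e₂
        · rw [hscale β hm₃]; exact mul_le_mul' le_rfl e₃
    _ ≤ c * ((k₁ + k₂ + k₃) * (X * Y) + (η * ((k₁ + k₂ + k₃) * Y) +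
          β * ((k₁ + k₂ + k₃) * Y))) := by
        gcongr
        · rw [add_assoc]; exact le_self_add
        · exact le_add_self.trans le_self_add
        · exact le_add_self
    _ = _ := by push_cast; ring

end

/-! ### Majorants for the difference of two solutions -/

section

variable {d : ℕ} {T q r σ : ℝ}

/-- `N` controls the size and the Hölder seminorm of `w` at almost every time in `]0, δ]`. -/
def IsMajorant (σ p δ : ℝ) (w : ℝ → Space d → Vec d) (N : ℝ → ℝ≥0∞) : Prop :=
  ∀ᵐ t ∂volume.restrict (Ioc 0 δ),
    eLpNorm (w t) (ENNReal.ofReal p) ≤ timeKernel (-(σ / 2)) t * N t ∧ HolderBound σ p (N t) (w t)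

theorem timeKernel_neg_half_mono (hσ : 0 ≤ σ) {s t : ℝ} (hs : 0 < s) (hst : s ≤ t) :
    timeKernel (-(σ / 2)) s ≤ timeKernel (-(σ / 2)) t := by
  rw [timeKernel_of_pos hs, timeKernel_of_pos (hs.trans_le hst), neg_neg]
  exact ENNReal.ofReal_le_ofReal (Real.rpow_le_rpow hs.le hst (by positivity))

/-- The forcing term for the difference of two solutions. -/
def tensDiff (U v : ℝ → Space d → Vec d) : ℝ → Space d → Fin d → Fin d → ℂ :=
  fun s y => tensSelf U s y - tensSelf v s y

theorem measurable_tensDiff {U v : ℝ → Space d → Vec d} (hU : Measurable (Function.uncurry U))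
    (hv : Measurable (Function.uncurry v)) : Measurable (Function.uncurry (tensDiff U v)) :=
  (measurable_tensSelf hU).sub (measurable_tensSelf hv)

/-- `U - v` is minus the Duhamel term of the difference of the nonlinearities. -/
def SolvesDifference (δ : ℝ) (U v : ℝ → Space d → Vec d) : Prop :=
  ∀ᵐ t ∂volume.restrict (Ioc 0 δ), ∀ᵐ x, U t x - v t x = -duhamel (tensDiff U v) t x

/-- Bounds for the Duhamel integrand at each pair `s < t` integrate to a majorant by Minkowski's
inequality; the weight in the size bound depends on `t` alone and leaves the integral. -/
theorem IsMajorant.of_duhamel {U v : ℝ → Space d → Vec d} (hU : Measurable (Function.uncurry U))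
    (hv : Measurable (Function.uncurry v)) {p δ : ℝ} (hp : 1 ≤ p) (hUv : SolvesDifference δ U v)
    {N : ℝ → ℝ≥0∞} {H : ℝ → ℝ → ℝ≥0∞} (hN : ∀ t, ∫⁻ s, H t s = N t)
    (h : ∀ᵐ s ∂volume.restrict (Ioc 0 δ), ∀ t, 0 < s → s < t → t ≤ δ →
      eLpNorm (heatLerayDiv (t - s) (tensDiff U v s)) (ENNReal.ofReal p) ≤
        timeKernel (-(σ / 2)) t * H t s ∧
      HolderBound σ p (H t s) (heatLerayDiv (t - s) (tensDiff U v s))) :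
    IsMajorant σ p δ (fun t x => U t x - v t x) N := by
  filter_upwards [hUv, ae_restrict_mem measurableSet_Ioc] with t ht htδ
  have h1 : ∀ᵐ s ∂volume.restrict (Ioo 0 t),
      eLpNorm (heatLerayDiv (t - s) (tensDiff U v s)) (ENNReal.ofReal p) ≤
        timeKernel (-(σ / 2)) t * H t s ∧
      HolderBound σ p (H t s) (heatLerayDiv (t - s) (tensDiff U v s)) := by
    have hsub : Ioo 0 t ⊆ Ioc 0 δ := fun s hs => ⟨hs.1, hs.2.le.trans htδ.2⟩
    filter_upwards [h.filter_mono (ae_mono (Measure.restrict_mono hsub le_rfl)),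
      ae_restrict_mem measurableSet_Ioo] with s hs hst
    exact hs t hst.1 hst.2 htδ.2
  obtain ⟨h2, h3⟩ := HolderBound.duhamel (measurable_tensDiff hU hv) hp (timeKernel_ne_top _ _) h1
  rw [hN t] at h2 h3
  refine ⟨le_trans (le_of_eq (eLpNorm_congr_norm_ae ?_)) h2, h3.congr_neg ht⟩
  filter_upwards [ht] with x hx
  rw [hx, norm_neg]

/-- At time `s` the difference obeys a Besov bound with constant `m s + η s^{-(1-r)/2}`, the first
part inherited from `U` and the second from `v` by interpolation. The mixed terms bring the sup
bound `b s^{-1/2}` multiplied by the size `s^{σ/2} N s`, which is the kernel `s^{-(1-σ)/2}`. -/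
theorem exists_isMajorant_majorantStep (hr : r ∈ Ioo (0 : ℝ) 1) (hrσ : r < σ) (hσ1 : σ < 1)
    (hq : (d : ℝ) ≤ q) (hq2 : 2 ≤ q) {ψ : Space d → ℂ} (hψ : GoodKernel ψ) (h1 : ∫ x, ψ x = 1)
    (hψσ : ∫⁻ y, ‖ψ y‖ₑ * ‖y‖ₑ ^ σ ≠ ∞) :
    ∃ c C : ℝ≥0, ∀ (A m : ℝ → ℝ≥0∞) (U v : ℝ → Space d → Vec d) (b R : ℝ≥0) (δ : ℝ)
      (N : ℝ → ℝ≥0∞), BoundedBy ψ r q A m U → KatoBall q b R v → δ ≤ 1 →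
      SolvesDifference δ U v → Measurable N → (∀ᵐ s, N s ≠ ∞) →
      IsMajorant σ (q / 2) δ (fun t x => U t x - v t x) N →
      IsMajorant σ (q / 2) δ (fun t x => U t x - v t x)
        (majorantStep r σ c (C * ((R : ℝ≥0∞) ^ r * (b : ℝ≥0∞) ^ (1 - r))) b
          ((Ioc 0 δ).indicator m) N) := by
  obtain ⟨hr0, hr1⟩ := hr
  have hp : 1 ≤ q / 2 := by linarith
  have hq1 : 1 ≤ q := by linarith
  have hσ0 : 0 < σ := hr0.trans hrσ
  obtain ⟨c, hc⟩ := exists_heatLerayDiv_tens_sub_tens_le hψ h1 hp hr0 hrσ hσ1.le hψσ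
  obtain ⟨C, hC⟩ := exists_enorm_smooth_le hψ hq hq1 hr0 hr1
  refine ⟨c, C, fun A m U v b R δ N hU hv hδ hUv hNm hNt hN => ?_⟩
  obtain ⟨η, hη⟩ : ∃ η : ℝ≥0∞, η = C * ((R : ℝ≥0∞) ^ r * (b : ℝ≥0∞) ^ (1 - r)) := ⟨_, rfl⟩
  have hηt : η ≠ ∞ := by
    rw [hη]
    exact ENNReal.mul_ne_top ENNReal.coe_ne_top (ENNReal.mul_ne_top
      (ENNReal.rpow_ne_top_of_nonneg hr0.le ENNReal.coe_ne_top)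
      (ENNReal.rpow_ne_top_of_nonneg (by linarith) ENNReal.coe_ne_top))
  rw [← hη]
  refine IsMajorant.of_duhamel hU.measurable hv.measurable hp hUv
    (fun t => lintegral_eq_majorantStep r σ c η b (hU.measurable_right.indicator measurableSet_Ioc)
      hNm t) ?_
  filter_upwards [hN, ae_restrict_of_ae hNt, ae_restrict_mem measurableSet_Ioc] with s hs hst hsδ
  intro t hs0 hst' ht
  have hUm : Measurable (U s) := hU.measurable.of_uncurry_left
  have hvm : Measurable (v s) := hv.measurable_apply s
  have hUq : eLpNorm (U s) (ENNReal.ofReal q) ≠ ∞ :=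
    ne_top_of_le_ne_top (hU.left_ne_top s) (hU.eLpNorm_le s)
  have hvq : eLpNorm (v s) (ENNReal.ofReal q) ≠ ∞ :=
    ne_top_of_le_ne_top ENNReal.coe_ne_top (hv.eLpNorm_le s)
  have hwq : eLpNorm (fun x => U s x - v s x) (ENNReal.ofReal q) ≠ ∞ :=
    ne_top_of_le_ne_top (ENNReal.add_ne_top.2 ⟨hUq, hvq⟩) (eLpNorm_sub_le
      hUm.aestronglyMeasurable hvm.aestronglyMeasurable (one_le_ofReal hq1))
  have hww := ne_top_of_le_ne_top (ENNReal.rpow_ne_top_of_nonneg (by norm_num) hwq)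
    (eLpNorm_tens_self_le (by linarith : 0 < q) (fun x => U s x - v s x))
  have hsm : ∀ j : ℕ, ∀ᵐ x, ‖smooth ψ j (fun y => U s y - v s y) x‖ₑ ≤
      2 ^ (r * j) * (m s + η * timeKernel ((1 - r) / 2) s) := fun j => by
    filter_upwards [hU.smooth_le s j] with x hx
    rw [hψ.smooth_sub hq1 hUm hUq hvm hvq, mul_add]
    refine enorm_sub_le.trans (add_le_add hx ((hC (v s) R _ hvm (hv.bound s) (hv.eLpNorm_le s)
      j x).trans (le_of_eq ?_)))
    rw [hη, ENNReal.mul_rpow_of_nonneg _ _ (by linarith), timeKernel_rpow (by linarith),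
      show (1 / 2 : ℝ) * (1 - r) = (1 - r) / 2 by ring]
    ring
  have hMt : m s + η * timeKernel ((1 - r) / 2) s ≠ ∞ :=
    ENNReal.add_ne_top.2 ⟨hU.right_ne_top s, ENNReal.mul_ne_top hηt (timeKernel_ne_top _ _)⟩
  have key := hc (U s) (v s) _ (N s) (b * timeKernel (1 / 2) s) (timeKernel (-(σ / 2)) s)
    (timeKernel (-(σ / 2)) t) hUm hvm hMt hst
    (ENNReal.mul_ne_top ENNReal.coe_ne_top (timeKernel_ne_top _ _)) (timeKernel_ne_top _ _)
    (hv.bound s) hs.1 hww hsm hs.2 (t - s) (sub_pos.2 hst') (by linarith)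
    (timeKernel_neg_half_mono hσ0.le hs0 hst'.le)
    (timeKernel_neg_half_mono hσ0.le (sub_pos.2 hst') (by linarith))
  have e : (b : ℝ≥0∞) * timeKernel (1 / 2) s * timeKernel (-(σ / 2)) s * N s =
      b * timeKernel ((1 - σ) / 2) s * N s := by
    rw [mul_assoc (b : ℝ≥0∞), timeKernel_add, show (1 / 2 : ℝ) + -(σ / 2) = (1 - σ) / 2 by ring]
  rw [e] at key
  rw [indicator_of_mem hsδ]
  exact key

/-- The iteration needs a starting point with finite `L^a` norm, small or not. The tensor squares
are in `L^{2/(1+r)}` in time with values in `L^{q/2}`; the kernel costs `(1+σ)/2` for increments of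
order `σ`, and Hardy-Littlewood-Sobolev gives exactly `1/a = (1+r)/2 + (1+σ)/2 - 1`. -/
theorem exists_isMajorant (hr : r ∈ Ioo (0 : ℝ) 1) (hrσ : r < σ) (hσ1 : σ < 1) (hq2 : 2 ≤ q)
    {a : ℝ} (ha : 1 / a = (r + σ) / 2) {ψ : Space d → ℂ} {A m : ℝ → ℝ≥0∞}
    {U v : ℝ → Space d → Vec d} {b R : ℝ≥0} {δ : ℝ} (hU : BoundedBy ψ r q A m U)
    (hv : KatoBall q b R v) (hUv : SolvesDifference δ U v) :
    ∃ N : ℝ → ℝ≥0∞, Measurable N ∧ ∫⁻ t, N t ^ a ≠ ∞ ∧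
      IsMajorant σ (q / 2) δ (fun t x => U t x - v t x) N := by
  obtain ⟨hr0, hr1⟩ := hr
  have hp : 1 ≤ q / 2 := by linarith
  have hq0 : 0 < q := by linarith
  have hσ0 : 0 < σ := hr0.trans hrσ
  have ha0 : 0 < a := by
    have : 0 < 1 / a := by rw [ha]; linarith
    exact one_div_pos.1 this
  obtain ⟨c₂, hc₂⟩ := exists_eLpNorm_heatLerayDiv_le d hp
  obtain ⟨c₃, hc₃⟩ := exists_eLpNorm_heatLerayDiv_shift_le d hp hσ0.le hσ1.le
  have hb : 1 < 2 / (1 + r) := by rw [lt_div_iff₀ (by linarith)]; linarith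
  obtain ⟨k, hk⟩ := exists_hardyLittlewoodSobolev (α := (1 + σ) / 2) (a := a) (b := 2 / (1 + r))
    (by linarith) (by linarith) hb ha0 (by rw [ha, one_div_div]; ring)
  obtain ⟨f, hf⟩ : ∃ f : ℝ → ℝ≥0∞, f = fun s => A s ^ (2 : ℝ) + (R : ℝ≥0∞) ^ (2 : ℝ) := ⟨_, rfl⟩
  have hfm : Measurable f := by rw [hf]; exact (hU.measurable_left.pow_const 2).add_const _
  have hgm : Measurable ((Ioc 0 δ).indicator f) := hfm.indicator measurableSet_Ioc
  have hGf : ∀ s, eLpNorm (tensDiff U v s) (ENNReal.ofReal (q / 2)) ≤ f s := fun s => by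
    have h1 : Measurable (tensSelf U s) := (measurable_tensSelf hU.measurable).of_uncurry_left
    have h2 : Measurable (tensSelf v s) := (measurable_tensSelf hv.measurable).of_uncurry_left
    rw [hf]
    refine (eLpNorm_sub_le h1.aestronglyMeasurable h2.aestronglyMeasurable
      (one_le_ofReal hp)).trans (add_le_add (hU.eLpNorm_tensSelf_le hq0 s) ?_)
    exact (eLpNorm_tens_self_le hq0 (v s)).trans
      (ENNReal.rpow_le_rpow (hv.eLpNorm_le s) (by norm_num))
  have hft : ∀ s, f s ≠ ∞ := fun s => by
    rw [hf]
    exact ENNReal.add_ne_top.2 ⟨ENNReal.rpow_ne_top_of_nonneg (by norm_num) (hU.left_ne_top s),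
      ENNReal.rpow_ne_top_of_nonneg (by norm_num) ENNReal.coe_ne_top⟩
  have hfi : ∫⁻ s, (Ioc 0 δ).indicator f s ^ (2 / (1 + r)) ≠ ∞ := by
    have he : 1 ≤ 2 / (1 + r) := hb.le
    rw [lintegral_indicator_rpow measurableSet_Ioc _ (by linarith), hf]
    have h1 : ∀ s, (A s ^ (2 : ℝ) + (R : ℝ≥0∞) ^ (2 : ℝ)) ^ (2 / (1 + r)) ≤
        2 ^ (2 / (1 + r) - 1) * ((A s ^ (2 : ℝ)) ^ (2 / (1 + r)) +
          ((R : ℝ≥0∞) ^ (2 : ℝ)) ^ (2 / (1 + r))) := fun s =>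
      ENNReal.rpow_add_le_mul_rpow_add_rpow _ _ he
    refine ne_top_of_le_ne_top ?_ (lintegral_mono h1)
    rw [lintegral_const_mul' _ _ (two_rpow_ne_top _), lintegral_add_right _ measurable_const,
      lintegral_const, Measure.restrict_apply_univ]
    refine ENNReal.mul_ne_top (two_rpow_ne_top _) (ENNReal.add_ne_top.2 ⟨?_, ?_⟩)
    · exact ne_top_of_le_ne_top hU.lintegral_sq (setLIntegral_le_lintegral _ _)
    · exact ENNReal.mul_ne_top (ENNReal.rpow_ne_top_of_nonneg (by linarith)
        (ENNReal.rpow_ne_top_of_nonneg (by norm_num) ENNReal.coe_ne_top)) measure_Ioc_lt_top.ne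
  have hNm := measurable_lintegral_timeKernel_mul ((1 + σ) / 2) hgm
  have hkm : ∀ t, Measurable fun s => timeKernel ((1 + σ) / 2) (t - s) * (Ioc 0 δ).indicator f s :=
    fun t => ((measurable_timeKernel _).comp (measurable_const_sub t)).mul hgm
  refine ⟨fun t => (c₂ + c₃ : ℝ≥0) * ∫⁻ s, timeKernel ((1 + σ) / 2) (t - s) *
    (Ioc 0 δ).indicator f s, hNm.const_mul _, ?_, ?_⟩
  · simp_rw [ENNReal.mul_rpow_of_nonneg _ _ ha0.le]
    rw [lintegral_const_mul _ (hNm.pow_const _)]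
    refine ENNReal.mul_ne_top (ENNReal.rpow_ne_top_of_nonneg ha0.le ENNReal.coe_ne_top) fun h' => ?_
    have h2 := hk _ hgm
    rw [h', ENNReal.top_rpow_of_pos (by positivity)] at h2
    exact ENNReal.mul_ne_top ENNReal.coe_ne_top
      (ENNReal.rpow_ne_top_of_nonneg (by positivity) hfi) (top_le_iff.1 h2)
  · refine IsMajorant.of_duhamel hU.measurable hv.measurable hp hUv
      (H := fun t s => (c₂ + c₃ : ℝ≥0) * (timeKernel ((1 + σ) / 2) (t - s) *
        (Ioc 0 δ).indicator f s)) (fun t => lintegral_const_mul _ (hkm t)) ?_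
    filter_upwards [ae_restrict_mem measurableSet_Ioc] with s hsδ
    intro t hs0 hst ht
    have hτ : 0 < t - s := sub_pos.2 hst
    have hGm : Measurable (tensDiff U v s) :=
      (measurable_tensDiff hU.measurable hv.measurable).of_uncurry_left
    rw [indicator_of_mem hsδ]
    constructor
    · refine (hc₂ _ hτ _ hGm).trans ?_
      have htk : timeKernel (1 / 2) (t - s) ≤
          timeKernel (-(σ / 2)) t * timeKernel ((1 + σ) / 2) (t - s) := by
        rw [show (1 / 2 : ℝ) = -(σ / 2) + (1 + σ) / 2 by ring, ← timeKernel_add]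
        exact mul_le_mul' (timeKernel_neg_half_mono hσ0.le hτ (by linarith)) le_rfl
      calc _ ≤ ((c₂ + c₃ : ℝ≥0) : ℝ≥0∞) * (timeKernel (-(σ / 2)) t *
            timeKernel ((1 + σ) / 2) (t - s)) * f s := by
            gcongr
            · exact le_self_add
            · exact hGf s
        _ = _ := by ring
    · refine (hc₃ _ hτ _ hGm (ne_top_of_le_ne_top (hft s) (hGf s))).mono ?_
      rw [← mul_assoc]
      gcongr
      · exact le_add_self
      · exact hGf s

end

/-! ### Uniqueness by contraction of majorants -/

section

variable {d : ℕ} {T q r σ : ℝ}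

/-- A contraction on majorants forces the function to vanish. -/
theorem ae_eq_zero_of_isMajorant {p δ a : ℝ} (hp : 0 < p) (ha : 0 < a)
    {w : ℝ → Space d → Vec d} (hw : ∀ t, Measurable (w t)) {Φ : (ℝ → ℝ≥0∞) → ℝ → ℝ≥0∞}
    (hΦm : ∀ N, Measurable N → Measurable (Φ N))
    (hΦ : ∀ N, Measurable N → (∀ᵐ s, N s ≠ ∞) → IsMajorant σ p δ w N → IsMajorant σ p δ w (Φ N))
    (hΦa : ∀ N, Measurable N →
      (∫⁻ t, Φ N t ^ a) ^ (1 / a) ≤ 2⁻¹ * (∫⁻ t, N t ^ a) ^ (1 / a))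
    {N : ℝ → ℝ≥0∞} (hN : Measurable N) (hNa : ∫⁻ t, N t ^ a ≠ ∞) (hNw : IsMajorant σ p δ w N) :
    ∀ᵐ t ∂volume.restrict (Ioc 0 δ), w t =ᵐ[volume] 0 := by
  obtain ⟨M, hM⟩ : ∃ M : ℕ → ℝ → ℝ≥0∞, M = fun n => Φ^[n] N := ⟨_, rfl⟩
  have hM0 : M 0 = N := by rw [hM]; rfl
  have hMs : ∀ n, M (n + 1) = Φ (M n) := fun n => by
    rw [hM]; exact Function.iterate_succ_apply' _ _ _
  have hNa' : (∫⁻ t, N t ^ a) ^ (1 / a) ≠ ∞ := ENNReal.rpow_ne_top_of_nonneg (by positivity) hNa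
  have key : ∀ n, Measurable (M n) ∧ IsMajorant σ p δ w (M n) ∧
      (∫⁻ t, M n t ^ a) ^ (1 / a) ≤ 2⁻¹ ^ n * (∫⁻ t, N t ^ a) ^ (1 / a) := fun n => by
    induction n with
    | zero => rw [hM0, pow_zero, one_mul]; exact ⟨hN, hNw, le_rfl⟩
    | succ n ih =>
      obtain ⟨h1, h2, h3⟩ := ih
      rw [hMs]
      refine ⟨hΦm _ h1, hΦ _ h1 (ae_ne_top_of_lintegral_rpow h1 ha fun h' => ?_) h2,
        (hΦa _ h1).trans ?_⟩
      · rw [h', ENNReal.top_rpow_of_pos (by positivity), top_le_iff] at h3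
        exact ENNReal.mul_ne_top (ENNReal.pow_ne_top (by simp)) hNa' h3
      · rw [pow_succ', mul_assoc]
        exact mul_le_mul' le_rfl h3
  have hlim : Tendsto (fun n : ℕ => (2⁻¹ : ℝ≥0∞) ^ n * (∫⁻ t, N t ^ a) ^ (1 / a)) atTop (𝓝 0) := by
    have := ENNReal.Tendsto.mul_const (b := (∫⁻ t, N t ^ a) ^ (1 / a))
      (ENNReal.tendsto_pow_atTop_nhds_zero_of_lt_one (r := 2⁻¹) (by simp)) (Or.inr hNa')
    rwa [zero_mul] at this
  -- Each iterate bounds `w` off its own null set, and there are countably many of them. So the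
  -- infimum still bounds the size of `w`, while its `L^a` norm is zero.
  have hPm : Measurable fun t => ⨅ n, M n t := Measurable.iInf fun n => (key n).1
  have h0 : (∫⁻ t, (⨅ n, M n t) ^ a) ^ (1 / a) = 0 := by
    refine le_antisymm (ge_of_tendsto' hlim fun n => ?_) zero_le
    refine le_trans (ENNReal.rpow_le_rpow (lintegral_mono fun t => ?_) (by positivity)) (key n).2.2
    exact ENNReal.rpow_le_rpow (iInf_le _ n) ha.le
  rw [ENNReal.rpow_eq_zero_iff_of_pos (by positivity), lintegral_eq_zero_iff (hPm.pow_const _)] at h0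
  have hall := ae_all_iff.2 fun n => (key n).2.1
  filter_upwards [hall, ae_restrict_of_ae h0] with t ht ht0
  rw [Pi.zero_apply, ENNReal.rpow_eq_zero_iff_of_pos ha] at ht0
  have h1 : eLpNorm (w t) (ENNReal.ofReal p) ≤ 0 := by
    calc _ ≤ ⨅ n, timeKernel (-(σ / 2)) t * M n t := le_iInf fun n => (ht n).1
      _ = timeKernel (-(σ / 2)) t * ⨅ n, M n t := by
          rw [ENNReal.mul_iInf]
          · exact fun h => absurd h (timeKernel_ne_top _ _)
      _ = 0 := by rw [ht0, mul_zero]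
  exact (eLpNorm_eq_zero_iff (hw t).aestronglyMeasurable (by simpa using hp)).1
    (le_antisymm h1 zero_le)

/-- On `L^a` the factor of the majorant step is `K c` times the norm of `m` on `]0, δ]` plus `C R^r
b^{1-r}` plus `b`. Each of the three products is made at most `1/6`: the last two by the choice of
`ε`, which does not involve `U`, and the first by shortening the interval, through absolute
continuity of the integral. -/
theorem exists_ae_eq_of_katoBall (hr : r ∈ Ioo (0 : ℝ) 1) (hq : (d : ℝ) ≤ q) (hq2 : 2 ≤ q)
    {ψ : Space d → ℂ} (hψ : GoodKernel ψ) (h1 : ∫ x, ψ x = 1)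
    (hψσ : ∀ σ : ℝ, 0 ≤ σ → σ ≤ 1 → ∫⁻ y, ‖ψ y‖ₑ * ‖y‖ₑ ^ σ ≠ ∞) (R : ℝ≥0) :
    ∃ ε : ℝ≥0∞, ε ≠ 0 ∧ ∀ (b : ℝ≥0) (v : ℝ → Space d → Vec d) (δ₀ : ℝ), (b : ℝ≥0∞) ≤ ε →
      KatoBall q b R v → 0 < δ₀ → δ₀ ≤ 1 → ∀ (A m : ℝ → ℝ≥0∞) (U : ℝ → Space d → Vec d),
      BoundedBy ψ r q A m U → SolvesDifference δ₀ U v →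
      ∃ δ, 0 < δ ∧ δ ≤ δ₀ ∧ ∀ᵐ t ∂volume.restrict (Ioc 0 δ), U t =ᵐ[volume] v t := by
  have ⟨hr0, hr1⟩ := hr
  -- Any value strictly between `r` and `1` would do.
  obtain ⟨σ, hσ⟩ : ∃ σ, σ = (1 + r) / 2 := ⟨_, rfl⟩
  have hrσ : r < σ := by linarith
  have hσ1 : σ < 1 := by linarith
  obtain ⟨a, ha'⟩ : ∃ a, a = 2 / (r + σ) := ⟨_, rfl⟩
  have ha : 1 / a = (r + σ) / 2 := by rw [ha', one_div_div]
  have ha0 : 0 < a := by rw [ha']; exact div_pos two_pos (by linarith)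
  obtain ⟨c, C, hstep⟩ := exists_isMajorant_majorantStep (d := d) hr hrσ hσ1 hq hq2 hψ h1
    (hψσ σ (by linarith) hσ1.le)
  obtain ⟨K, hK⟩ := exists_lintegral_majorantStep_le hr0 hrσ hσ1 ha
  have hKt : (K * c * (C * (R : ℝ≥0∞) ^ r) : ℝ≥0∞) ≠ ∞ :=
    ENNReal.mul_ne_top (ENNReal.mul_ne_top ENNReal.coe_ne_top ENNReal.coe_ne_top)
      (ENNReal.mul_ne_top ENNReal.coe_ne_top
        (ENNReal.rpow_ne_top_of_nonneg hr0.le ENNReal.coe_ne_top))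
  have hKc : (K * c : ℝ≥0∞) ≠ ∞ := ENNReal.mul_ne_top ENNReal.coe_ne_top ENNReal.coe_ne_top
  have h6 : (6⁻¹ : ℝ≥0∞) ≠ 0 := by simp
  obtain ⟨ε, hε0, hε1, hε2⟩ := exists_nnreal_pos_of_eventually
    ((eventually_mul_rpow_le hKt (s := 1 - r) (by linarith) h6).and
      (eventually_mul_rpow_le hKc one_pos h6))
  obtain ⟨ε', hε'0, hε'⟩ := exists_nnreal_pos_of_eventually
    (eventually_mul_rpow_le hKc (s := (1 - r) / 2) (by linarith) h6)
  rw [ENNReal.rpow_one] at hε2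
  refine ⟨ε, by simpa using hε0.ne', fun b v δ₀ hb hv hδ₀ hδ₀1 A m U hU hUv => ?_⟩
  obtain ⟨δ₁, hδ₁0, hδ₁⟩ := exists_pos_setLIntegral_lt_of_measure_lt hU.lintegral_right
    (ε := ε') (by simpa using hε'0.ne')
  obtain ⟨δ₂, hδ₂, hδ₂1⟩ : ∃ δ₂ : ℝ, 0 < δ₂ ∧ ENNReal.ofReal δ₂ < δ₁ := by
    obtain ⟨x, hx0, hx1⟩ := ENNReal.lt_iff_exists_nnreal_btwn.1 hδ₁0
    exact ⟨x, by simpa using hx0, by simpa using hx1⟩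
  have hδ0 : 0 < min δ₀ δ₂ := lt_min hδ₀ hδ₂
  refine ⟨min δ₀ δ₂, hδ0, min_le_left _ _, ?_⟩
  obtain ⟨δ, hδ⟩ : ∃ δ, δ = min δ₀ δ₂ := ⟨_, rfl⟩
  rw [← hδ]
  have hδδ₀ : δ ≤ δ₀ := hδ ▸ min_le_left _ _
  have hUv' : SolvesDifference δ U v :=
    hUv.filter_mono (ae_mono (Measure.restrict_mono (Ioc_subset_Ioc_right hδδ₀) le_rfl))
  have hmδ : Measurable ((Ioc 0 δ).indicator m) := hU.measurable_right.indicator measurableSet_Ioc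
  have hm : ∫⁻ s, (Ioc 0 δ).indicator m s ^ (2 / (1 - r)) ≤ ε' := by
    rw [lintegral_indicator_rpow measurableSet_Ioc _ (div_pos two_pos (by linarith))]
    refine (hδ₁ _ ?_).le
    rw [Real.volume_Ioc, sub_zero]
    exact (ENNReal.ofReal_le_ofReal (hδ ▸ min_le_right _ _)).trans_lt hδ₂1
  obtain ⟨N, hN, hNa, hNw⟩ := exists_isMajorant hr hrσ hσ1 hq2 ha hU hv hUv'
  have hwm : ∀ t, Measurable fun x => U t x - v t x := fun t =>
    (hU.measurable.of_uncurry_left).sub (hv.measurable_apply t)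
  have hzero := ae_eq_zero_of_isMajorant (w := fun t x => U t x - v t x)
    (Φ := majorantStep r σ c (C * ((R : ℝ≥0∞) ^ r * (b : ℝ≥0∞) ^ (1 - r))) b ((Ioc 0 δ).indicator m))
    (by linarith : 0 < q / 2) ha0 hwm (fun N hN => measurable_majorantStep r σ _ _ _ hmδ hN)
    (fun N hN hNt hNw => hstep A m U v b R δ N hU hv (hδδ₀.trans hδ₀1) hUv' hN hNt hNw)
    (fun N hN => (hK _ _ _ _ N hmδ hN).trans (mul_le_mul' ?_ le_rfl)) hN hNa hNw
  · filter_upwards [hzero] with t ht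
    filter_upwards [ht] with x hx
    exact sub_eq_zero.1 hx
  · calc _ ≤ (K * c : ℝ≥0∞) * ((ε' : ℝ≥0∞) ^ ((1 - r) / 2) +
          C * ((R : ℝ≥0∞) ^ r * (ε : ℝ≥0∞) ^ (1 - r)) + ε) := by gcongr
      _ = K * c * (ε' : ℝ≥0∞) ^ ((1 - r) / 2) +
          K * c * (C * (R : ℝ≥0∞) ^ r) * (ε : ℝ≥0∞) ^ (1 - r) + K * c * ε := by ring
      _ ≤ 6⁻¹ + 6⁻¹ + 6⁻¹ := add_le_add (add_le_add hε' hε1) hε2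
      _ = 3 * 6⁻¹ := by ring
      _ = 2⁻¹ := by
        rw [show (6 : ℝ≥0∞) = 3 * 2 by norm_num, ENNReal.mul_inv (by simp) (by simp), ← mul_assoc,
          ENNReal.mul_inv_cancel (by simp) (by simp), one_mul]

end

/-! ### The difference equation -/

section

variable {d : ℕ} {T q r : ℝ}

/-- The two integral equations are subtracted; the heat flows cancel because `g` is the same.
Linearity of the Duhamel term is legitimate at the times where both integrals converge, that is, at
almost every time. -/
theorem BoundedBy.solvesDifference {ψ : Space d → ℂ} {A m : ℝ → ℝ≥0∞}
    {U v : ℝ → Space d → Vec d} (hU : BoundedBy ψ r q A m U) (hr : r ∈ Ioo (0 : ℝ) 1) (hq : 2 ≤ q)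
    {b R : ℝ≥0} (hv : KatoBall q b R v) {g : Space d → Vec d} {δ : ℝ}
    (hvg : ∀ t, 0 < t → t ≤ δ → ∀ x, v t x = conv (heatKernel t) g x - duhamel (tensSelf v) t x)
    (hUg : ∀ᵐ t ∂volume.restrict (Ioc 0 δ),
      U t =ᵐ[volume] fun x => conv (heatKernel t) g x - duhamel (tensSelf U) t x) :
    SolvesDifference δ U v := by
  have hp : 1 ≤ q / 2 := by linarith
  have hq0 : 0 < q := by linarith
  have hUm := measurable_tensSelf hU.measurable
  have hvm := measurable_tensSelf hv.measurable
  have hvR : ∀ s, eLpNorm (tensSelf v s) (ENNReal.ofReal (q / 2)) ≤ (R : ℝ≥0∞) ^ (2 : ℝ) :=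
    fun s => (eLpNorm_tens_self_le hq0 (v s)).trans
      (ENNReal.rpow_le_rpow (hv.eLpNorm_le s) (by norm_num))
  have hRt : (R : ℝ≥0∞) ^ (2 : ℝ) ≠ ∞ := ENNReal.rpow_ne_top_of_nonneg (by norm_num)
    ENNReal.coe_ne_top
  have h1 := ae_lintegral_heatLerayDiv_ne_top (T := δ) hUm hp hr (hU.measurable_left.pow_const 2)
    (ne_top_of_le_ne_top hU.lintegral_sq (setLIntegral_le_lintegral _ _))
    (hU.eLpNorm_tensSelf_le hq0)
  have h2 := ae_lintegral_heatLerayDiv_ne_top (T := δ) hvm hp hr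
    (f := fun _ => (R : ℝ≥0∞) ^ (2 : ℝ)) measurable_const (by
      rw [lintegral_const, Measure.restrict_apply_univ]
      exact ENNReal.mul_ne_top (ENNReal.rpow_ne_top_of_nonneg
        (div_nonneg zero_le_two (by linarith [hr.1])) hRt) measure_Ioc_lt_top.ne) hvR
  filter_upwards [h1, h2, hUg, ae_restrict_mem measurableSet_Ioc] with t ht1 ht2 htU ht
  have h3 := duhamel_sub_ae hUm hvm hp
    (fun s => ne_top_of_le_ne_top (ENNReal.rpow_ne_top_of_nonneg (by norm_num) (hU.left_ne_top s))
      (hU.eLpNorm_tensSelf_le hq0 s)) (fun s => ne_top_of_le_ne_top hRt (hvR s)) ht1 ht2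
  filter_upwards [h3, htU] with x hx hxU
  rw [hxU, hvg t ht.1 ht.2]
  unfold tensDiff
  rw [hx]
  abel

end

end NavierStokes

/-! ### Local uniqueness. -/

open NavierStokes
theorem proposition4p1 (d : ℕ) (hd : 2 ≤ d) (χ : Space d → ℝ) (hχ : IsCutoff χ)
    (T : ℝ) (hT : 0 < T) (r : ℝ) (hr : r ∈ Ioo (0 : ℝ) 1) (q : ℝ) (hq : (d : ℝ) ≤ q)
    (p : ℝ≥0∞) (hp : ENNReal.ofReal (4 / (1 + r)) ≤ p)
    (u₀ : 𝓢'(Space d, Vec d)) (hu₀ : lqNorm (ENNReal.ofReal q) u₀ < ∞)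
    (u₁ u₂ : ℝ → 𝓢'(Space d, Vec d))
    (h₁ : IsMildSolution T u₀ u₁) (h₂ : IsMildSolution T u₀ u₂)
    (hB₁ : MemLpTime T (ENNReal.ofReal (2 / (1 - r))) (besovNorm χ (-r) ∞) u₁)
    (hB₂ : MemLpTime T (ENNReal.ofReal (2 / (1 - r))) (besovNorm χ (-r) ∞) u₂)
    (hL₁ : MemLpTime T p (lqNorm (ENNReal.ofReal q)) u₁)
    (hL₂ : MemLpTime T p (lqNorm (ENNReal.ofReal q)) u₂) :
    ∃ δ ∈ Ioo 0 T, ∀ t ∈ Icc 0 δ, u₁ t = u₂ t := by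
  have hq2 : 2 ≤ q := le_trans (by exact_mod_cast hd) hq
  have hq1 : 1 ≤ q := by linarith
  obtain ⟨g₀, hg₀, hg₀r, -⟩ := exists_represents_of_lqNorm_lt_top hu₀
  obtain ⟨g, hg, hgg₀⟩ := hg₀.1
  have hgr : Represents u₀ g := hg₀r.congr hgg₀
  have hgq : eLpNorm g (ENNReal.ofReal q) ≠ ∞ := by
    rw [← eLpNorm_congr_ae hgg₀]; exact hg₀.2.ne
  have hgm : Measurable g := hg.measurable
  obtain ⟨A₁, m₁, U₁, hU₁, hu₁, he₁⟩ := h₁.exists_boundedBy hr hq1 hχ hp hB₁ hL₁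
  obtain ⟨A₂, m₂, U₂, hU₂, hu₂, he₂⟩ := h₂.exists_boundedBy hr hq1 hχ hp hB₂ hL₂
  obtain ⟨R, hR⟩ := exists_katoSolution hq hq1 hgm hgq
  obtain ⟨ε, hε, huniq⟩ := exists_ae_eq_of_katoBall hr hq hq2 (goodKernel_of_schwartz hχ.kernel)
    hχ.integral_kernel (fun σ h0 h1 => lintegral_enorm_schwartz_mul_rpow_ne_top hχ.kernel h0 h1) R
  -- The order of choices matters: `R` comes from the data, the threshold `ε` from `R`, and only
  -- then `v`. The same `v` serves both solutions.
  obtain ⟨δ', hδ'0, hδ'1, b, v, hb, hv, hvg⟩ := hR ε hε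
  obtain ⟨δ₀, hδ₀⟩ : ∃ δ₀, δ₀ = min δ' (T / 2) := ⟨_, rfl⟩
  have hδ₀0 : 0 < δ₀ := hδ₀ ▸ lt_min hδ'0 (by linarith)
  have hδ₀δ' : δ₀ ≤ δ' := hδ₀ ▸ min_le_left _ _
  have hδ₀T : δ₀ < T := lt_of_le_of_lt (hδ₀ ▸ min_le_right _ _ : δ₀ ≤ T / 2) (by linarith)
  have hsub : ae (volume.restrict (Ioc 0 δ₀)) ≤ ae (volume.restrict (Ioo 0 T)) :=
    ae_mono (Measure.restrict_mono (Ioc_subset_Ioo_right hδ₀T) le_rfl)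
  have huniq' : ∀ {A m : ℝ → ℝ≥0∞} {U : ℝ → Space d → Vec d} {u : ℝ → 𝓢'(Space d, Vec d)},
      BoundedBy hχ.kernel r q A m U →
      (∀ᵐ t ∂volume.restrict (Ico 0 T), Represents (u t) (U t)) →
      (∀ t ∈ Ico 0 T, ∀ φ, u t φ = heat t u₀ φ + oseenIntegral (tensSelf U) t φ) →
      ∃ δ, 0 < δ ∧ δ ≤ δ₀ ∧ ∀ᵐ t ∂volume.restrict (Ioc 0 δ), U t =ᵐ[volume] v t :=
    fun {A m U u} hU hu he => by
      have h := hU.ae_eq hr hq2 hgr hgm hgq hu he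
      exact huniq b v δ₀ hb hv hδ₀0 (hδ₀δ'.trans hδ'1) A m U hU
        (hU.solvesDifference hr hq2 hv (fun t ht htδ => hvg t ht (htδ.trans hδ₀δ'))
          (h.filter_mono hsub))
  obtain ⟨δ₁, hδ₁0, hδ₁, hv₁⟩ := huniq' hU₁ hu₁ he₁
  obtain ⟨δ₂, hδ₂0, hδ₂, hv₂⟩ := huniq' hU₂ hu₂ he₂
  refine ⟨min δ₁ δ₂, ⟨lt_min hδ₁0 hδ₂0, ((min_le_left _ _).trans hδ₁).trans_lt hδ₀T⟩,
    fun t ht => ?_⟩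
  have ht1 : t ≤ δ₁ := ht.2.trans (min_le_left _ _)
  have ht2 : t ≤ δ₂ := ht.2.trans (min_le_right _ _)
  have htT : t ∈ Ico 0 T := ⟨ht.1, (ht1.trans hδ₁).trans_lt hδ₀T⟩
  -- The mild formulation expresses `u₁ t` and `u₂ t` through the data and the past on `]0, t]`,
  -- where both solutions equal `v` almost everywhere. This reaches every `t`, including `t = 0`,
  -- where the integral is empty.
  ext1 φ
  rw [he₁ t htT, he₂ t htT]
  congr 1
  refine oseenIntegral_congr ht.1 ?_ φ
  filter_upwards [hv₁.filter_mono (ae_mono (Measure.restrict_mono (Ioc_subset_Ioc_right ht1) le_rfl)),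
    hv₂.filter_mono (ae_mono (Measure.restrict_mono (Ioc_subset_Ioc_right ht2) le_rfl))]
    with s hs1 hs2
  filter_upwards [hs1, hs2] with x hx1 hx2
  simp only [tensSelf, hx1, hx2]
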